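/- **Setting.** Let $2\le d=d_A\le d_B$, $\mathcal H_{AB}=\mathbb C^{d_A}\otimes\mathbb C^{d_B}$, and $|\Phi\rangle=\frac1{\sqrt d}\sum_{j=0}^{d-1}|jj\rangle$. For a pure state $|\Psi\rangle\in\mathcal H_{AB}$ let $s_0\ge s_1\ge\dots\ge s_{d-1}\ge 0$ be its Schmidt coefficients, so $|\Psi\rangle=\sum_j\sqrt{s_j}\,|\psi^A_j\rangle\otimes|\psi^B_j\rangle$ with orthonormal $\{|\psi^A_j\rangle\}$, $\{|\psi^B_j\rangle\}$, and let $\mathcal E_r(\Psi)=\sum_{j=r}^{d-1}s_j$. For a density operator $\sigma$ let $\mathcal E_r(\sigma)$ be the infimum of $\sum_l p_l\mathcal E_r(\Psi_l)$ over all convex decompositions $\sigma=\sum_l p_l|\Psi_l\rangle\langle\Psi_l|$ into pure states. Let $\mathcal S_r$ be the set of convex combinations of pure states with at most $r$ nonzero Schmidt coefficients, and $\mathcal S_{\mathcal E_r}(E)$ the set of density operators $\sigma$ with $\mathcal E_r(\sigma)\le E$. A verification operator of $|\Psi\rangle$ is an operator $\Omega=\sum_l p_l\Pi_l$ with $(p_l)$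 a probability distribution, $0\le\Pi_l\le\mathbb 1$ and $\Pi_l|\Psi\rangle=|\Psi\rangle$. It is local if the measurement $\{\Omega,\mathbb 1-\Omega\}$ can be realized by a finite-round LOCC (local operations and classical communication) protocol; separable if $\Omega$ and $\mathbb 1-\Omega$ are both nonnegative multiples of separable states; homogeneous if $\Omega=|\Psi\rangle\langle\Psi|+\beta(\mathbb 1-|\Psi\rangle\langle\Psi|)$ for some $\beta\in[0,1)$. For a set $\mathcal S$ of states let $$P_{\mathrm{LC}}(\Psi,\mathcal S)=\inf_\Omega\,\sup_{\sigma\in\mathcal S}\operatorname{tr}(\Omega\sigma),$$ the infimum being over all local verification operators of $|\Psi\rangle$; $P_{\mathrm{sep}}$ is defined in the same way with separable instead of local verification operators, and $P^{\mathrm H}_{\mathrm{LC}}$, $P^{\mathrm H}_{\mathrm{sep}}$ by restricting in addition to homogeneous $\Omega$. A function $f$ of pure states in $\mathcal H_{AB}$ is Schur convex if it is invariant under local unitary transformations and $f(\Psi)\le f(\Upsilon)$ whenever the Schmidt vector of $|\Psi\rangle$ is majorized by that of $|\Upsilon\rangle$. **Theorem.** Let $r\in\{1,\dots,d-1\}$,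 $0\le E<(d-r)/d$, and $\mathcal S=\mathcal S_r$ or $\mathcal S=\mathcal S_{\mathcal E_r}(E)$. Then $P_{\mathrm{LC}}(\Psi,\mathcal S)$ and $P_{\mathrm{sep}}(\Psi,\mathcal S)$ are Schur convex in $|\Psi\rangle$, and they do not decrease under LOCC: if some finite-round LOCC channel maps the pure state $|\Psi\rangle\langle\Psi|$ to the pure state $|\Upsilon\rangle\langle\Upsilon|$ on $\mathcal H_{AB}$, then $P_{\mathrm{LC}}(\Psi,\mathcal S)\le P_{\mathrm{LC}}(\Upsilon,\mathcal S)$ and $P_{\mathrm{sep}}(\Psi,\mathcal S)\le P_{\mathrm{sep}}(\Upsilon,\mathcal S)$. In addition, for every pure state $|\Psi\rangle\in\mathcal H_{AB}$, $$P_{\mathrm{LC}}(\Phi,\mathcal S)=P_{\mathrm{sep}}(\Phi,\mathcal S)\le P_{\mathrm{sep}}(\Psi,\mathcal S)\le P_{\mathrm{LC}}(\Psi,\mathcal S),$$ $$P_{\mathrm{LC}}(\Phi,\mathcal S)=P_{\mathrm{sep}}(\Phi,\mathcal S)\le P^{\mathrm H}_{\mathrm{sep}}(\Psi,\mathcal S)\le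 P^{\mathrm H}_{\mathrm{LC}}(\Psi,\mathcal S).$$ -/

import Mathlib

open scoped ComplexOrder Kronecker Matrix

noncomputable section

namespace EntCert

/-! Vectors of the bipartite space `ℂ^a ⊗ ℂ^b` are functions on `Fin a × Fin b`, and operators are
matrices indexed by `Fin a × Fin b`. -/

/-- Vectors of `ℂ^a ⊗ ℂ^b`, in the computational basis. -/
abbrev Vec (a b : ℕ) : Type := Fin a × Fin b → ℂ

/-- Operators on `ℂ^a ⊗ ℂ^b`. -/
abbrev Op (a b : ℕ) : Type := Matrix (Fin a × Fin b) (Fin a × Fin b) ℂ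

variable {a b : ℕ}

/-- `Ψ` is a (normalized) pure state. -/
def IsPure (Ψ : Vec a b) : Prop := ∑ i, ‖Ψ i‖ ^ 2 = 1

/-- The operator `|Ψ⟩⟨Ψ|`. -/
def proj (Ψ : Vec a b) : Op a b := Matrix.vecMulVec Ψ (star Ψ)

/-- The set of density operators. -/
def states (a b : ℕ) : Set (Op a b) := {σ | σ.PosSemidef ∧ σ.trace = 1}

/-! ### Schmidt coefficients and majorization -/

/-- The partial trace over the second factor. -/
def partialTraceB (ρ : Op a b) : Matrix (Fin a) (Fin a) ℂ :=
  Matrix.of fun i i' => ∑ j, ρ (i, j) (i', j)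

theorem isHermitian_partialTraceB_proj (Ψ : Vec a b) : (partialTraceB (proj Ψ)).IsHermitian := by
  ext i i'
  simp [partialTraceB, proj, Matrix.vecMulVec_apply, mul_comm]

/-- The nonincreasing rearrangement of a real vector. -/
def sortDesc {d : ℕ} (x : Fin d → ℝ) : Fin d → ℝ :=
  fun i => x (Tuple.sort (fun j => -x j) i)

theorem antitone_sortDesc {d : ℕ} (x : Fin d → ℝ) : Antitone (sortDesc x) := by
  intro i j hij
  have h := Tuple.monotone_sort (fun j => -x j) hij
  simpa [sortDesc] using h

/-- The Schmidt vector of `Ψ`: the Schmidt coefficients (the squares of the coefficients `√s_j` of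
a Schmidt decomposition, which are the eigenvalues of the reduced state `tr_B |Ψ⟩⟨Ψ|`), with
multiplicity and in nonincreasing order. -/
def schmidtVector (Ψ : Vec a b) : Fin a → ℝ :=
  sortDesc (isHermitian_partialTraceB_proj Ψ).eigenvalues

/-- The Schmidt rank: the number of nonzero Schmidt coefficients. -/
def schmidtRank (Ψ : Vec a b) : ℕ :=
  (Finset.univ.filter fun j : Fin a => schmidtVector Ψ j ≠ 0).card

/-- `x` is majorized by `y`. -/
def Majorized {d : ℕ} (x y : Fin d → ℝ) : Prop :=
  (∀ k : Fin d, ∑ j ∈ Finset.Iic k, sortDesc x j ≤ ∑ j ∈ Finset.Iic k, sortDesc y j) ∧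
    ∑ j, sortDesc x j = ∑ j, sortDesc y j

/-- A function of bipartite pure states is Schur convex if it is invariant under local unitary
transformations and monotone with respect to majorization of Schmidt vectors. -/
def SchurConvex (f : Vec a b → ℝ) : Prop :=
  (∀ U ∈ Matrix.unitaryGroup (Fin a) ℂ, ∀ V ∈ Matrix.unitaryGroup (Fin b) ℂ,
    ∀ Ψ : Vec a b, IsPure Ψ → f ((U ⊗ₖ V) *ᵥ Ψ) = f Ψ) ∧
  ∀ Ψ Υ : Vec a b, IsPure Ψ → IsPure Υ →
    Majorized (schmidtVector Ψ) (schmidtVector Υ) → f Ψ ≤ f Υ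

/-- The maximally entangled state `∑_j |jj⟩ / √a` (for `a ≤ b`). -/
def maxEnt (a b : ℕ) : Vec a b :=
  fun p => if (p.1 : ℕ) = (p.2 : ℕ) then (((Real.sqrt a)⁻¹ : ℝ) : ℂ) else 0

/-! ### States with limited entanglement -/

/-- The set `𝒮_r` of convex combinations of pure states of Schmidt rank at most `r`. -/
def schmidtSet (a b r : ℕ) : Set (Op a b) :=
  convexHull ℝ {σ | ∃ Ψ : Vec a b, IsPure Ψ ∧ schmidtRank Ψ ≤ r ∧ σ = proj Ψ}

/-- `ℰ_r(Ψ)`: the sum of the Schmidt coefficients `s_j` with `j ≥ r` (indices from `0`). -/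
def entPure (r : ℕ) (Ψ : Vec a b) : ℝ :=
  ∑ j ∈ Finset.univ.filter (fun j : Fin a => r ≤ (j : ℕ)), schmidtVector Ψ j

/-- The convex roof `ℰ_r(σ)`: the infimum of the average of `ℰ_r` over all convex decompositions
of `σ` into pure states. -/
def entMixed (r : ℕ) (σ : Op a b) : ℝ :=
  sInf {x | ∃ (L : ℕ) (p : Fin L → ℝ) (Ψ : Fin L → Vec a b),
    (∀ l, 0 ≤ p l) ∧ ∑ l, p l = 1 ∧ (∀ l, IsPure (Ψ l)) ∧
    ∑ l, (p l : ℂ) • proj (Ψ l) = σ ∧ x = ∑ l, p l * entPure r (Ψ l)}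

/-- The set `𝒮_{ℰ_r}(E)`. -/
def entSet (a b r : ℕ) (E : ℝ) : Set (Op a b) := {σ ∈ states a b | entMixed r σ ≤ E}

/-- The set of separable states: convex combinations of pure product states. -/
def sepStates (a b : ℕ) : Set (Op a b) :=
  convexHull ℝ {σ | ∃ (ψ : Fin a → ℂ) (φ : Fin b → ℂ), IsPure (fun p : Fin a × Fin b => ψ p.1 * φ p.2) ∧
    σ = proj (fun p : Fin a × Fin b => ψ p.1 * φ p.2)}

/-! ### LOCC -/

/-- Finite-round LOCC protocols from `ℂ^a ⊗ ℂ^b` to `ℂ^a' ⊗ ℂ^b'` with classical output in `κ`.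
Either the protocol stops with an output, or one of the parties performs a local quantum
measurement (given by Kraus operators `K i`, the dimension of the resulting local system may
depend on the outcome `i`), announces the outcome `i`, and the rest of the protocol depends on it.
Local randomness, ancillas and discarding are special cases of such a measurement; outcomes are
forgotten by giving different branches the same output. -/
inductive LOCC (κ : Type) (a' b' : ℕ) : ℕ → ℕ → Type
  | done (k : κ) : LOCC κ a' b' a' b'
  | alice {a b : ℕ} (N : ℕ) (c : Fin N → ℕ) (K : ∀ i, Matrix (Fin (c i)) (Fin a) ℂ)
      (hK : ∑ i, (K i)ᴴ * K i = 1) (next : ∀ i, LOCC κ a' b' (c i) b) : LOCC κ a' b' a b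
  | bob {a b : ℕ} (N : ℕ) (c : Fin N → ℕ) (K : ∀ i, Matrix (Fin (c i)) (Fin b) ℂ)
      (hK : ∑ i, (K i)ᴴ * K i = 1) (next : ∀ i, LOCC κ a' b' a (c i)) : LOCC κ a' b' a b

/-- The unnormalized final state of the protocol, given the classical output `k`. -/
def LOCC.instrument {κ : Type} [DecidableEq κ] {a' b' : ℕ} :
    {a b : ℕ} → LOCC κ a' b' a b → κ → Op a b → Op a' b'
  | _, _, .done k', k, σ => if k' = k then σ else 0
  | _, b, .alice N _ K _ next, k, σ => ∑ i : Fin N, (next i).instrument k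
      ((K i ⊗ₖ (1 : Matrix (Fin b) (Fin b) ℂ)) * σ * (K i ⊗ₖ (1 : Matrix (Fin b) (Fin b) ℂ))ᴴ)
  | a, _, .bob N _ K _ next, k, σ => ∑ i : Fin N, (next i).instrument k
      (((1 : Matrix (Fin a) (Fin a) ℂ) ⊗ₖ K i) * σ * ((1 : Matrix (Fin a) (Fin a) ℂ) ⊗ₖ K i)ᴴ)

/-- The pure state `Ψ` is transformed into the pure state `Υ` by some LOCC channel. -/
def LOCCTransforms (Ψ Υ : Vec a b) : Prop :=
  ∃ Λ : LOCC Unit a b a b, Λ.instrument () (proj Ψ) = proj Υ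

/-- A function of bipartite pure states does not decrease under LOCC. -/
def LOCCNondecreasing (f : Vec a b → ℝ) : Prop :=
  ∀ Ψ Υ : Vec a b, IsPure Ψ → IsPure Υ → LOCCTransforms Ψ Υ → f Ψ ≤ f Υ

/-! ### Verification strategies and separation probabilities -/

/-- `T` is the passing effect of a binary test `{T, 1 - T}` that `Ψ` passes with certainty. -/
def IsTest (Ψ : Vec a b) (T : Op a b) : Prop :=
  T.PosSemidef ∧ (1 - T).PosSemidef ∧ T *ᵥ Ψ = Ψ

/-- `Ω = ∑_l p_l Π_l` for a random choice of tests `Π_l` of `Ψ`. -/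
def IsVerificationOperator (Ψ : Vec a b) (Ω : Op a b) : Prop :=
  ∃ (L : ℕ) (p : Fin L → ℝ) (T : Fin L → Op a b),
    (∀ l, 0 ≤ p l) ∧ ∑ l, p l = 1 ∧ (∀ l, IsTest Ψ (T l)) ∧ Ω = ∑ l, (p l : ℂ) • T l

/-- The verification operators are exactly the passing effects of tests of `Ψ`. -/
theorem isVerificationOperator_iff (Ψ : Vec a b) (Ω : Op a b) :
    IsVerificationOperator Ψ Ω ↔ IsTest Ψ Ω := by
  constructor
  · rintro ⟨L, p, T, hp, hsum, hT, rfl⟩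
    have hsum' : ∑ l, (p l : ℂ) = 1 := by exact_mod_cast hsum
    have hp' : ∀ l, (0 : ℂ) ≤ (p l : ℂ) := fun l => by exact_mod_cast hp l
    refine ⟨Matrix.posSemidef_sum _ fun l _ => (hT l).1.smul (hp' l), ?_, ?_⟩
    · have h : (1 : Op a b) - ∑ l, (p l : ℂ) • T l = ∑ l, (p l : ℂ) • (1 - T l) := by
        simp only [smul_sub, Finset.sum_sub_distrib, ← Finset.sum_smul, hsum', one_smul]
      rw [h]
      exact Matrix.posSemidef_sum _ fun l _ => (hT l).2.1.smul (hp' l)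
    · rw [Matrix.sum_mulVec]
      simp only [Matrix.smul_mulVec, (hT _).2.2, ← Finset.sum_smul, hsum', one_smul]
  · intro h
    exact ⟨1, fun _ => 1, fun _ => Ω, by simp, by simp, fun _ => h, by simp⟩

/-- The strategy with operator `Ω` can be realized by LOCC: some LOCC protocol answers `true`
("pass") with probability `tr(Ω σ)` on every state `σ` (the random choice of the test is a part
of the protocol). -/
def IsLocal (Ω : Op a b) : Prop :=
  ∃ (a' b' : ℕ) (P : LOCC Bool a' b' a b),
    ∀ σ ∈ states a b, (P.instrument true σ).trace = (Ω * σ).trace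

/-- Both `Ω` and `1 - Ω` are proportional to separable states. -/
def IsSeparable (Ω : Op a b) : Prop :=
  (∃ c : ℝ, 0 ≤ c ∧ ∃ σ ∈ sepStates a b, Ω = (c : ℂ) • σ) ∧
    ∃ c : ℝ, 0 ≤ c ∧ ∃ σ ∈ sepStates a b, 1 - Ω = (c : ℂ) • σ

/-- `Ω` is homogeneous with respect to `Ψ`. -/
def IsHomogeneous (Ψ : Vec a b) (Ω : Op a b) : Prop :=
  ∃ β : ℝ, 0 ≤ β ∧ β < 1 ∧ Ω = proj Ψ + (β : ℂ) • (1 - proj Ψ)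

/-- `P_Ω(S) = max_{σ ∈ S} tr(Ω σ)`. -/
def passProb (Ω : Op a b) (S : Set (Op a b)) : ℝ :=
  sSup ((fun σ : Op a b => (Ω * σ).trace.re) '' S)

/-- The separation probability over local strategies. -/
def PLC (Ψ : Vec a b) (S : Set (Op a b)) : ℝ :=
  sInf {x | ∃ Ω, IsVerificationOperator Ψ Ω ∧ IsLocal Ω ∧ x = passProb Ω S}

/-- The separation probability over separable strategies. -/
def Psep (Ψ : Vec a b) (S : Set (Op a b)) : ℝ :=
  sInf {x | ∃ Ω, IsVerificationOperator Ψ Ω ∧ IsSeparable Ω ∧ x = passProb Ω S}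

/-- The separation probability over local homogeneous strategies. -/
def PLCH (Ψ : Vec a b) (S : Set (Op a b)) : ℝ :=
  sInf {x | ∃ Ω, IsVerificationOperator Ψ Ω ∧ IsHomogeneous Ψ Ω ∧ IsLocal Ω ∧ x = passProb Ω S}

/-- The separation probability over separable homogeneous strategies. -/
def PsepH (Ψ : Vec a b) (S : Set (Op a b)) : ℝ :=
  sInf {x | ∃ Ω, IsVerificationOperator Ψ Ω ∧ IsHomogeneous Ψ Ω ∧ IsSeparable Ω ∧ x = passProb Ω S}

end EntCert

end

open scoped ComplexOrder Kronecker Matrix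
noncomputable section
namespace EntCert
variable {a b : ℕ}
-- Only two properties of the set `S` enter the comparison: it consists of states, and it is closed
-- under channels with finitely many product Kraus operators (`KrausClosed`). Everything is proved
-- for such sets in `separation_probabilities`.
--
-- Monotonicity is a Heisenberg-picture argument. If an LOCC channel takes Ψ to Υ, its dual pulls
-- every test of Υ back to a test of Ψ. The pulled-back test is again local (run the channel, then
-- the protocol) or separable (conjugation by product operators preserves product vectors), and
-- closedness of `S` ensures that it passes `S` no more often. Schur convexity follows, because
-- majorization of Schmidt vectors implies LOCC convertibility (Nielsen,
-- `LOCCTransforms.of_majorized`) and local unitaries are reversible. Since the flat Schmidt vector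
-- is majorized by all others, Φ minimizes the separable quantity.
--
-- Closedness of `S` is linear algebra for the coefficient matrix, on which A ⊗ B acts as M ↦ A M
-- Bᵀ. Rank cannot grow, which settles the sets of bounded Schmidt rank. For the convex roof, the
-- tail of the Schmidt vector equals the squared distance to vectors of Schmidt rank at most r
-- (Eckart-Young, `entPure_le_normSq_sub`). Product Kraus operators carry approximants to
-- approximants and preserve the total squared error, so the roof does not increase.
--
-- For Φ, the local and separable values agree because (1 + d|Φ⟩⟨Φ|)/(d+1), supported on the d × d
-- block, is both one-way LOCC and optimal among separable tests. Locality: it is an average of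
-- local rotations U ⊗ Ū of the test that compares computational basis outcomes. Optimality:
-- compress a separable test to the block and twirl it to s + t d|Φ⟩⟨Φ|. Fixing Φ gives s + td = 1,
-- and separability forces the trace to be at least d, hence s ≥ 1/(d+1); the pass probability is
-- smallest at equality. Twirling uses finite averages only (cube-root-of-unity phases,
-- permutations, the Fourier matrix), phrased through convex invariant sets
-- (`TwirlClosed.exists_isotropic_mem`).
--
-- The homogeneous infima range over smaller sets, so what has to be shown is that these are
-- nonempty: 1 - |Ψ⟩⟨Ψ| is separable (`isSepCone_one_sub_proj`), and 1 - εX is one-way LOCC for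
-- separable X and small ε.
/-! ### Product Kraus families -/

/-- The operators `A i ⊗ B i` are the Kraus operators of a channel. -/
def IsKraus {a' b' : ℕ} {ι : Type} [Fintype ι] (A : ι → Matrix (Fin a') (Fin a) ℂ)
    (B : ι → Matrix (Fin b') (Fin b) ℂ) : Prop :=
  ∑ i, (A i ⊗ₖ B i)ᴴ * (A i ⊗ₖ B i) = 1

/-- The channel with Kraus operators `A i ⊗ B i`. -/
def krausMap {a' b' : ℕ} {ι : Type} [Fintype ι] (A : ι → Matrix (Fin a') (Fin a) ℂ)
    (B : ι → Matrix (Fin b') (Fin b) ℂ) (σ : Op a b) : Op a' b' :=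
  ∑ i, (A i ⊗ₖ B i) * σ * (A i ⊗ₖ B i)ᴴ

/-- The dual of the channel with Kraus operators `A i ⊗ B i`. -/
def krausDual {a' b' : ℕ} {ι : Type} [Fintype ι] (A : ι → Matrix (Fin a') (Fin a) ℂ)
    (B : ι → Matrix (Fin b') (Fin b) ℂ) (T : Op a' b') : Op a b :=
  ∑ i, (A i ⊗ₖ B i)ᴴ * T * (A i ⊗ₖ B i)

/-- `S` is closed under channels with finitely many product Kraus operators. -/
def KrausClosed (S : Set (Op a b)) : Prop :=
  ∀ (ι : Type) [Fintype ι] (A : ι → Matrix (Fin a) (Fin a) ℂ) (B : ι → Matrix (Fin b) (Fin b) ℂ),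
    IsKraus A B → ∀ σ ∈ S, krausMap A B σ ∈ S

section Kraus

variable {a' b' : ℕ} {ι : Type} [Fintype ι] {A : ι → Matrix (Fin a') (Fin a) ℂ}
  {B : ι → Matrix (Fin b') (Fin b) ℂ}

theorem trace_mul_krausMap (T : Op a' b') (σ : Op a b) :
    (T * krausMap A B σ).trace = (krausDual A B T * σ).trace := by
  simp only [krausMap, krausDual, Finset.mul_sum, Finset.sum_mul, Matrix.trace_sum]
  refine Finset.sum_congr rfl fun i _ => ?_
  rw [← Matrix.mul_assoc, Matrix.trace_mul_comm]
  simp only [Matrix.mul_assoc]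

theorem krausDual_one (h : IsKraus A B) : krausDual A B 1 = 1 := by
  rw [IsKraus] at h
  simpa [krausDual] using h

theorem trace_krausMap (h : IsKraus A B) (σ : Op a b) : (krausMap A B σ).trace = σ.trace := by
  simpa [krausDual_one h] using trace_mul_krausMap (A := A) (B := B) 1 σ

theorem posSemidef_krausMap {σ : Op a b} (h : σ.PosSemidef) : (krausMap A B σ).PosSemidef :=
  Matrix.posSemidef_sum _ fun _ _ => h.mul_mul_conjTranspose_same _

theorem posSemidef_krausDual {T : Op a' b'} (h : T.PosSemidef) : (krausDual A B T).PosSemidef :=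
  Matrix.posSemidef_sum _ fun _ _ => h.conjTranspose_mul_mul_same _

theorem krausDual_sub (T T' : Op a' b') :
    krausDual A B (T - T') = krausDual A B T - krausDual A B T' := by
  simp [krausDual, Matrix.mul_sub, Matrix.sub_mul]

theorem krausMap_mem_states (h : IsKraus A B) {σ : Op a b} (hσ : σ ∈ states a b) :
    krausMap A B σ ∈ states a' b' :=
  ⟨posSemidef_krausMap hσ.1, by rw [trace_krausMap h, hσ.2]⟩

end Kraus

/-! ### Rank-one operators: traces, conjugation, scaling. -/

theorem posSemidef_proj (Ψ : Vec a b) : (proj Ψ).PosSemidef :=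
  Matrix.posSemidef_vecMulVec_self_star Ψ

theorem trace_proj (Ψ : Vec a b) : (proj Ψ).trace = ((∑ i, ‖Ψ i‖ ^ 2 : ℝ) : ℂ) := by
  simp [proj, Matrix.trace, Matrix.vecMulVec_apply, Complex.mul_conj']

theorem trace_mul_proj {m : ℕ} {n : ℕ} (T : Op m n) (Ψ : Vec m n) :
    (T * proj Ψ).trace = star Ψ ⬝ᵥ (T *ᵥ Ψ) := by
  rw [proj, Matrix.mul_vecMulVec, Matrix.trace_vecMulVec, dotProduct_comm]

theorem proj_mulVec {a' b' : ℕ} (K : Matrix (Fin a' × Fin b') (Fin a × Fin b) ℂ) (Ψ : Vec a b) :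
    proj (K *ᵥ Ψ) = K * proj Ψ * Kᴴ := by
  rw [proj, proj, Matrix.mul_vecMulVec, Matrix.vecMulVec_mul, Matrix.star_mulVec]

theorem proj_smul (c : ℂ) (Ψ : Vec a b) : proj (c • Ψ) = ((‖c‖ ^ 2 : ℝ) : ℂ) • proj Ψ := by
  ext i j
  simp only [proj, Matrix.vecMulVec_apply, Pi.smul_apply, Pi.star_apply, smul_eq_mul,
    Matrix.smul_apply, star_mul', RCLike.star_def]
  push_cast
  rw [← Complex.mul_conj']
  ring

theorem proj_mem_states {Ψ : Vec a b} (h : IsPure Ψ) : proj Ψ ∈ states a b :=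
  ⟨posSemidef_proj Ψ, by rw [trace_proj, h]; simp⟩

/-! ### Composition and Kraus form of protocols -/

/-- Sequential composition of a protocol with trivial output and another protocol. -/
def LOCC.comp {κ : Type} {a' b' a'' b'' : ℕ} :
    {a b : ℕ} → LOCC Unit a' b' a b → LOCC κ a'' b'' a' b' → LOCC κ a'' b'' a b
  | _, _, .done _, P => P
  | _, _, .alice N c K hK next, P => .alice N c K hK fun i => (next i).comp P
  | _, _, .bob N c K hK next, P => .bob N c K hK fun i => (next i).comp P

theorem sum_kronecker {l m n p : Type*} {ι : Type*} [Fintype ι] (A : ι → Matrix l m ℂ)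
    (B : Matrix n p ℂ) : ∑ i, (A i ⊗ₖ B) = (∑ i, A i) ⊗ₖ B := by
  ext x y
  simp [Matrix.sum_apply, Matrix.kroneckerMap_apply, Finset.sum_mul]

theorem kronecker_sum {l m n p : Type*} {ι : Type*} [Fintype ι] (A : Matrix l m ℂ)
    (B : ι → Matrix n p ℂ) : ∑ i, (A ⊗ₖ B i) = A ⊗ₖ (∑ i, B i) := by
  ext x y
  simp [Matrix.sum_apply, Matrix.kroneckerMap_apply, Finset.mul_sum]

theorem sum_conjTranspose_mul_self_comp {m n : Type*} [Fintype m] [DecidableEq n]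
    {N : ℕ} {p : Fin N → Type*} [∀ i, Fintype (p i)] [∀ i, DecidableEq (p i)]
    {ι : Fin N → Type*} [∀ i, Fintype (ι i)] (K : ∀ i, Matrix (p i) n ℂ)
    (L : ∀ i, ι i → Matrix m (p i) ℂ) (hK : ∑ i, (K i)ᴴ * K i = 1)
    (hL : ∀ i, ∑ j, (L i j)ᴴ * L i j = 1) :
    ∑ x : Σ i, ι i, (L x.1 x.2 * K x.1)ᴴ * (L x.1 x.2 * K x.1) = 1 := by
  rw [Fintype.sum_sigma, ← hK]
  refine Finset.sum_congr rfl fun i _ => ?_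
  have : ∀ j, (L i j * K i)ᴴ * (L i j * K i) = (K i)ᴴ * ((L i j)ᴴ * L i j) * K i := by
    intro j; rw [Matrix.conjTranspose_mul]; simp only [Matrix.mul_assoc]
  rw [Finset.sum_congr rfl fun j _ => this j, ← Matrix.sum_mul, ← Matrix.mul_sum, hL,
    Matrix.mul_one]

/-- A root-to-leaf path of the protocol tree multiplies Alice's operators into `A` and Bob's into
`B`; `out` is the output at the leaf. Completeness is inherited node by node, so the family of all
paths is a product Kraus family. -/
theorem LOCC.exists_kraus {κ : Type} [DecidableEq κ] {a' b' : ℕ} (P : LOCC κ a' b' a b) :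
    ∃ (ι : Type) (_ : Fintype ι) (A : ι → Matrix (Fin a') (Fin a) ℂ)
      (B : ι → Matrix (Fin b') (Fin b) ℂ) (out : ι → κ), IsKraus A B ∧
      ∀ k σ, P.instrument k σ =
        ∑ m, if out m = k then (A m ⊗ₖ B m) * σ * (A m ⊗ₖ B m)ᴴ else 0 := by
  induction P with
  | done k =>
    refine ⟨Unit, inferInstance, fun _ => 1, fun _ => 1, fun _ => k, by simp [IsKraus], ?_⟩
    intro k' σ
    simp [LOCC.instrument]
  | @alice a b N c K hK next ih =>
    choose ι hι A B out hAB h using ih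
    have key : ∀ i (m : ι i), (A i m * K i) ⊗ₖ B i m =
        (A i m ⊗ₖ B i m) * (K i ⊗ₖ (1 : Matrix (Fin b) (Fin b) ℂ)) := by
      intro i m; rw [← Matrix.mul_kronecker_mul, Matrix.mul_one]
    refine ⟨Σ i, ι i, inferInstance, fun m => A m.1 m.2 * K m.1, fun m => B m.1 m.2,
      fun m => out m.1 m.2, ?_, ?_⟩
    · rw [IsKraus]
      simp only [key]
      refine sum_conjTranspose_mul_self_comp (fun i => K i ⊗ₖ (1 : Matrix (Fin b) (Fin b) ℂ))
        (fun i m => A i m ⊗ₖ B i m) ?_ hAB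
      simp only [Matrix.conjTranspose_kronecker, ← Matrix.mul_kronecker_mul,
        Matrix.conjTranspose_one, Matrix.mul_one, sum_kronecker, hK, Matrix.one_kronecker_one]
    · intro k σ
      rw [LOCC.instrument, Fintype.sum_sigma]
      refine Finset.sum_congr rfl fun i _ => ?_
      rw [h]
      refine Finset.sum_congr rfl fun m _ => ?_
      simp only [key, Matrix.conjTranspose_mul, Matrix.mul_assoc]
  | @bob a b N c K hK next ih =>
    choose ι hι A B out hAB h using ih
    have key : ∀ i (m : ι i), A i m ⊗ₖ (B i m * K i) =
        (A i m ⊗ₖ B i m) * ((1 : Matrix (Fin a) (Fin a) ℂ) ⊗ₖ K i) := by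
      intro i m; rw [← Matrix.mul_kronecker_mul, Matrix.mul_one]
    refine ⟨Σ i, ι i, inferInstance, fun m => A m.1 m.2, fun m => B m.1 m.2 * K m.1,
      fun m => out m.1 m.2, ?_, ?_⟩
    · rw [IsKraus]
      simp only [key]
      refine sum_conjTranspose_mul_self_comp (fun i => (1 : Matrix (Fin a) (Fin a) ℂ) ⊗ₖ K i)
        (fun i m => A i m ⊗ₖ B i m) ?_ hAB
      simp only [Matrix.conjTranspose_kronecker, ← Matrix.mul_kronecker_mul,
        Matrix.conjTranspose_one, Matrix.mul_one, kronecker_sum, hK, Matrix.one_kronecker_one]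
    · intro k σ
      rw [LOCC.instrument, Fintype.sum_sigma]
      refine Finset.sum_congr rfl fun i _ => ?_
      rw [h]
      refine Finset.sum_congr rfl fun m _ => ?_
      simp only [key, Matrix.conjTranspose_mul, Matrix.mul_assoc]

theorem LOCC.instrument_sum {κ : Type} [DecidableEq κ] {a' b' : ℕ} (P : LOCC κ a' b' a b)
    {ι : Type*} (s : Finset ι) (k : κ) (σ : ι → Op a b) :
    P.instrument k (∑ i ∈ s, σ i) = ∑ i ∈ s, P.instrument k (σ i) := by
  obtain ⟨J, _, A, B, out, -, h⟩ := P.exists_kraus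
  simp only [h]
  rw [Finset.sum_comm]
  refine Finset.sum_congr rfl fun m _ => ?_
  split_ifs <;> simp [Matrix.mul_sum, Matrix.sum_mul]

theorem LOCC.instrument_comp {κ : Type} [DecidableEq κ] {a' b' a'' b'' : ℕ}
    (Λ : LOCC Unit a' b' a b) (P : LOCC κ a'' b'' a' b') (k : κ) (σ : Op a b) :
    (Λ.comp P).instrument k σ = P.instrument k (Λ.instrument () σ) := by
  induction Λ with
  | done _ => simp [LOCC.comp, LOCC.instrument]
  | alice N c K hK next ih => simp [LOCC.comp, LOCC.instrument, ih, LOCC.instrument_sum]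
  | bob N c K hK next ih => simp [LOCC.comp, LOCC.instrument, ih, LOCC.instrument_sum]

/-- An LOCC channel is a channel with product Kraus operators. -/
theorem LOCC.exists_krausMap {a' b' : ℕ} (Λ : LOCC Unit a' b' a b) :
    ∃ (ι : Type) (_ : Fintype ι) (A : ι → Matrix (Fin a') (Fin a) ℂ)
      (B : ι → Matrix (Fin b') (Fin b) ℂ), IsKraus A B ∧
      ∀ σ, Λ.instrument () σ = krausMap A B σ := by
  obtain ⟨ι, _, A, B, out, h, h'⟩ := Λ.exists_kraus
  exact ⟨ι, inferInstance, A, B, h, fun σ => by simp [h', krausMap]⟩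

/-! ### Cones generated by rank-one projectors -/

/-- The square of the norm of a vector. -/
def normSq (v : Vec a b) : ℝ := ∑ i, ‖v i‖ ^ 2

theorem normSq_nonneg (v : Vec a b) : 0 ≤ normSq v := Finset.sum_nonneg fun _ _ => by positivity

theorem normSq_eq_zero {v : Vec a b} : normSq v = 0 ↔ v = 0 := by
  rw [normSq, Finset.sum_eq_zero_iff_of_nonneg fun _ _ => by positivity]
  simp [funext_iff]

theorem normSq_smul (c : ℂ) (v : Vec a b) : normSq (c • v) = ‖c‖ ^ 2 * normSq v := by
  simp [normSq, mul_pow, Finset.mul_sum]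

theorem trace_proj_eq_normSq (v : Vec a b) : (proj v).trace = (normSq v : ℂ) := trace_proj v

theorem ofReal_normSq (v : Vec a b) : (normSq v : ℂ) = star v ⬝ᵥ v := by
  simp [normSq, dotProduct, Complex.conj_mul']

theorem proj_zero : proj (0 : Vec a b) = 0 := by
  simp [proj]

/-- The normalization of a nonzero vector. -/
def normalize (v : Vec a b) : Vec a b := (((Real.sqrt (normSq v))⁻¹ : ℝ) : ℂ) • v

theorem isPure_normalize {v : Vec a b} (hv : v ≠ 0) : IsPure (normalize v) := by
  have h0 : normSq v ≠ 0 := fun h => hv (normSq_eq_zero.1 h)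
  change normSq (normalize v) = 1
  rw [normalize, normSq_smul, Complex.norm_real, Real.norm_eq_abs, sq_abs, inv_pow,
    Real.sq_sqrt (normSq_nonneg v), inv_mul_cancel₀ h0]

theorem proj_eq_smul_proj_normalize (v : Vec a b) :
    proj v = normSq v • proj (normalize v) := by
  rcases eq_or_ne v 0 with rfl | hv
  · simp [proj_zero, normSq]
  have h0 : normSq v ≠ 0 := fun h => hv (normSq_eq_zero.1 h)
  rw [normalize, proj_smul, Complex.norm_real, Real.norm_eq_abs, sq_abs, inv_pow,
    Real.sq_sqrt (normSq_nonneg v), Complex.coe_smul, smul_smul, mul_inv_cancel₀ h0, one_smul]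

/-- A family of vectors with `∑ ‖v i‖ ^ 2 = 1` defines an ensemble of pure states, each of which is
the normalization of some vector of the family. -/
theorem exists_ensemble {ι : Type} [Fintype ι] (v : ι → Vec a b)
    (h : (∑ i, proj (v i)).trace = 1) :
    ∑ i, normSq (v i) = 1 ∧ ∃ u : ι → Vec a b, (∀ i, IsPure (u i)) ∧
      (∀ i, ∃ j, v j ≠ 0 ∧ u i = normalize (v j)) ∧ (∀ i, v i ≠ 0 → u i = normalize (v i)) ∧
      ∀ i, proj (v i) = normSq (v i) • proj (u i) := by
  classical
  have hsum : ∑ i, normSq (v i) = 1 := by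
    rw [Matrix.trace_sum] at h
    simp only [trace_proj_eq_normSq] at h
    exact_mod_cast h
  refine ⟨hsum, ?_⟩
  obtain ⟨i₀, hi₀⟩ : ∃ i, v i ≠ 0 := by
    by_contra! h0
    simp [h0, normSq] at hsum
  refine ⟨fun i => if v i = 0 then normalize (v i₀) else normalize (v i), fun i => ?_, fun i => ?_,
    fun i hi => by simp [hi], fun i => ?_⟩
  · dsimp only; split_ifs with hi
    exacts [isPure_normalize hi₀, isPure_normalize hi]
  · dsimp only; split_ifs with hi
    exacts [⟨i₀, hi₀, rfl⟩, ⟨i, hi, rfl⟩]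
  · dsimp only; split_ifs with hi
    · simp [hi, proj_zero, normSq]
    · exact proj_eq_smul_proj_normalize _

/-- The weights of an ensemble are absorbed into the norms of the vectors. Hence, for a set `V`
stable under scalars, the convex hull of its pure states is the set of unit-trace finite sums of
`proj`, a form that is convenient under Kraus maps. This and `exists_sum_proj_of_mem_convexHull` are
the two directions. -/
theorem sum_proj_mem_convexHull {V : Set (Vec a b)} (hV : ∀ (c : ℂ), ∀ v ∈ V, c • v ∈ V)
    {ι : Type} [Fintype ι] (v : ι → Vec a b) (hv : ∀ i, v i ∈ V)
    (h : (∑ i, proj (v i)).trace = 1) :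
    ∑ i, proj (v i) ∈ convexHull ℝ {σ | ∃ Ψ : Vec a b, IsPure Ψ ∧ Ψ ∈ V ∧ σ = proj Ψ} := by
  obtain ⟨hsum, u, hu, huV, -, hvu⟩ := exists_ensemble v h
  rw [Finset.sum_congr rfl fun i _ => hvu i]
  refine (convex_convexHull ℝ _).sum_mem (fun i _ => normSq_nonneg _) hsum fun i _ =>
    subset_convexHull _ _ ⟨u i, hu i, ?_, rfl⟩
  obtain ⟨j, -, hj⟩ := huV i
  rw [hj]
  exact hV _ _ (hv j)

theorem proj_sqrt_smul {c : ℝ} (hc : 0 ≤ c) (v : Vec a b) :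
    proj (((Real.sqrt c : ℝ) : ℂ) • v) = (c : ℂ) • proj v := by
  rw [proj_smul, Complex.norm_real, Real.norm_eq_abs, sq_abs, Real.sq_sqrt hc]

theorem exists_sum_proj_of_mem_convexHull {V : Set (Vec a b)}
    (hV : ∀ (c : ℂ), ∀ v ∈ V, c • v ∈ V) {σ : Op a b}
    (hσ : σ ∈ convexHull ℝ {σ | ∃ Ψ : Vec a b, IsPure Ψ ∧ Ψ ∈ V ∧ σ = proj Ψ}) :
    ∃ (ι : Type) (_ : Fintype ι) (v : ι → Vec a b), (∀ i, v i ∈ V) ∧ σ = ∑ i, proj (v i) := by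
  refine convexHull_min (t := {σ | ∃ (ι : Type) (_ : Fintype ι) (v : ι → Vec a b),
    (∀ i, v i ∈ V) ∧ σ = ∑ i, proj (v i)}) ?_ ?_ hσ
  · rintro _ ⟨Ψ, -, hΨ, rfl⟩
    exact ⟨Unit, inferInstance, fun _ => Ψ, fun _ => hΨ, by simp⟩
  · rintro _ ⟨ι, _, v, hv, rfl⟩ _ ⟨κ, _, w, hw, rfl⟩ r s hr hs -
    refine ⟨ι ⊕ κ, inferInstance, Sum.elim (fun i => ((Real.sqrt r : ℝ) : ℂ) • v i)
      (fun i => ((Real.sqrt s : ℝ) : ℂ) • w i), ?_, ?_⟩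
    · rintro (i | i)
      exacts [hV _ _ (hv i), hV _ _ (hw i)]
    · simp only [Fintype.sum_sum_type, Sum.elim_inl, Sum.elim_inr, proj_sqrt_smul hr,
        proj_sqrt_smul hs]
      simp only [Complex.coe_smul, Finset.smul_sum]

theorem mem_states_of_mem_convexHull {V : Set (Vec a b)} {σ : Op a b}
    (hσ : σ ∈ convexHull ℝ {σ | ∃ Ψ : Vec a b, IsPure Ψ ∧ Ψ ∈ V ∧ σ = proj Ψ}) :
    σ ∈ states a b := by
  refine convexHull_min ?_ ?_ hσ
  · rintro _ ⟨Ψ, hΨ, -, rfl⟩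
    exact proj_mem_states hΨ
  · rintro σ ⟨h1, h2⟩ τ ⟨h3, h4⟩ r s hr hs hrs
    refine ⟨(h1.smul hr).add (h3.smul hs), ?_⟩
    rw [Matrix.trace_add, Matrix.trace_smul, Matrix.trace_smul, h2, h4, ← add_smul, hrs, one_smul]

/-! ### Separable operators -/

/-- A product vector. -/
def prodVec (ψ : Fin a → ℂ) (φ : Fin b → ℂ) : Vec a b := fun p => ψ p.1 * φ p.2

theorem kronecker_mulVec_prodVec {a' b' : ℕ} (A : Matrix (Fin a') (Fin a) ℂ)
    (B : Matrix (Fin b') (Fin b) ℂ) (ψ : Fin a → ℂ) (φ : Fin b → ℂ) :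
    (A ⊗ₖ B) *ᵥ prodVec ψ φ = prodVec (A *ᵥ ψ) (B *ᵥ φ) := by
  ext ⟨i, j⟩
  simp only [Matrix.mulVec, dotProduct, prodVec, Matrix.kroneckerMap_apply, Fintype.sum_prod_type,
    Finset.sum_mul_sum]
  exact Finset.sum_congr rfl fun _ _ => Finset.sum_congr rfl fun _ _ => by ring

/-- The cone generated by the separable states. -/
def IsSepCone (X : Op a b) : Prop :=
  ∃ (ι : Type) (_ : Fintype ι) (ψ : ι → Fin a → ℂ) (φ : ι → Fin b → ℂ),
    X = ∑ i, proj (prodVec (ψ i) (φ i))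

theorem IsSepCone.sum {κ : Type} [Fintype κ] {X : κ → Op a b} (h : ∀ k, IsSepCone (X k)) :
    IsSepCone (∑ k, X k) := by
  choose ι hι ψ φ hX using h
  refine ⟨Σ k, ι k, inferInstance, fun x => ψ x.1 x.2, fun x => φ x.1 x.2, ?_⟩
  rw [Fintype.sum_sigma]
  exact Finset.sum_congr rfl fun k _ => hX k

theorem IsSepCone.zero : IsSepCone (0 : Op a b) :=
  ⟨Empty, inferInstance, Empty.elim, Empty.elim, by simp⟩

theorem IsSepCone.add {X Y : Op a b} (hX : IsSepCone X) (hY : IsSepCone Y) :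
    IsSepCone (X + Y) := by
  obtain ⟨ι, _, ψ, φ, rfl⟩ := hX
  obtain ⟨κ, _, ψ', φ', rfl⟩ := hY
  exact ⟨ι ⊕ κ, inferInstance, Sum.elim ψ ψ', Sum.elim φ φ', by simp⟩

theorem isSepCone_proj (ψ : Fin a → ℂ) (φ : Fin b → ℂ) : IsSepCone (proj (prodVec ψ φ)) :=
  ⟨Unit, inferInstance, fun _ => ψ, fun _ => φ, by simp⟩

theorem IsSepCone.conj {a' b' : ℕ} {X : Op a b} (hX : IsSepCone X)
    (A : Matrix (Fin a') (Fin a) ℂ) (B : Matrix (Fin b') (Fin b) ℂ) :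
    IsSepCone ((A ⊗ₖ B) * X * (A ⊗ₖ B)ᴴ) := by
  obtain ⟨ι, _, ψ, φ, rfl⟩ := hX
  refine ⟨ι, inferInstance, fun i => A *ᵥ ψ i, fun i => B *ᵥ φ i, ?_⟩
  simp only [Matrix.mul_sum, Matrix.sum_mul, ← kronecker_mulVec_prodVec, proj_mulVec]

theorem IsSepCone.conj' {a' b' : ℕ} {X : Op a b} (hX : IsSepCone X)
    (A : Matrix (Fin a) (Fin a') ℂ) (B : Matrix (Fin b) (Fin b') ℂ) :
    IsSepCone ((A ⊗ₖ B)ᴴ * X * (A ⊗ₖ B)) := by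
  have := hX.conj Aᴴ Bᴴ
  rwa [← Matrix.conjTranspose_kronecker, Matrix.conjTranspose_conjTranspose] at this

theorem IsSepCone.posSemidef {X : Op a b} (hX : IsSepCone X) : X.PosSemidef := by
  obtain ⟨ι, _, ψ, φ, rfl⟩ := hX
  exact Matrix.posSemidef_sum _ fun _ _ => posSemidef_proj _

theorem IsSepCone.smul {X : Op a b} (hX : IsSepCone X) {c : ℝ} (hc : 0 ≤ c) :
    IsSepCone ((c : ℂ) • X) := by
  obtain ⟨ι, _, ψ, φ, rfl⟩ := hX
  refine ⟨ι, inferInstance, fun i => ((Real.sqrt c : ℝ) : ℂ) • ψ i, φ, ?_⟩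
  rw [Finset.smul_sum]
  refine Finset.sum_congr rfl fun i _ => ?_
  rw [← proj_sqrt_smul hc]
  congr 1
  ext p
  simp [prodVec, mul_assoc]

theorem isSepCone_one : IsSepCone (1 : Op a b) := by
  refine ⟨Fin a × Fin b, inferInstance, fun p => Pi.single p.1 1, fun p => Pi.single p.2 1, ?_⟩
  ext ⟨i, j⟩ ⟨k, l⟩
  have e1 : (k = i) = (i = k) := propext eq_comm
  have e2 : (l = j) = (j = l) := propext eq_comm
  by_cases h1 : i = k <;> by_cases h2 : j = l <;>
  simp [proj, prodVec, Matrix.sum_apply, Matrix.vecMulVec_apply, Fintype.sum_prod_type,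
    Pi.single_apply, Matrix.one_apply, e1, e2, h1, h2]

theorem sepStates_eq : sepStates a b = convexHull ℝ {σ | ∃ Ψ : Vec a b, IsPure Ψ ∧
    Ψ ∈ {v | ∃ ψ φ, v = prodVec ψ φ} ∧ σ = proj Ψ} := by
  rw [sepStates]
  congr 1
  ext σ
  constructor
  · rintro ⟨ψ, φ, h, rfl⟩
    exact ⟨prodVec ψ φ, h, ⟨ψ, φ, rfl⟩, rfl⟩
  · rintro ⟨_, h, ⟨ψ, φ, rfl⟩, rfl⟩
    exact ⟨ψ, φ, h, rfl⟩

theorem smul_mem_prodVec (c : ℂ) (v : Vec a b) (hv : v ∈ {v : Vec a b | ∃ ψ φ, v = prodVec ψ φ}) :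
    c • v ∈ {v : Vec a b | ∃ ψ φ, v = prodVec ψ φ} := by
  obtain ⟨ψ, φ, rfl⟩ := hv
  exact ⟨c • ψ, φ, by ext p; simp [prodVec, mul_assoc]⟩

theorem isSepCone_iff (ha : 0 < a) (hb : 0 < b) (X : Op a b) :
    (∃ c : ℝ, 0 ≤ c ∧ ∃ σ ∈ sepStates a b, X = (c : ℂ) • σ) ↔ IsSepCone X := by
  constructor
  · rintro ⟨c, hc, σ, hσ, rfl⟩
    rw [sepStates_eq] at hσ
    obtain ⟨ι, _, v, hv, rfl⟩ := exists_sum_proj_of_mem_convexHull smul_mem_prodVec hσ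
    choose ψ φ hv using hv
    refine IsSepCone.smul ⟨ι, inferInstance, ψ, φ, ?_⟩ hc
    simp only [hv]
  · intro hX
    have key : ∀ Y : Op a b, IsSepCone Y → Y.trace = 1 → Y ∈ sepStates a b := by
      rintro Y ⟨ι, _, ψ, φ, rfl⟩ h
      rw [sepStates_eq]
      exact sum_proj_mem_convexHull smul_mem_prodVec _ (fun i => ⟨_, _, rfl⟩) h
    have htr := hX.posSemidef.trace_nonneg
    obtain ⟨t, ht⟩ : ∃ t : ℝ, X.trace = t := ⟨X.trace.re, (Complex.ext_iff.2
      ⟨rfl, by simpa using (Complex.le_def.1 htr).2.symm⟩)⟩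
    rw [ht] at htr
    have ht0 : 0 ≤ t := by exact_mod_cast htr
    rcases ht0.eq_or_lt with h0 | h0
    · have hX0 : X = 0 := by
        rw [← hX.posSemidef.trace_eq_zero_iff, ht, ← h0]; simp
      refine ⟨0, le_rfl, _, key _ (isSepCone_proj (Pi.single ⟨0, ha⟩ 1) (Pi.single ⟨0, hb⟩ 1)) ?_,
        by simp [hX0]⟩
      rw [trace_proj]
      simp [prodVec, Fintype.sum_prod_type, Pi.single_apply, apply_ite]
    · refine ⟨t, ht0, _, key _ (hX.smul (inv_nonneg.2 ht0)) ?_, ?_⟩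
      · rw [Matrix.trace_smul, ht, smul_eq_mul, ← Complex.ofReal_mul, inv_mul_cancel₀ h0.ne',
          Complex.ofReal_one]
      · rw [smul_smul, ← Complex.ofReal_mul, mul_inv_cancel₀ h0.ne', Complex.ofReal_one, one_smul]

theorem isSeparable_iff (ha : 0 < a) (hb : 0 < b) (Ω : Op a b) :
    IsSeparable Ω ↔ IsSepCone Ω ∧ IsSepCone (1 - Ω) := by
  rw [IsSeparable, isSepCone_iff ha hb, isSepCone_iff ha hb]

/-- Polarization over ℂ: the quadratic form determines the operator, with no hermiticity assumption.
-/
theorem eq_zero_of_dotProduct_mulVec {n : Type*} [Fintype n] [DecidableEq n] {Z : Matrix n n ℂ}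
    (h : ∀ v : n → ℂ, star v ⬝ᵥ (Z *ᵥ v) = 0) : Z = 0 := by
  have h1 : Matrix.toEuclideanLin Z = 0 := by
    rw [← inner_map_self_eq_zero]
    intro x
    rw [← inner_conj_symm, EuclideanSpace.inner_eq_star_dotProduct, dotProduct_comm]
    have := h x.ofLp
    simp [Matrix.ofLp_toLpLin] at this ⊢
    exact this
  simpa using h1

/-- Operators are determined by their expectation values. -/
theorem ext_of_trace_mul {X Y : Op a b} (h : ∀ σ ∈ states a b, (X * σ).trace = (Y * σ).trace) :
    X = Y := by
  rw [← sub_eq_zero]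
  refine eq_zero_of_dotProduct_mulVec fun v => ?_
  rcases eq_or_ne v 0 with rfl | hv
  · simp
  rw [← trace_mul_proj, proj_eq_smul_proj_normalize, Matrix.mul_smul, Matrix.trace_smul,
    Matrix.sub_mul, Matrix.trace_sub, h _ (proj_mem_states (isPure_normalize hv)), sub_self,
    smul_zero]

/-- The effect of an output is the sum of (A ⊗ B)ᴴ(A ⊗ B) over the leaves carrying it, and each
summand is the separable operator 1 conjugated by a product operator. Completeness makes the effect
of `false` equal to `1 - Ω`. -/
theorem IsLocal.isSepCone {Ω : Op a b} (h : IsLocal Ω) : IsSepCone Ω ∧ IsSepCone (1 - Ω) := by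
  obtain ⟨a', b', P, hP⟩ := h
  obtain ⟨ι, _, A, B, out, hAB, hP'⟩ := P.exists_kraus
  have key : ∀ k, IsSepCone (∑ m, if out m = k then (A m ⊗ₖ B m)ᴴ * (A m ⊗ₖ B m) else 0) := by
    refine fun k => IsSepCone.sum fun m => ?_
    split_ifs
    · simpa using (isSepCone_one (a := a') (b := b')).conj' (A m) (B m)
    · exact IsSepCone.zero
  have hΩ : Ω = ∑ m, if out m = true then (A m ⊗ₖ B m)ᴴ * (A m ⊗ₖ B m) else 0 := by
    refine ext_of_trace_mul fun σ hσ => ?_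
    rw [← hP σ hσ, hP', Matrix.trace_sum, Matrix.sum_mul, Matrix.trace_sum]
    refine Finset.sum_congr rfl fun m _ => ?_
    split_ifs
    · rw [Matrix.trace_mul_comm, Matrix.mul_assoc]
    · simp
  have hΩ' : 1 - Ω = ∑ m, if out m = false then (A m ⊗ₖ B m)ᴴ * (A m ⊗ₖ B m) else 0 := by
    rw [hΩ, sub_eq_iff_eq_add, ← Finset.sum_add_distrib, ← hAB]
    refine Finset.sum_congr rfl fun m _ => ?_
    cases out m <;> simp
  exact ⟨hΩ ▸ key true, hΩ' ▸ key false⟩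

/-! ### Monotonicity of the separation probabilities under LOCC -/

/-- By duality the pulled-back test rejects Ψ with the probability with which `T` rejects Υ, namely
0; a positive semidefinite operator with zero expectation on Ψ annihilates Ψ. -/
theorem IsTest.krausDual {a' b' : ℕ} {ι : Type} [Fintype ι] {A : ι → Matrix (Fin a') (Fin a) ℂ}
    {B : ι → Matrix (Fin b') (Fin b) ℂ} (h : IsKraus A B) {Ψ : Vec a b} {Υ : Vec a' b'}
    (hΨΥ : krausMap A B (proj Ψ) = proj Υ) {T : Op a' b'} (hT : IsTest Υ T) :
    IsTest Ψ (krausDual A B T) := by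
  have h2 : (1 - EntCert.krausDual A B T).PosSemidef := by
    rw [← krausDual_one h, ← krausDual_sub]
    exact posSemidef_krausDual hT.2.1
  refine ⟨posSemidef_krausDual hT.1, h2, ?_⟩
  have h3 := (h2.dotProduct_mulVec_zero_iff Ψ).1 (by
    rw [← trace_mul_proj, ← krausDual_one h, ← krausDual_sub, ← trace_mul_krausMap, hΨΥ,
      trace_mul_proj, Matrix.sub_mulVec, hT.2.2, Matrix.one_mulVec, sub_self, dotProduct_zero])
  rw [Matrix.sub_mulVec, Matrix.one_mulVec, sub_eq_zero] at h3
  exact h3.symm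

/-! ### Bounds on pass probabilities. -/

open scoped MatrixOrder Matrix.Norms.L2Operator in
theorem exists_eq_conjTranspose_mul_self {n : Type*} [Fintype n] [DecidableEq n]
    {σ : Matrix n n ℂ} (hσ : σ.PosSemidef) : ∃ C : Matrix n n ℂ, σ = Cᴴ * C :=
  CStarAlgebra.nonneg_iff_eq_star_mul_self.1 hσ.nonneg

theorem re_trace_mul_nonneg {T σ : Op a b} (hT : T.PosSemidef) (hσ : σ.PosSemidef) :
    0 ≤ (T * σ).trace.re := by
  obtain ⟨C, rfl⟩ := exists_eq_conjTranspose_mul_self hσ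
  rw [← Matrix.mul_assoc, Matrix.trace_mul_comm, ← Matrix.mul_assoc]
  exact (Complex.le_def.1 (hT.mul_mul_conjTranspose_same C).trace_nonneg).1

theorem re_trace_mul_le_one {T σ : Op a b} (hT : (1 - T).PosSemidef) (hσ : σ ∈ states a b) :
    (T * σ).trace.re ≤ 1 := by
  have := re_trace_mul_nonneg hT hσ.1
  rw [Matrix.sub_mul, Matrix.one_mul, Matrix.trace_sub, hσ.2] at this
  simpa using this

theorem passProb_nonneg {S : Set (Op a b)} (hS : S ⊆ states a b) {T : Op a b}
    (hT : T.PosSemidef) : 0 ≤ passProb T S := by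
  refine Real.sSup_nonneg ?_
  rintro _ ⟨σ, hσ, rfl⟩
  exact re_trace_mul_nonneg hT (hS hσ).1

theorem le_passProb {S : Set (Op a b)} (hS : S ⊆ states a b) {T : Op a b}
    (hT : (1 - T).PosSemidef) {σ : Op a b} (hσ : σ ∈ S) :
    (T * σ).trace.re ≤ passProb T S := by
  refine le_csSup ⟨1, ?_⟩ ⟨σ, hσ, rfl⟩
  rintro _ ⟨τ, hτ, rfl⟩
  exact re_trace_mul_le_one hT (hS hτ)

theorem IsVerificationOperator.one (Ψ : Vec a b) : IsVerificationOperator Ψ (1 : Op a b) := by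
  rw [isVerificationOperator_iff]
  exact ⟨Matrix.PosSemidef.one, by simpa using Matrix.PosSemidef.zero, by simp⟩

theorem IsLocal.one : IsLocal (1 : Op a b) :=
  ⟨a, b, .done true, fun σ _ => by simp [LOCC.instrument]⟩

theorem passProb_krausDual_le {S : Set (Op a b)} (hS : S ⊆ states a b) (hK : KrausClosed S)
    {ι : Type} [Fintype ι] {A : ι → Matrix (Fin a) (Fin a) ℂ} {B : ι → Matrix (Fin b) (Fin b) ℂ}
    (h : IsKraus A B) {Ψ : Vec a b} {T : Op a b} (hT : IsTest Ψ T) :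
    passProb (krausDual A B T) S ≤ passProb T S := by
  -- Nonnegativity of the bound also covers empty `S`, where the real supremum is 0 by convention.
  refine Real.sSup_le ?_ (passProb_nonneg hS hT.1)
  rintro _ ⟨σ, hσ, rfl⟩
  dsimp only
  rw [← trace_mul_krausMap]
  exact le_passProb hS hT.2.1 (hK _ _ _ h _ hσ)

theorem bddBelow_of_passProb {S : Set (Op a b)} (hS : S ⊆ states a b) {Ψ : Vec a b}
    {Q : Op a b → Prop} :
    BddBelow {x | ∃ Ω, IsVerificationOperator Ψ Ω ∧ Q Ω ∧ x = passProb Ω S} := by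
  refine ⟨0, ?_⟩
  rintro _ ⟨Ω, hΩ, -, rfl⟩
  rw [isVerificationOperator_iff] at hΩ
  exact passProb_nonneg hS hΩ.1

theorem IsLocal.krausDual {a' b' : ℕ} {Λ : LOCC Unit a' b' a b} {ι : Type} [Fintype ι]
    {A : ι → Matrix (Fin a') (Fin a) ℂ} {B : ι → Matrix (Fin b') (Fin b) ℂ} (h : IsKraus A B)
    (hΛ : ∀ σ, Λ.instrument () σ = krausMap A B σ) {Ω : Op a' b'} (hΩ : IsLocal Ω) :
    IsLocal (krausDual A B Ω) := by
  obtain ⟨a'', b'', P, hP⟩ := hΩ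
  refine ⟨a'', b'', Λ.comp P, fun σ hσ => ?_⟩
  rw [LOCC.instrument_comp, hΛ, hP _ (krausMap_mem_states h hσ), trace_mul_krausMap]

theorem IsSepCone.krausDual {a' b' : ℕ} {ι : Type} [Fintype ι]
    {A : ι → Matrix (Fin a') (Fin a) ℂ} {B : ι → Matrix (Fin b') (Fin b) ℂ} {X : Op a' b'}
    (hX : IsSepCone X) : IsSepCone (krausDual A B X) :=
  IsSepCone.sum fun _ => hX.conj' _ _

/-- Each competitor for Υ, pulled back along the channel, becomes a competitor for Ψ that is at
least as good. The trivial test 1 keeps the infimum for Υ from being over the empty set. -/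
theorem PLC_le_of_LOCCTransforms {S : Set (Op a b)} (hS : S ⊆ states a b) (hK : KrausClosed S)
    {Ψ Υ : Vec a b} (h : LOCCTransforms Ψ Υ) : PLC Ψ S ≤ PLC Υ S := by
  obtain ⟨Λ, hΛ⟩ := h
  obtain ⟨ι, _, A, B, hAB, hΛ'⟩ := Λ.exists_krausMap
  refine le_csInf ⟨_, 1, .one Υ, .one, rfl⟩ ?_
  rintro _ ⟨Ω, hΩ, hΩ', rfl⟩
  rw [isVerificationOperator_iff] at hΩ
  refine (csInf_le (bddBelow_of_passProb hS) ⟨_, (isVerificationOperator_iff _ _).2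
    (hΩ.krausDual hAB ?_), hΩ'.krausDual hAB hΛ', rfl⟩).trans
      (passProb_krausDual_le hS hK hAB hΩ)
  rw [← hΛ', hΛ]

theorem Psep_le_of_LOCCTransforms (ha : 0 < a) (hb : 0 < b) {S : Set (Op a b)}
    (hS : S ⊆ states a b) (hK : KrausClosed S)
    {Ψ Υ : Vec a b} (h : LOCCTransforms Ψ Υ) : Psep Ψ S ≤ Psep Υ S := by
  obtain ⟨Λ, hΛ⟩ := h
  obtain ⟨ι, _, A, B, hAB, hΛ'⟩ := Λ.exists_krausMap
  refine le_csInf ⟨_, 1, .one Υ, (isSeparable_iff ha hb _).2 IsLocal.one.isSepCone, rfl⟩ ?_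
  rintro _ ⟨Ω, hΩ, hΩ', rfl⟩
  rw [isVerificationOperator_iff] at hΩ
  rw [isSeparable_iff ha hb] at hΩ'
  refine (csInf_le (bddBelow_of_passProb hS) ⟨_, (isVerificationOperator_iff _ _).2
    (hΩ.krausDual hAB ?_), (isSeparable_iff ha hb _).2 ⟨hΩ'.1.krausDual, ?_⟩, rfl⟩).trans
      (passProb_krausDual_le hS hK hAB hΩ)
  · rw [← hΛ', hΛ]
  · rw [← krausDual_one hAB, ← krausDual_sub]
    exact hΩ'.2.krausDual

theorem Psep_le_PLC (ha : 0 < a) (hb : 0 < b) {S : Set (Op a b)} (hS : S ⊆ states a b)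
    (Ψ : Vec a b) : Psep Ψ S ≤ PLC Ψ S := by
  refine csInf_le_csInf (bddBelow_of_passProb hS) ⟨_, 1, .one Ψ, .one, rfl⟩ ?_
  rintro _ ⟨Ω, hΩ, hΩ', rfl⟩
  exact ⟨Ω, hΩ, (isSeparable_iff ha hb _).2 hΩ'.isSepCone, rfl⟩

/-! ### Coefficient matrices -/

/-- The coefficient matrix of a bipartite vector. -/
def mat (Ψ : Vec a b) : Matrix (Fin a) (Fin b) ℂ := Matrix.of fun i j => Ψ (i, j)

theorem mat_mul_conjTranspose (Ψ : Vec a b) : mat Ψ * (mat Ψ)ᴴ = partialTraceB (proj Ψ) := by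
  ext i j
  simp [Matrix.mul_apply, mat, partialTraceB, proj, Matrix.vecMulVec_apply]

theorem mat_kronecker_mulVec {a' b' : ℕ} (A : Matrix (Fin a') (Fin a) ℂ)
    (B : Matrix (Fin b') (Fin b) ℂ) (Ψ : Vec a b) :
    mat ((A ⊗ₖ B) *ᵥ Ψ) = A * mat Ψ * Bᵀ := by
  ext i j
  simp only [mat, Matrix.mulVec, dotProduct, Matrix.of_apply, Matrix.mul_apply,
    Matrix.kroneckerMap_apply, Fintype.sum_prod_type, Matrix.transpose_apply, Finset.sum_mul]
  rw [Finset.sum_comm]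
  exact Finset.sum_congr rfl fun _ _ => Finset.sum_congr rfl fun _ _ => by ring

theorem mat_injective : Function.Injective (mat : Vec a b → Matrix (Fin a) (Fin b) ℂ) := by
  intro v w h
  ext p
  exact congrFun (congrFun h p.1) p.2

theorem rank_mat_smul_le (c : ℂ) (v : Vec a b) : (mat (c • v)).rank ≤ (mat v).rank := by
  have : mat (c • v) = (c • (1 : Matrix (Fin a) (Fin a) ℂ)) * mat v := by
    ext i j; simp [mat]
  rw [this]
  exact Matrix.rank_mul_le_right _ _

theorem rank_mat_kronecker_mulVec_le {a' b' : ℕ} (A : Matrix (Fin a') (Fin a) ℂ)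
    (B : Matrix (Fin b') (Fin b) ℂ) (Ψ : Vec a b) :
    (mat ((A ⊗ₖ B) *ᵥ Ψ)).rank ≤ (mat Ψ).rank := by
  rw [mat_kronecker_mulVec]
  exact (Matrix.rank_mul_le_left _ _).trans (Matrix.rank_mul_le_right _ _)

/-- The rank of M equals that of M Mᴴ, the reduced state, hence the number of its nonzero
eigenvalues; sorting is a bijection of indices. -/
theorem schmidtRank_eq_rank (Ψ : Vec a b) : schmidtRank Ψ = (mat Ψ).rank := by
  rw [← Matrix.rank_self_mul_conjTranspose, mat_mul_conjTranspose,
    (isHermitian_partialTraceB_proj Ψ).rank_eq_card_non_zero_eigs, schmidtRank,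
    Fintype.card_subtype]
  refine Finset.card_bij' (fun i _ => Tuple.sort (fun j =>
    -(isHermitian_partialTraceB_proj Ψ).eigenvalues j) i) (fun i _ => (Tuple.sort (fun j =>
    -(isHermitian_partialTraceB_proj Ψ).eigenvalues j)).symm i) ?_ ?_ ?_ ?_
  · exact fun i hi => Finset.mem_filter.2 ⟨Finset.mem_univ _, (Finset.mem_filter.1 hi).2⟩
  · intro i hi
    refine Finset.mem_filter.2 ⟨Finset.mem_univ _, ?_⟩
    simpa [schmidtVector, sortDesc] using (Finset.mem_filter.1 hi).2
  · simp
  · simp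

theorem schmidtVector_nonneg (Ψ : Vec a b) (i : Fin a) : 0 ≤ schmidtVector Ψ i := by
  have h : (partialTraceB (proj Ψ)).PosSemidef := by
    rw [← mat_mul_conjTranspose]
    exact Matrix.posSemidef_self_mul_conjTranspose _
  exact h.eigenvalues_nonneg _

theorem antitone_schmidtVector (Ψ : Vec a b) : Antitone (schmidtVector Ψ) :=
  antitone_sortDesc _

/-! ### The Schmidt decomposition -/

theorem conj_orthonormalBasis_mem_unitaryGroup {n : ℕ}
    (e : OrthonormalBasis (Fin n) ℂ (EuclideanSpace ℂ (Fin n))) :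
    (Matrix.of fun i j => star ((e i).ofLp j)) ∈ Matrix.unitaryGroup (Fin n) ℂ := by
  rw [Matrix.mem_unitaryGroup_iff]
  ext i j
  have h := orthonormal_iff_ite.1 e.orthonormal i j
  rw [EuclideanSpace.inner_eq_star_dotProduct, dotProduct_comm] at h
  simpa [Matrix.mul_apply, dotProduct, Matrix.one_apply] using h

/-- The vector `∑ i, μ i |i i⟩`. -/
def diagVec (a b : ℕ) (μ : Fin a → ℝ) : Vec a b :=
  fun p => if (p.1 : ℕ) = (p.2 : ℕ) then (μ p.1 : ℂ) else 0

theorem exists_schmidt_decomposition (hab : a ≤ b) (Ψ : Vec a b) :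
    ∃ U ∈ Matrix.unitaryGroup (Fin a) ℂ, ∃ V ∈ Matrix.unitaryGroup (Fin b) ℂ,
      (U ⊗ₖ V) *ᵥ Ψ = diagVec a b fun i => Real.sqrt (schmidtVector Ψ i) := by
  set hρ := isHermitian_partialTraceB_proj Ψ with hhρ
  set π := Tuple.sort (fun j => -hρ.eigenvalues j) with hπ
  set e := hρ.eigenvectorBasis.reindex π.symm with he
  set s := schmidtVector Ψ with hs
  have hs0 : ∀ i, 0 ≤ s i := schmidtVector_nonneg Ψ
  -- Contracting Alice's factor of Ψ with an eigenvector of the reduced state leaves a vector of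
  -- Bob. Inner products of these vectors are matrix elements of the reduced state in its
  -- eigenbasis, so they are orthogonal with squared norms `s i`.
  let n : Fin a → EuclideanSpace ℂ (Fin b) := fun i => WithLp.toLp 2 (star (e i).ofLp ᵥ* mat Ψ)
  have hn : ∀ i k, inner ℂ (n k) (n i) = if k = i then (s i : ℂ) else 0 := by
    intro i k
    have hek : (partialTraceB (proj Ψ)) *ᵥ (e k).ofLp = (s k : ℂ) • (e k).ofLp := by
      have := hρ.mulVec_eigenvectorBasis (π k)
      simpa [he, hs, schmidtVector, sortDesc, hπ] using this
    rw [EuclideanSpace.inner_eq_star_dotProduct]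
    simp only [n]
    rw [Matrix.star_vecMul, star_star, ← Matrix.dotProduct_mulVec, Matrix.mulVec_mulVec,
      mat_mul_conjTranspose, hek, dotProduct_smul, dotProduct_comm,
      ← EuclideanSpace.inner_eq_star_dotProduct, orthonormal_iff_ite.1 e.orthonormal]
    by_cases h : k = i
    · simp [h]
    · simp [h, Ne.symm h]
  have hn0 : ∀ i, s i = 0 → n i = 0 := by
    intro i hi
    rw [← inner_self_eq_zero (𝕜 := ℂ), hn]
    simp [hi]
  -- Only the indices with a nonzero Schmidt coefficient are prescribed in the extension to a basis;
  -- the values of `v` elsewhere are irrelevant.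
  let v : Fin b → EuclideanSpace ℂ (Fin b) := fun k =>
    if h : (k : ℕ) < a then (((Real.sqrt (s ⟨k, h⟩))⁻¹ : ℝ) : ℂ) • n ⟨k, h⟩ else 0
  have hv : Orthonormal ℂ (Set.domRestrict {k : Fin b | ∃ h : (k : ℕ) < a, s ⟨k, h⟩ ≠ 0} v) := by
    rw [orthonormal_iff_ite]
    rintro ⟨k, hk, hk0⟩ ⟨l, hl, hl0⟩
    simp only [Set.domRestrict_apply, v, hk, hl, dif_pos, inner_smul_left, inner_smul_right, hn,
      Subtype.mk.injEq, Fin.mk.injEq, Complex.conj_ofReal]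
    by_cases hkl : k = l
    · subst hkl
      have : Real.sqrt (s ⟨k, hk⟩) ≠ 0 := (Real.sqrt_pos.2 ((hs0 _).lt_of_ne' hk0)).ne'
      simp only [if_true]
      rw [← Complex.ofReal_mul, ← Complex.ofReal_mul]
      norm_cast
      nth_rewrite 3 [← Real.mul_self_sqrt (hs0 ⟨k, hk⟩)]
      field_simp
    · rw [if_neg (fun h => hkl (Fin.ext h)), if_neg hkl]; simp
  obtain ⟨f, hf⟩ := hv.exists_orthonormalBasis_extension_of_card_eq (by simp)
  refine ⟨_, conj_orthonormalBasis_mem_unitaryGroup e, _, conj_orthonormalBasis_mem_unitaryGroup f,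
    ?_⟩
  apply mat_injective
  rw [mat_kronecker_mulVec]
  ext i k
  have h1 : ((Matrix.of fun i j => star ((e i).ofLp j)) * mat Ψ *
      (Matrix.of fun i j => star ((f i).ofLp j))ᵀ) i k = inner ℂ (f k) (n i) := by
    rw [EuclideanSpace.inner_eq_star_dotProduct]
    simp [Matrix.mul_apply, dotProduct, n, Matrix.vecMul]
  rw [h1]
  simp only [mat, diagVec, Matrix.of_apply]
  by_cases hi : s i = 0
  · simp [hn0 i hi, hi]
  have hsi : Real.sqrt (s i) ≠ 0 := (Real.sqrt_pos.2 ((hs0 _).lt_of_ne' hi)).ne'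
  have h2 : n i = ((Real.sqrt (s i) : ℝ) : ℂ) • f (Fin.castLE hab i) := by
    rw [hf _ ⟨i.2, hi⟩]
    simp only [v, Fin.val_castLE, i.2, dif_pos, smul_smul, Fin.eta]
    rw [← Complex.ofReal_mul, mul_inv_cancel₀ hsi, Complex.ofReal_one, one_smul]
  rw [h2, inner_smul_right, orthonormal_iff_ite.1 f.orthonormal]
  by_cases hik : (i : ℕ) = k
  · rw [if_pos hik, if_pos (Fin.ext hik.symm), mul_one]
  · rw [if_neg hik, if_neg (fun h => hik (by rw [h]; rfl)), mul_zero]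

theorem normSq_mulVec_of_unitary {a' b' : ℕ} {K : Matrix (Fin a' × Fin b') (Fin a × Fin b) ℂ}
    (hK : Kᴴ * K = 1) (v : Vec a b) : normSq (K *ᵥ v) = normSq v := by
  have : (normSq (K *ᵥ v) : ℂ) = normSq v := by
    rw [ofReal_normSq, ofReal_normSq, Matrix.star_mulVec, ← Matrix.dotProduct_mulVec,
      Matrix.mulVec_mulVec, hK, Matrix.one_mulVec]
  exact_mod_cast this

theorem kronecker_conjTranspose_mul_self {U : Matrix (Fin a) (Fin a) ℂ}
    {V : Matrix (Fin b) (Fin b) ℂ} (hU : U ∈ Matrix.unitaryGroup (Fin a) ℂ)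
    (hV : V ∈ Matrix.unitaryGroup (Fin b) ℂ) : (U ⊗ₖ V)ᴴ * (U ⊗ₖ V) = 1 := by
  rw [Matrix.mem_unitaryGroup_iff', Matrix.star_eq_conjTranspose] at hU hV
  rw [Matrix.conjTranspose_kronecker, ← Matrix.mul_kronecker_mul, hU, hV, Matrix.one_kronecker_one]

theorem normSq_eq_sum (v : Vec a b) : normSq v = ∑ j, ∑ i, ‖v (i, j)‖ ^ 2 := by
  rw [normSq, Fintype.sum_prod_type_right]

theorem sum_ite_val_eq (hab : a ≤ b) (i : Fin a) (f : Fin b → ℝ) :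
    ∑ j : Fin b, (if (i : ℕ) = j then f j else 0) = f (Fin.castLE hab i) := by
  rw [Finset.sum_eq_single (Fin.castLE hab i)]
  · simp
  · intro j _ hj
    rw [if_neg]
    exact fun h => hj (Fin.ext h.symm)
  · simp

theorem normSq_diagVec (hab : a ≤ b) (μ : Fin a → ℝ) : normSq (diagVec a b μ) = ∑ i, μ i ^ 2 := by
  rw [normSq, Fintype.sum_prod_type]
  refine Finset.sum_congr rfl fun i _ => ?_
  rw [← sum_ite_val_eq hab i fun _ => μ i ^ 2]
  refine Finset.sum_congr rfl fun j _ => ?_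
  simp only [diagVec]
  split_ifs <;> simp

theorem sum_schmidtVector (hab : a ≤ b) (Ψ : Vec a b) : ∑ i, schmidtVector Ψ i = normSq Ψ := by
  obtain ⟨U, hU, V, hV, h⟩ := exists_schmidt_decomposition hab Ψ
  rw [← normSq_mulVec_of_unitary (kronecker_conjTranspose_mul_self hU hV) Ψ, h, normSq_diagVec hab]
  exact Finset.sum_congr rfl fun i _ => (Real.sq_sqrt (schmidtVector_nonneg Ψ i)).symm

/-! ### The distance to vectors of small Schmidt rank -/

theorem mulVec_conjTranspose_mulVec {a' b' : ℕ} {K : Matrix (Fin a' × Fin b') (Fin a × Fin b) ℂ}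
    (hK : Kᴴ * K = 1) (v : Vec a b) : Kᴴ *ᵥ (K *ᵥ v) = v := by
  rw [Matrix.mulVec_mulVec, hK, Matrix.one_mulVec]

theorem rank_mat_diagVec_le (r : ℕ) (μ : Fin a → ℝ) :
    (mat (diagVec a b fun i => if (i : ℕ) < r then μ i else 0)).rank ≤ r := by
  have h : mat (diagVec a b fun i => if (i : ℕ) < r then μ i else 0) =
      Matrix.diagonal (fun i : Fin a => if (i : ℕ) < r then (μ i : ℂ) else 0) *
        Matrix.of fun (i : Fin a) (j : Fin b) => if (i : ℕ) = j then (1 : ℂ) else 0 := by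
    ext i j
    simp only [mat, diagVec, Matrix.of_apply, Matrix.diagonal_mul]
    split_ifs <;> simp
  rw [h]
  refine (Matrix.rank_mul_le_left _ _).trans ?_
  classical
  rw [Matrix.rank_diagonal]
  calc Fintype.card {i : Fin a // (if (i : ℕ) < r then (μ i : ℂ) else 0) ≠ 0}
      ≤ Fintype.card (Fin r) := by
        refine Fintype.card_le_of_injective (fun i => ⟨(i.1 : ℕ), ?_⟩) ?_
        · by_contra hi
          exact i.2 (if_neg hi)
        · intro i j hij
          exact Subtype.ext (Fin.ext (by simpa using hij))
    _ = r := Fintype.card_fin r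

/-- The attained half of Eckart-Young: keep the r largest terms of the Schmidt decomposition. -/
theorem exists_rank_le_normSq_sub_eq (hab : a ≤ b) (r : ℕ) (Ψ : Vec a b) :
    ∃ X : Vec a b, (mat X).rank ≤ r ∧ normSq (Ψ - X) = entPure r Ψ := by
  obtain ⟨U, hU, V, hV, h⟩ := exists_schmidt_decomposition hab Ψ
  have hUV := kronecker_conjTranspose_mul_self hU hV
  set Y : Vec a b := diagVec a b fun i => if (i : ℕ) < r then Real.sqrt (schmidtVector Ψ i) else 0
    with hY
  refine ⟨(U ⊗ₖ V)ᴴ *ᵥ Y, ?_, ?_⟩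
  · rw [Matrix.conjTranspose_kronecker]
    exact (rank_mat_kronecker_mulVec_le _ _ _).trans (rank_mat_diagVec_le r _)
  · have hUV' : (U ⊗ₖ V) * (U ⊗ₖ V)ᴴ = 1 := mul_eq_one_comm.1 hUV
    rw [← normSq_mulVec_of_unitary hUV, Matrix.mulVec_sub, h, Matrix.mulVec_mulVec, hUV',
      Matrix.one_mulVec]
    have : (diagVec a b fun i => Real.sqrt (schmidtVector Ψ i)) - Y = diagVec a b fun i =>
        if r ≤ (i : ℕ) then Real.sqrt (schmidtVector Ψ i) else 0 := by
      ext p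
      simp only [hY, diagVec, Pi.sub_apply]
      by_cases h1 : (p.1 : ℕ) = p.2
      · simp only [if_pos h1]
        by_cases h2 : (p.1 : ℕ) < r
        · rw [if_pos h2, if_neg (by omega)]; simp
        · rw [if_neg h2, if_pos (by omega)]; simp
      · simp [if_neg h1]
    rw [this, normSq_diagVec hab, entPure, Finset.sum_filter]
    refine Finset.sum_congr rfl fun i _ => ?_
    split_ifs
    · exact Real.sq_sqrt (schmidtVector_nonneg Ψ i)
    · simp

/-- A budget `q` of total size r, with entries in [0, 1], removes most from a nonincreasing `s` when
spent on the first r entries. The proof compares with the threshold value τ = s_r entry by entry;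
for r ≥ a the tail is empty. -/
theorem sum_le_sum_mul_one_sub (r : ℕ) {s q : Fin a → ℝ} (hs : Antitone s) (hs0 : ∀ i, 0 ≤ s i)
    (hq0 : ∀ i, 0 ≤ q i) (hq1 : ∀ i, q i ≤ 1) (hq : ∑ i, q i ≤ r) :
    ∑ i ∈ Finset.univ.filter (fun i : Fin a => r ≤ (i : ℕ)), s i ≤ ∑ i, s i * (1 - q i) := by
  rcases Nat.lt_or_ge r a with hra | hra
  · set τ := s ⟨r, hra⟩ with hτ
    have key : ∀ i : Fin a, τ * ((if (i : ℕ) < r then 1 else 0) - q i) ≤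
        s i * (1 - q i) - if r ≤ (i : ℕ) then s i else 0 := by
      intro i
      by_cases hi : (i : ℕ) < r
      · rw [if_pos hi, if_neg (by omega)]
        have : τ ≤ s i := hs (Fin.le_def.2 hi.le)
        nlinarith [hq1 i]
      · rw [if_neg hi, if_pos (by omega)]
        have : s i ≤ τ := hs (Fin.le_def.2 (by simpa using hi))
        nlinarith [hq0 i]
    have hcard : ∑ i : Fin a, (if (i : ℕ) < r then (1 : ℝ) else 0) = r := by
      rw [Finset.sum_ite, Finset.sum_const_zero, add_zero, Finset.sum_const, nsmul_one]
      congr 1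
      have : (Finset.univ.filter fun i : Fin a => (i : ℕ) < r) = Finset.Iio ⟨r, hra⟩ := by
        ext i; simp [Fin.lt_def]
      rw [this, Fin.card_Iio]
    have h := Finset.sum_le_sum fun i (_ : i ∈ Finset.univ) => key i
    rw [← Finset.mul_sum, Finset.sum_sub_distrib, Finset.sum_sub_distrib, hcard] at h
    rw [Finset.sum_filter]
    nlinarith [hs0 ⟨r, hra⟩]
  · rw [Finset.filter_false_of_mem fun i _ => by have := i.2; omega, Finset.sum_empty]
    exact Finset.sum_nonneg fun i _ => mul_nonneg (hs0 i) (sub_nonneg.2 (hq1 i))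

/-- The optimality half of Eckart-Young. In Schmidt form, let K be the column space of the
approximant and q_i the squared norm of the projection of e_i to K. Then the q_i sum to dim K ≤ r,
and column i alone contributes an error of at least s_i(1 - q_i). -/
theorem entPure_le_normSq_sub (hab : a ≤ b) (r : ℕ) (Ψ X : Vec a b) (hX : (mat X).rank ≤ r) :
    entPure r Ψ ≤ normSq (Ψ - X) := by
  obtain ⟨U, hU, V, hV, h⟩ := exists_schmidt_decomposition hab Ψ
  set s := schmidtVector Ψ
  have hs0 : ∀ i, 0 ≤ s i := schmidtVector_nonneg Ψ
  set Y : Vec a b := (U ⊗ₖ V) *ᵥ X with hY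
  have hYr : (mat Y).rank ≤ r := (rank_mat_kronecker_mulVec_le _ _ _).trans hX
  rw [← normSq_mulVec_of_unitary (kronecker_conjTranspose_mul_self hU hV), Matrix.mulVec_sub, h,
    ← hY]
  set col : Fin b → EuclideanSpace ℂ (Fin a) := fun j => WithLp.toLp 2 ((mat Y).col j) with hcol
  set K := Submodule.span ℂ (Set.range col) with hK
  have hKr : Module.finrank ℂ K ≤ r := by
    refine le_of_eq_of_le ?_ hYr
    rw [Matrix.rank_eq_finrank_span_cols, hK]
    have : Submodule.span ℂ (Set.range col) = (Submodule.span ℂ (Set.range (mat Y).col)).map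
        ((WithLp.linearEquiv 2 ℂ (Fin a → ℂ)).symm : (Fin a → ℂ) →ₗ[ℂ] _) := by
      rw [Submodule.map_span, ← Set.range_comp]
      rfl
    rw [this]
    exact LinearEquiv.finrank_map_eq _ _
  let e : OrthonormalBasis (Fin a) ℂ (EuclideanSpace ℂ (Fin a)) := EuclideanSpace.basisFun _ ℂ
  let u := stdOrthonormalBasis ℂ K
  let q : Fin a → ℝ := fun i => ‖K.orthogonalProjectionOnto (e i)‖ ^ 2
  have hpyth : ∀ i, q i + ‖Kᗮ.orthogonalProjectionOnto (e i)‖ ^ 2 = 1 := by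
    intro i
    have := Submodule.norm_sq_eq_add_norm_sq_projection (e i) K
    rw [e.orthonormal.1 i, one_pow] at this
    exact this.symm
  have hq1 : ∀ i, q i ≤ 1 := fun i => by
    have := hpyth i; have h2 := sq_nonneg ‖Kᗮ.orthogonalProjectionOnto (e i)‖; linarith
  have hq : ∑ i, q i ≤ r := by
    have h1 : ∀ i, q i = ∑ k, ‖inner ℂ (u k : EuclideanSpace ℂ (Fin a)) (e i)‖ ^ 2 := by
      intro i
      simp only [q]
      rw [← u.sum_sq_norm_inner_right]
      simp only [Submodule.inner_orthogonalProjectionOnto_eq_of_mem_left]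
    rw [Finset.sum_congr rfl fun i _ => h1 i, Finset.sum_comm]
    have h2 : ∀ k, ∑ i, ‖inner ℂ (u k : EuclideanSpace ℂ (Fin a)) (e i)‖ ^ 2 = 1 := by
      intro k
      rw [e.sum_sq_norm_inner_left, Submodule.norm_coe, u.orthonormal.1 k, one_pow]
    rw [Finset.sum_congr rfl fun k _ => h2 k]
    simpa using hKr
  refine (sum_le_sum_mul_one_sub r (antitone_schmidtVector Ψ) hs0
    (fun i => sq_nonneg _) hq1 hq).trans ?_
  rw [normSq_eq_sum]
  set D : Vec a b := diagVec a b fun i => Real.sqrt (s i)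
  -- Projecting column i of the difference to the complement of K kills the column of `Y` and leaves
  -- the projection of √s_i e_i.
  have hcolumn : ∀ i : Fin a, s i * (1 - q i) ≤
      ∑ k, ‖(D - Y) (k, Fin.castLE hab i)‖ ^ 2 := by
    intro i
    have h1 : ∑ k, ‖(D - Y) (k, Fin.castLE hab i)‖ ^ 2 =
        ‖((Real.sqrt (s i) : ℝ) : ℂ) • e i - col (Fin.castLE hab i)‖ ^ 2 := by
      rw [EuclideanSpace.norm_sq_eq]
      refine Finset.sum_congr rfl fun k _ => ?_
      congr 2
      simp only [e, col, D, diagVec, Pi.sub_apply, EuclideanSpace.basisFun_apply, PiLp.sub_apply,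
        PiLp.smul_apply, mat, Matrix.col_apply, Matrix.of_apply, Fin.val_castLE,
        PiLp.single_apply, Fin.val_inj]
      split_ifs with hki
      · simp [hki]
      · simp
    have h2 := Submodule.norm_sq_eq_add_norm_sq_projection
      (((Real.sqrt (s i) : ℝ) : ℂ) • e i - col (Fin.castLE hab i)) K
    have h3 : Kᗮ.orthogonalProjectionOnto (col (Fin.castLE hab i)) = 0 := by
      rw [Submodule.orthogonalProjectionOnto_eq_zero_iff]
      exact K.le_orthogonal_orthogonal (Submodule.subset_span ⟨_, rfl⟩)
    rw [map_sub (Kᗮ.orthogonalProjectionOnto), map_smul (Kᗮ.orthogonalProjectionOnto), h3, sub_zero,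
      norm_smul, mul_pow, Complex.norm_real, Real.norm_eq_abs, sq_abs, Real.sq_sqrt (hs0 i)] at h2
    rw [h1, h2, ← hpyth i, add_sub_cancel_left]
    exact le_add_of_nonneg_left (sq_nonneg _)
  calc ∑ i, s i * (1 - q i) ≤ ∑ i : Fin a, ∑ k, ‖(D - Y) (k, Fin.castLE hab i)‖ ^ 2 :=
        Finset.sum_le_sum fun i _ => hcolumn i
    _ = ∑ j ∈ Finset.univ.map (Fin.castLEEmb hab), ∑ k, ‖(D - Y) (k, j)‖ ^ 2 := by
        rw [Finset.sum_map]; rfl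
    _ ≤ _ := Finset.sum_le_sum_of_subset_of_nonneg (Finset.subset_univ _) fun j _ _ =>
        Finset.sum_nonneg fun _ _ => sq_nonneg _

/-! ### Sets of states with limited entanglement are closed under LOCC -/

theorem krausMap_sum_proj {ι κ : Type} [Fintype ι] [Fintype κ] {a' b' : ℕ}
    (A : ι → Matrix (Fin a') (Fin a) ℂ) (B : ι → Matrix (Fin b') (Fin b) ℂ) (v : κ → Vec a b) :
    krausMap A B (∑ k, proj (v k)) = ∑ x : ι × κ, proj ((A x.1 ⊗ₖ B x.1) *ᵥ v x.2) := by
  simp only [krausMap, Matrix.mul_sum, Matrix.sum_mul, Fintype.sum_prod_type, proj_mulVec]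

theorem sum_normSq_kraus {ι : Type} [Fintype ι] {a' b' : ℕ} {A : ι → Matrix (Fin a') (Fin a) ℂ}
    {B : ι → Matrix (Fin b') (Fin b) ℂ} (h : IsKraus A B) (v : Vec a b) :
    ∑ i, normSq ((A i ⊗ₖ B i) *ᵥ v) = normSq v := by
  have := trace_krausMap h (proj v)
  rw [krausMap, Matrix.trace_sum] at this
  simp only [← proj_mulVec, trace_proj_eq_normSq] at this
  exact_mod_cast this

theorem smul_mem_rank_le (r : ℕ) (c : ℂ) (v : Vec a b) (hv : v ∈ {v : Vec a b | (mat v).rank ≤ r}) :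
    c • v ∈ {v : Vec a b | (mat v).rank ≤ r} :=
  (rank_mat_smul_le c v).trans hv

theorem schmidtSet_eq (a b r : ℕ) : schmidtSet a b r = convexHull ℝ {σ | ∃ Ψ : Vec a b, IsPure Ψ ∧
    Ψ ∈ {v : Vec a b | (mat v).rank ≤ r} ∧ σ = proj Ψ} := by
  simp only [schmidtSet, schmidtRank_eq_rank, Set.mem_ofPred_eq]

theorem schmidtSet_subset_states (a b r : ℕ) : schmidtSet a b r ⊆ states a b := by
  intro σ hσ
  rw [schmidtSet_eq] at hσ
  exact mem_states_of_mem_convexHull hσ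

theorem krausClosed_schmidtSet (a b r : ℕ) : KrausClosed (schmidtSet a b r) := by
  intro ι _ A B hAB σ hσ
  have htr := (krausMap_mem_states hAB (schmidtSet_subset_states a b r hσ)).2
  rw [schmidtSet_eq] at hσ ⊢
  obtain ⟨κ, _, v, hv, rfl⟩ := exists_sum_proj_of_mem_convexHull (smul_mem_rank_le r) hσ
  rw [krausMap_sum_proj] at htr ⊢
  exact sum_proj_mem_convexHull (smul_mem_rank_le r) _
    (fun x => (rank_mat_kronecker_mulVec_le _ _ _).trans (hv x.2)) htr

theorem entPure_nonneg (r : ℕ) (Ψ : Vec a b) : 0 ≤ entPure r Ψ :=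
  Finset.sum_nonneg fun _ _ => schmidtVector_nonneg Ψ _

/-- The values over which the infimum in the convex roof `entMixed r σ` is taken. -/
def roofValues (r : ℕ) (σ : Op a b) : Set ℝ :=
  {x | ∃ (L : ℕ) (p : Fin L → ℝ) (Ψ : Fin L → Vec a b),
    (∀ l, 0 ≤ p l) ∧ ∑ l, p l = 1 ∧ (∀ l, IsPure (Ψ l)) ∧
    ∑ l, (p l : ℂ) • proj (Ψ l) = σ ∧ x = ∑ l, p l * entPure r (Ψ l)}

theorem sum_mem_roofValues {ι : Type} [Fintype ι] (r : ℕ) (p : ι → ℝ) (Ψ : ι → Vec a b)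
    (hp : ∀ i, 0 ≤ p i) (hp1 : ∑ i, p i = 1) (hΨ : ∀ i, IsPure (Ψ i)) :
    ∑ i, p i * entPure r (Ψ i) ∈ roofValues r (∑ i, p i • proj (Ψ i)) := by
  let e := (Fintype.equivFin ι).symm
  refine ⟨Fintype.card ι, p ∘ e, Ψ ∘ e, fun _ => hp _, ?_, fun _ => hΨ _, ?_, ?_⟩
  · rw [← hp1, ← e.sum_comp]; rfl
  · rw [← e.sum_comp]; simp
  · rw [← e.sum_comp]; rfl

theorem bddBelow_roofValues (r : ℕ) (σ : Op a b) : BddBelow (roofValues r σ) := by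
  refine ⟨0, ?_⟩
  rintro _ ⟨L, p, Ψ, hp, -, -, -, rfl⟩
  exact Finset.sum_nonneg fun l _ => mul_nonneg (hp l) (entPure_nonneg r _)

/-- The distance to vectors of bounded rank scales with the vector, so the Eckart-Young bound needs
no normalization. -/
theorem normSq_mul_entPure_normalize_le (hab : a ≤ b) (r : ℕ) {v : Vec a b} (hv : v ≠ 0)
    {X : Vec a b} (hX : (mat X).rank ≤ r) :
    normSq v * entPure r (normalize v) ≤ normSq (v - X) := by
  have h0 : 0 < normSq v := (normSq_nonneg v).lt_of_ne' fun h => hv (normSq_eq_zero.1 h)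
  have h := entPure_le_normSq_sub hab r (normalize v)
    ((((Real.sqrt (normSq v))⁻¹ : ℝ) : ℂ) • X) ((rank_mat_smul_le _ _).trans hX)
  rw [normalize, ← smul_sub, normSq_smul, Complex.norm_real, Real.norm_eq_abs, sq_abs, inv_pow,
    Real.sq_sqrt h0.le] at h
  calc normSq v * entPure r (normalize v)
      ≤ normSq v * ((normSq v)⁻¹ * normSq (v - X)) := mul_le_mul_of_nonneg_left h h0.le
    _ = normSq (v - X) := by rw [← mul_assoc, mul_inv_cancel₀ h0.ne', one_mul]

theorem entMixed_sum_proj_le (hab : a ≤ b) (r : ℕ) {ι : Type} [Fintype ι] (v X : ι → Vec a b)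
    (hX : ∀ i, (mat (X i)).rank ≤ r) (h : (∑ i, proj (v i)).trace = 1) :
    entMixed r (∑ i, proj (v i)) ≤ ∑ i, normSq (v i - X i) := by
  obtain ⟨hsum, u, hu, -, hun, hvu⟩ := exists_ensemble v h
  rw [Finset.sum_congr rfl fun i _ => hvu i]
  refine (csInf_le (bddBelow_roofValues r _) (sum_mem_roofValues r (fun i => normSq (v i)) u
    (fun i => normSq_nonneg _) hsum hu)).trans (Finset.sum_le_sum fun i _ => ?_)
  rcases eq_or_ne (v i) 0 with hi | hi
  · rw [hi, normSq_eq_zero.2 rfl, zero_mul]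
    exact normSq_nonneg _
  · rw [hun i hi]
    exact normSq_mul_entPure_normalize_le hab r hi (hX i)

theorem roofValues_nonempty (r : ℕ) {σ : Op a b} (hσ : σ ∈ states a b) :
    (roofValues r σ).Nonempty := by
  obtain ⟨m, v, hv⟩ := Matrix.posSemidef_iff_eq_sum_vecMulVec.1 hσ.1
  have h2 := hσ.2
  obtain rfl : σ = ∑ i, proj (v i) := hv
  obtain ⟨hsum, u, hu, -, -, hvu⟩ := exists_ensemble v h2
  rw [Finset.sum_congr rfl fun i _ => hvu i]
  exact ⟨_, sum_mem_roofValues r (fun i => normSq (v i)) u (fun i => normSq_nonneg _) hsum hu⟩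

/-- Take a decomposition of σ together with best rank-r approximants. Applying every Kraus operator
to the vectors and to the approximants gives a decomposition of the image with approximants of rank
at most r, and completeness preserves the total squared error. -/
theorem entMixed_krausMap_le (hab : a ≤ b) (r : ℕ) {ι : Type} [Fintype ι]
    {A : ι → Matrix (Fin a) (Fin a) ℂ} {B : ι → Matrix (Fin b) (Fin b) ℂ} (h : IsKraus A B)
    {σ : Op a b} (hσ : σ ∈ states a b) : entMixed r (krausMap A B σ) ≤ entMixed r σ := by
  refine le_csInf (roofValues_nonempty r hσ) ?_
  rintro _ ⟨L, p, Ψ, hp, hp1, hΨ, rfl, rfl⟩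
  have htr := (krausMap_mem_states h hσ).2
  choose X hX hXΨ using fun l => exists_rank_le_normSq_sub_eq hab r (Ψ l)
  have e1 : ∑ l, (p l : ℂ) • proj (Ψ l) =
      ∑ l, proj (((Real.sqrt (p l) : ℝ) : ℂ) • Ψ l) :=
    Finset.sum_congr rfl fun l _ => (proj_sqrt_smul (hp l) _).symm
  rw [e1, krausMap_sum_proj] at htr ⊢
  refine (entMixed_sum_proj_le hab r _ (fun x : ι × Fin L =>
    (A x.1 ⊗ₖ B x.1) *ᵥ (((Real.sqrt (p x.2) : ℝ) : ℂ) • X x.2)) (fun x =>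
      (rank_mat_kronecker_mulVec_le _ _ _).trans ((rank_mat_smul_le _ _).trans (hX _)))
      htr).trans ?_
  simp only [← Matrix.mulVec_sub, ← smul_sub]
  rw [Fintype.sum_prod_type_right]
  refine Finset.sum_le_sum fun l _ => ?_
  dsimp only
  rw [sum_normSq_kraus h, normSq_smul, Complex.norm_real, Real.norm_eq_abs, sq_abs,
    Real.sq_sqrt (hp l), hXΨ]

theorem krausClosed_entSet (hab : a ≤ b) (r : ℕ) (E : ℝ) : KrausClosed (entSet a b r E) :=
  fun _ _ _ _ hAB _ hσ => ⟨krausMap_mem_states hAB hσ.1,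
    (entMixed_krausMap_le hab r hAB hσ.1).trans hσ.2⟩

/-! ### Majorization -/

theorem sortDesc_eq_self {d : ℕ} {x : Fin d → ℝ} (hx : Antitone x) : sortDesc x = x := by
  have h : Tuple.sort (fun j => -x j) = Equiv.refl _ :=
    Tuple.sort_eq_refl_iff_monotone.2 fun i j hij => neg_le_neg (hx hij)
  ext i
  simp [sortDesc, h]

/-- Abel summation as an induction on `k`. The signs of `c` are unrestricted: the boundary term
stays on the left and vanishes once the total of `z` is zero. -/
theorem mul_sum_range_le_of_antitone {n : ℕ} {c z : ℕ → ℝ} (hc : ∀ i, i + 1 < n → c (i + 1) ≤ c i)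
    (hz : ∀ k < n, 0 ≤ ∑ i ∈ Finset.range (k + 1), z i) {k : ℕ} (hk : k < n) :
    c k * ∑ i ∈ Finset.range (k + 1), z i ≤ ∑ i ∈ Finset.range (k + 1), c i * z i := by
  induction k with
  | zero => simp
  | succ k ih =>
    rw [Finset.sum_range_succ, Finset.sum_range_succ (fun i => c i * z i), mul_add]
    have h1 := ih (by omega)
    have h2 := mul_le_mul_of_nonneg_right (hc k hk) (hz k (by omega))
    linarith

theorem sum_Iic_eq_sum_range {n : ℕ} (f : Fin n → ℝ) (k : Fin n) :
    ∑ j ∈ Finset.Iic k, f j =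
      ∑ i ∈ Finset.range (k + 1), if h : i < n then f ⟨i, h⟩ else 0 := by
  refine Finset.sum_bij (fun j _ => (j : ℕ)) ?_ ?_ ?_ ?_
  · intro j hj
    simpa [Nat.lt_succ_iff] using hj
  · intro i _ j _ h
    exact Fin.ext h
  · intro i hi
    have hi' : i < k + 1 := by simpa using hi
    exact ⟨⟨i, by omega⟩, by simpa [Fin.le_def] using Nat.lt_succ_iff.1 hi', rfl⟩
  · intro j _
    simp

/-- Abel summation: pairing with an antitone vector is monotone for dominance of partial sums. -/
theorem sum_mul_le_sum_mul_of_antitone {n : ℕ} {c x y : Fin n → ℝ} (hc : Antitone c)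
    (h : ∀ k, ∑ j ∈ Finset.Iic k, x j ≤ ∑ j ∈ Finset.Iic k, y j) (h1 : ∑ j, x j = ∑ j, y j) :
    ∑ j, c j * x j ≤ ∑ j, c j * y j := by
  rcases n with _ | n
  · simp
  let c' : ℕ → ℝ := fun i => if h : i < n + 1 then c ⟨i, h⟩ else 0
  let z' : ℕ → ℝ := fun i => if h : i < n + 1 then (y - x) ⟨i, h⟩ else 0
  have hlast : Finset.Iic (Fin.last n) = Finset.univ := by
    ext i; simp [Fin.le_last]
  have key := mul_sum_range_le_of_antitone (n := n + 1) (c := c') (z := z') ?_ ?_ (Nat.lt_succ_self n)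
  · have e1 : ∑ i ∈ Finset.range (n + 1), z' i = 0 := by
      have := sum_Iic_eq_sum_range (y - x) (Fin.last n)
      rw [hlast] at this
      simp only [Fin.val_last] at this
      rw [← this]
      simp [h1]
    have e2 : ∑ i ∈ Finset.range (n + 1), c' i * z' i = ∑ j, c j * (y - x) j := by
      have := sum_Iic_eq_sum_range (fun j => c j * (y - x) j) (Fin.last n)
      rw [hlast] at this
      rw [this]
      refine Finset.sum_congr rfl fun i hi => ?_
      have hi' : i < n + 1 := by simpa using hi
      simp only [c', z', hi', dif_pos]
    rw [e1, e2, mul_zero] at key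
    simpa [mul_sub] using key
  · intro i hi
    have hi' : i < n + 1 := by omega
    simp only [c', hi, hi', dif_pos]
    exact hc (Fin.le_def.2 (by simp))
  · intro k hk
    have := sum_Iic_eq_sum_range (y - x) ⟨k, hk⟩
    rw [← this]
    simpa using h ⟨k, hk⟩

/-- A vector which is majorized by `y` is a convex combination of permutations of `y`. -/
theorem exists_eq_sum_perm {n : ℕ} {x y : Fin n → ℝ} (hx : Antitone x)
    (h : ∀ k, ∑ j ∈ Finset.Iic k, x j ≤ ∑ j ∈ Finset.Iic k, y j) (h1 : ∑ j, x j = ∑ j, y j) :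
    ∃ w : Equiv.Perm (Fin n) → ℝ, (∀ π, 0 ≤ w π) ∧ ∑ π, w π = 1 ∧
      ∀ i, x i = ∑ π, w π * y (π.symm i) := by
  let L : (Equiv.Perm (Fin n) → ℝ) →ₗ[ℝ] (Fin n → ℝ) :=
    Fintype.linearCombination ℝ fun π : Equiv.Perm (Fin n) => y ∘ π.symm
  have hL : ∀ w i, L w i = ∑ π, w π * y (π.symm i) := by
    intro w i
    simp [L, Fintype.linearCombination_apply, Finset.sum_apply]
  by_cases hxT : x ∈ L '' stdSimplex ℝ (Equiv.Perm (Fin n))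
  · obtain ⟨w, hw, rfl⟩ := hxT
    exact ⟨w, hw.1, hw.2, hL w⟩
  exfalso
  -- Otherwise a functional separates `x` from the compact convex hull of the permutations of `y`.
  -- Sorting its coefficients can only raise its value at `x` (rearrangement), the sorted functional
  -- is no larger at `x` than at `y` (Abel), and that last value is the original functional at a
  -- permutation of `y`.
  obtain ⟨f, u, hf, hu⟩ := geometric_hahn_banach_closed_point
    ((convex_stdSimplex ℝ (Equiv.Perm (Fin n))).linear_image L)
    ((isCompact_stdSimplex ℝ (Equiv.Perm (Fin n))).image
      (LinearMap.continuous_of_finiteDimensional L)).isClosed hxT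
  let c : Fin n → ℝ := fun i => f fun j => if i = j then 1 else 0
  have hfc : ∀ z, f z = ∑ i, z i * c i := fun z => by
    simpa using (f : (Fin n → ℝ) →ₗ[ℝ] ℝ).pi_apply_eq_sum_univ z
  let π := Tuple.sort fun i => -c i
  have hc : Antitone (c ∘ π) := antitone_sortDesc c
  have h2 : f x ≤ ∑ i, x i * (c ∘ π) i := by
    have hm : Monovary x (c ∘ π) := hx.monovary hc
    have := hm.sum_mul_comp_perm_le_sum_mul (σ := π.symm)
    rw [hfc]
    simpa using this
  have h3 := sum_mul_le_sum_mul_of_antitone hc h h1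
  have h4 : ∑ i, (c ∘ π) i * y i = f (y ∘ π.symm) := by
    rw [hfc, ← Equiv.sum_comp π fun i => (y ∘ π.symm) i * c i]
    exact Finset.sum_congr rfl fun i _ => by simp [mul_comm]
  have h5 : y ∘ π.symm ∈ L '' stdSimplex ℝ (Equiv.Perm (Fin n)) :=
    ⟨_, single_mem_stdSimplex ℝ π, by
      ext i; rw [hL, Finset.sum_eq_single π] <;> simp +contextual⟩
  have h6 := hf _ h5
  simp only [mul_comm (x _)] at h2
  linarith

/-! ### Majorization implies convertibility by LOCC -/

theorem LOCCTransforms.of_kraus {ι : Type} [Fintype ι] {Ψ Υ : Vec a b} (hΨ : IsPure Ψ)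
    (hΥ : IsPure Υ) (A : ι → Matrix (Fin a) (Fin a) ℂ) (V : ι → Matrix (Fin b) (Fin b) ℂ)
    (hA : ∑ i, (A i)ᴴ * A i = 1) (hV : ∀ i, V i ∈ Matrix.unitaryGroup (Fin b) ℂ) (c : ι → ℂ)
    (h : ∀ i, (A i ⊗ₖ V i) *ᵥ Ψ = c i • Υ) : LOCCTransforms Ψ Υ := by
  have hV' : ∀ i, (V i)ᴴ * V i = 1 := fun i => by
    have := hV i
    rwa [Matrix.mem_unitaryGroup_iff', Matrix.star_eq_conjTranspose] at this
  have hK : IsKraus A V := by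
    simp only [IsKraus, Matrix.conjTranspose_kronecker, ← Matrix.mul_kronecker_mul, hV',
      sum_kronecker, hA, Matrix.one_kronecker_one]
  have hc : ∑ i, ‖c i‖ ^ 2 = 1 := by
    have := sum_normSq_kraus hK Ψ
    simp only [h, normSq_smul, ← Finset.sum_mul] at this
    rwa [show normSq Υ = 1 from hΥ, show normSq Ψ = 1 from hΨ, mul_one] at this
  let e := (Fintype.equivFin ι).symm
  refine ⟨.alice (Fintype.card ι) (fun _ => a) (fun i => A (e i))
    (by rw [← hA, ← e.sum_comp]) fun i =>
      .bob 1 (fun _ => b) (fun _ => V (e i)) (by simp [hV']) fun _ => .done (), ?_⟩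
  have key : ∀ i, ((1 : Matrix (Fin a) (Fin a) ℂ) ⊗ₖ V i) *
      ((A i ⊗ₖ (1 : Matrix (Fin b) (Fin b) ℂ)) * proj Ψ *
        (A i ⊗ₖ (1 : Matrix (Fin b) (Fin b) ℂ))ᴴ) *
      ((1 : Matrix (Fin a) (Fin a) ℂ) ⊗ₖ V i)ᴴ = ((‖c i‖ ^ 2 : ℝ) : ℂ) • proj Υ := by
    intro i
    rw [← proj_mulVec, ← proj_mulVec, Matrix.mulVec_mulVec, ← Matrix.mul_kronecker_mul,
      Matrix.one_mul, Matrix.mul_one, h, proj_smul]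
  simp only [LOCC.instrument, key, if_true, Finset.univ_unique, Finset.sum_const,
    Finset.card_singleton, one_smul]
  rw [e.sum_comp fun i => ((‖c i‖ ^ 2 : ℝ) : ℂ) • proj Υ, ← Finset.sum_smul, ← Complex.ofReal_sum,
    hc, Complex.ofReal_one, one_smul]

theorem LOCCTransforms.of_unitary {Ψ Υ : Vec a b} (hΨ : IsPure Ψ) (hΥ : IsPure Υ)
    {U : Matrix (Fin a) (Fin a) ℂ} {V : Matrix (Fin b) (Fin b) ℂ}
    (hU : U ∈ Matrix.unitaryGroup (Fin a) ℂ) (hV : V ∈ Matrix.unitaryGroup (Fin b) ℂ)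
    (h : (U ⊗ₖ V) *ᵥ Ψ = Υ) : LOCCTransforms Ψ Υ := by
  rw [Matrix.mem_unitaryGroup_iff', Matrix.star_eq_conjTranspose] at hU
  exact .of_kraus (ι := Unit) hΨ hΥ (fun _ => U) (fun _ => V) (by simpa using hU) (fun _ => hV)
    (fun _ => 1) (by simpa using h)

theorem permMatrix_mem_unitaryGroup {n : ℕ} (σ : Equiv.Perm (Fin n)) :
    σ.permMatrix ℂ ∈ Matrix.unitaryGroup (Fin n) ℂ := by
  rw [Matrix.mem_unitaryGroup_iff, Matrix.star_eq_conjTranspose, Matrix.conjTranspose_permMatrix,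
    ← Matrix.permMatrix_mul]
  simp

theorem permMatrix_kronecker_mulVec (σ : Equiv.Perm (Fin a)) (τ : Equiv.Perm (Fin b))
    (v : Vec a b) : (σ.permMatrix ℂ ⊗ₖ τ.permMatrix ℂ) *ᵥ v = fun p => v (σ p.1, τ p.2) := by
  ext ⟨i, j⟩
  simp [Matrix.mulVec, dotProduct, Fintype.sum_prod_type, Equiv.Perm.permMatrix,
    PEquiv.toMatrix_apply]

theorem diagonal_kronecker_one_mulVec (d : Fin a → ℂ) (v : Vec a b) :
    (Matrix.diagonal d ⊗ₖ (1 : Matrix (Fin b) (Fin b) ℂ)) *ᵥ v = fun p => d p.1 * v p := by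
  ext ⟨i, j⟩
  rw [← Matrix.diagonal_one, Matrix.diagonal_kronecker_diagonal, Matrix.mulVec_diagonal]
  simp

theorem unitary_conjTranspose_mem {n : ℕ} {U : Matrix (Fin n) (Fin n) ℂ}
    (hU : U ∈ Matrix.unitaryGroup (Fin n) ℂ) : Uᴴ ∈ Matrix.unitaryGroup (Fin n) ℂ := by
  rw [← Matrix.star_eq_conjTranspose]
  exact Unitary.star_mem hU

/-- Nielsen's theorem: a pure state can be transformed by LOCC into every pure state whose Schmidt
vector majorizes its own. -/
theorem LOCCTransforms.of_majorized (hab : a ≤ b) {Ψ Υ : Vec a b} (hΨ : IsPure Ψ)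
    (hΥ : IsPure Υ) (h : Majorized (schmidtVector Ψ) (schmidtVector Υ)) : LOCCTransforms Ψ Υ := by
  have hx := antitone_schmidtVector Ψ
  have hx0 := schmidtVector_nonneg Ψ
  have hy0 := schmidtVector_nonneg Υ
  rw [Majorized, sortDesc_eq_self hx, sortDesc_eq_self (antitone_schmidtVector Υ)] at h
  obtain ⟨w, hw0, hw1, hw⟩ := exists_eq_sum_perm hx h.1 h.2
  obtain ⟨U, hU, V, hV, hUV⟩ := exists_schmidt_decomposition hab Ψ
  obtain ⟨U', hU', V', hV', hUV'⟩ := exists_schmidt_decomposition hab Υ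
  set x := schmidtVector Ψ
  set y := schmidtVector Υ
  -- Outcome π has probability w_π and should turn √x into √y permuted by π. Where x_i = 0 the entry
  -- does not act on Ψ, and the value √w_π is chosen to keep the Kraus family complete.
  let d : Equiv.Perm (Fin a) → Fin a → ℝ := fun π i =>
    Real.sqrt (w π) * if x i = 0 then 1 else Real.sqrt (y (π.symm i)) / Real.sqrt (x i)
  have hd : ∀ i, ∑ π, d π i ^ 2 = 1 := by
    intro i
    by_cases hi : x i = 0
    · simp [d, hi, Real.sq_sqrt, hw0, hw1]
    · simp only [d, hi, if_false, mul_pow, div_pow, Real.sq_sqrt (hw0 _), Real.sq_sqrt (hy0 _),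
        Real.sq_sqrt (hx0 _), ← mul_div_assoc]
      rw [← Finset.sum_div, ← hw, div_self hi]
  have hdx : ∀ π i, d π i * Real.sqrt (x i) = Real.sqrt (w π) * Real.sqrt (y (π.symm i)) := by
    intro π i
    by_cases hi : x i = 0
    · have h0 : w π * y (π.symm i) = 0 := by
        have h1 := hw i
        rw [hi, eq_comm, Finset.sum_eq_zero_iff_of_nonneg
          fun π _ => mul_nonneg (hw0 π) (hy0 _)] at h1
        exact h1 π (Finset.mem_univ _)
      rw [hi, Real.sqrt_zero, mul_zero, ← Real.sqrt_mul (hw0 π), h0, Real.sqrt_zero]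
    · have : Real.sqrt (x i) ≠ 0 := (Real.sqrt_pos.2 ((hx0 i).lt_of_ne' hi)).ne'
      simp only [d, hi, if_false]
      field_simp
  let D : Equiv.Perm (Fin a) → Matrix (Fin a) (Fin a) ℂ := fun π =>
    Matrix.diagonal fun i => (d π i : ℂ)
  have hunit : ∀ {n : ℕ} {W : Matrix (Fin n) (Fin n) ℂ}, W ∈ Matrix.unitaryGroup (Fin n) ℂ →
      Wᴴ * W = 1 := fun hW => by
    rwa [Matrix.mem_unitaryGroup_iff', Matrix.star_eq_conjTranspose] at hW
  -- Alice measures in the Schmidt basis; both parties then undo π and rotate to the Schmidt basis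
  -- of Υ. Bob's permutation fixes the basis vectors beyond the first a, so every branch yields √w_π
  -- Υ.
  refine .of_kraus hΨ hΥ (fun π => U'ᴴ * (π.permMatrix ℂ * (D π * U)))
    (fun π => V'ᴴ * ((π.viaEmbedding (Fin.castLEEmb hab)).permMatrix ℂ * V)) ?_ (fun π =>
      mul_mem (unitary_conjTranspose_mem hV') (mul_mem (permMatrix_mem_unitaryGroup _) hV))
    (fun π => (Real.sqrt (w π) : ℂ)) fun π => ?_
  · have h1 : ∀ π : Equiv.Perm (Fin a), (U'ᴴ * (π.permMatrix ℂ * (D π * U)))ᴴ *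
        (U'ᴴ * (π.permMatrix ℂ * (D π * U))) =
        Uᴴ * (Matrix.diagonal fun i => ((d π i ^ 2 : ℝ) : ℂ)) * U := by
      intro π
      have e1 := hunit (unitary_conjTranspose_mem hU')
      rw [Matrix.conjTranspose_conjTranspose] at e1
      have e2 := hunit (permMatrix_mem_unitaryGroup π)
      have e3 : (D π)ᴴ * D π = Matrix.diagonal fun i => ((d π i ^ 2 : ℝ) : ℂ) := by
        simp only [D, Matrix.diagonal_conjTranspose, Matrix.diagonal_mul_diagonal]
        congr 1; ext i
        simp [sq]
      calc _ = Uᴴ * ((D π)ᴴ * ((π.permMatrix ℂ)ᴴ * (U' * U'ᴴ) * π.permMatrix ℂ) * D π) * U := by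
            simp only [Matrix.conjTranspose_mul, Matrix.conjTranspose_conjTranspose,
              Matrix.mul_assoc]
        _ = _ := by rw [e1, Matrix.mul_one, e2, Matrix.mul_one, e3]
    rw [Finset.sum_congr rfl fun π _ => h1 π, ← Finset.sum_mul, ← Finset.mul_sum]
    have h2 : ∑ π, (Matrix.diagonal fun i => ((d π i ^ 2 : ℝ) : ℂ)) =
        (1 : Matrix (Fin a) (Fin a) ℂ) := by
      rw [← Matrix.diagonal_one]
      ext i j
      by_cases hij : i = j
      · subst hij
        simp only [Matrix.sum_apply, Matrix.diagonal_apply_eq]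
        exact_mod_cast hd i
      · simp [Matrix.sum_apply, hij]
    rw [h2, Matrix.mul_one, hunit hU]
  · have e1 : (U'ᴴ * (π.permMatrix ℂ * (D π * U))) ⊗ₖ
        (V'ᴴ * ((π.viaEmbedding (Fin.castLEEmb hab)).permMatrix ℂ * V)) =
        (U' ⊗ₖ V')ᴴ * ((π.permMatrix ℂ ⊗ₖ (π.viaEmbedding (Fin.castLEEmb hab)).permMatrix ℂ) *
          ((D π ⊗ₖ (1 : Matrix (Fin b) (Fin b) ℂ)) * (U ⊗ₖ V))) := by
      rw [Matrix.conjTranspose_kronecker]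
      simp only [← Matrix.mul_kronecker_mul, Matrix.one_mul]
    have e2 : Υ = (U' ⊗ₖ V')ᴴ *ᵥ diagVec a b fun i => Real.sqrt (y i) := by
      rw [← hUV', mulVec_conjTranspose_mulVec (kronecker_conjTranspose_mul_self hU' hV')]
    rw [e1, ← Matrix.mulVec_mulVec, ← Matrix.mulVec_mulVec, ← Matrix.mulVec_mulVec, hUV, e2,
      ← Matrix.mulVec_smul, diagonal_kronecker_one_mulVec, permMatrix_kronecker_mulVec]
    congr 1
    ext ⟨i, j⟩
    have hiff : ((π i : Fin a) : ℕ) = (π.viaEmbedding (Fin.castLEEmb hab)) j ↔ (i : ℕ) = j := by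
      have e3 : Fin.castLEEmb hab (π i) = (π.viaEmbedding (Fin.castLEEmb hab))
        (Fin.castLEEmb hab i) := (Equiv.Perm.viaEmbedding_apply _ _ _).symm
      have e4 : ((π i : Fin a) : ℕ) = (Fin.castLEEmb hab (π i) : Fin b) := rfl
      rw [e4, Fin.val_inj, e3, (Equiv.injective _).eq_iff, ← Fin.val_inj]
      rfl
    simp only [diagVec, Pi.smul_apply, hiff, smul_eq_mul]
    split_ifs
    · rw [← Complex.ofReal_mul, hdx, ← Complex.ofReal_mul, Equiv.symm_apply_apply]
    · simp

/-! ### The embedding of the smaller space -/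

/-- The isometric embedding of `ℂ^a` in `ℂ^b` as the span of the first basis vectors. -/
def embed (hab : a ≤ b) : Matrix (Fin b) (Fin a) ℂ :=
  Matrix.of fun k j => if k = Fin.castLE hab j then 1 else 0

theorem embed_conjTranspose_mul (hab : a ≤ b) : (embed hab)ᴴ * embed hab = 1 := by
  ext i j
  simp only [embed, Matrix.mul_apply, Matrix.conjTranspose_apply, Matrix.of_apply]
  rw [Finset.sum_eq_single (Fin.castLE hab i)]
  · simp [Matrix.one_apply, Fin.ext_iff]
  · intro k _ hk; simp [hk]
  · simp

/-- The projector on the orthogonal complement of the range of `embed`. -/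
def coembed (hab : a ≤ b) : Matrix (Fin b) (Fin b) ℂ := 1 - embed hab * (embed hab)ᴴ

theorem coembed_conjTranspose (hab : a ≤ b) : (coembed hab)ᴴ = coembed hab := by
  simp [coembed, Matrix.conjTranspose_sub, Matrix.conjTranspose_mul]

theorem coembed_mul_embed (hab : a ≤ b) : coembed hab * embed hab = 0 := by
  rw [coembed, Matrix.sub_mul, Matrix.mul_assoc, embed_conjTranspose_mul, Matrix.mul_one,
    Matrix.one_mul, sub_self]

theorem coembed_mul_self (hab : a ≤ b) : coembed hab * coembed hab = coembed hab := by
  have h : (embed hab)ᴴ * coembed hab = 0 := by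
    rw [← coembed_conjTranspose, ← Matrix.conjTranspose_mul, coembed_mul_embed,
      Matrix.conjTranspose_zero]
  calc coembed hab * coembed hab
      = coembed hab - embed hab * ((embed hab)ᴴ * coembed hab) := by
        nth_rewrite 1 [coembed]
        rw [Matrix.sub_mul, Matrix.one_mul, Matrix.mul_assoc]
    _ = coembed hab := by rw [h, Matrix.mul_zero, sub_zero]

/-- The isometric embedding of `ℂ^a ⊗ ℂ^a` in `ℂ^a ⊗ ℂ^b`. -/
def embed₂ (hab : a ≤ b) : Matrix (Fin a × Fin b) (Fin a × Fin a) ℂ :=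
  (1 : Matrix (Fin a) (Fin a) ℂ) ⊗ₖ embed hab

theorem embed₂_conjTranspose_mul (hab : a ≤ b) : (embed₂ hab)ᴴ * embed₂ hab = 1 := by
  rw [embed₂, Matrix.conjTranspose_kronecker, ← Matrix.mul_kronecker_mul, embed_conjTranspose_mul]
  simp

theorem one_sub_embed₂ (hab : a ≤ b) : 1 - embed₂ hab * (embed₂ hab)ᴴ =
    ((1 : Matrix (Fin a) (Fin a) ℂ) ⊗ₖ coembed hab) * 1 *
      ((1 : Matrix (Fin a) (Fin a) ℂ) ⊗ₖ coembed hab)ᴴ := by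
  rw [Matrix.mul_one, Matrix.conjTranspose_kronecker, ← Matrix.mul_kronecker_mul,
    coembed_conjTranspose, coembed_mul_self, embed₂, Matrix.conjTranspose_kronecker,
    ← Matrix.mul_kronecker_mul, ← Matrix.one_kronecker_one, Matrix.conjTranspose_one,
    Matrix.mul_one]
  ext ⟨i, j⟩ ⟨k, l⟩
  simp only [coembed, Matrix.sub_apply, Matrix.kroneckerMap_apply]
  ring

theorem embed₂_mulVec (hab : a ≤ b) (v : Vec a a) (i : Fin a) (j : Fin b) :
    (embed₂ hab *ᵥ v) (i, j) = if h : (j : ℕ) < a then v (i, ⟨j, h⟩) else 0 := by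
  have h1 : (embed₂ hab *ᵥ v) (i, j) = ∑ k, if j = Fin.castLE hab k then v (i, k) else 0 := by
    simp only [embed₂, embed, Matrix.mulVec, dotProduct, Fintype.sum_prod_type,
      Matrix.kroneckerMap_apply, Matrix.of_apply, Matrix.one_apply]
    rw [Finset.sum_eq_single i]
    · simp
    · intro k _ hk; simp [hk.symm]
    · simp
  rw [h1]
  split_ifs with h
  · rw [Finset.sum_eq_single ⟨j, h⟩]
    · simp
    · intro k _ hk
      rw [if_neg]
      rintro rfl
      exact hk (Fin.ext rfl)
    · simp
  · refine Finset.sum_eq_zero fun k _ => if_neg ?_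
    rintro rfl
    exact h k.2

theorem embed₂_mulVec_diagVec (hab : a ≤ b) (μ : Fin a → ℝ) :
    embed₂ hab *ᵥ diagVec a a μ = diagVec a b μ := by
  ext ⟨i, j⟩
  rw [embed₂_mulVec]
  simp only [diagVec]
  split_ifs with h1 h2
  · rfl
  · rfl
  · omega
  · rfl

/-! ### Averages over diagonal unitaries -/

/-- The unitary `U ⊗ Ū`. -/
def conjKron {d : ℕ} (U : Matrix (Fin d) (Fin d) ℂ) : Op d d := U ⊗ₖ U.map star

theorem conjKron_mul {d : ℕ} (U V : Matrix (Fin d) (Fin d) ℂ) :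
    conjKron (U * V) = conjKron U * conjKron V := by
  have : (U * V).map star = U.map star * V.map star := by
    ext i j
    simp [Matrix.mul_apply]
  rw [conjKron, this, Matrix.mul_kronecker_mul]; rfl

theorem map_star_mem_unitaryGroup {d : ℕ} {U : Matrix (Fin d) (Fin d) ℂ}
    (hU : U ∈ Matrix.unitaryGroup (Fin d) ℂ) : U.map star ∈ Matrix.unitaryGroup (Fin d) ℂ := by
  rw [Matrix.mem_unitaryGroup_iff] at hU ⊢
  ext i j
  have := congrArg star (congrFun (congrFun hU i) j)
  simp only [Matrix.mul_apply, Matrix.star_apply, star_sum, Matrix.map_apply, star_star,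
    star_mul'] at this ⊢
  rw [this]
  simp [Matrix.one_apply, apply_ite]

theorem conjKron_conjTranspose_mul {d : ℕ} {U : Matrix (Fin d) (Fin d) ℂ}
    (hU : U ∈ Matrix.unitaryGroup (Fin d) ℂ) : (conjKron U)ᴴ * conjKron U = 1 :=
  kronecker_conjTranspose_mul_self hU (map_star_mem_unitaryGroup hU)

/-- The standard additive character of `ℤ/3`. -/
def phase : AddChar (ZMod 3) ℂ := ZMod.stdAddChar

theorem phase_injective : Function.Injective phase := ZMod.injective_stdAddChar

theorem star_phase (t : ZMod 3) : star (phase t) = phase (-t) := by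
  rw [AddChar.map_neg_eq_conj]; rfl

/-- The diagonal unitary with phases `θ`. -/
def phaseMat {d : ℕ} (θ : Fin d → ZMod 3) : Matrix (Fin d) (Fin d) ℂ :=
  Matrix.diagonal fun j => phase (θ j)

theorem phaseMat_mem_unitaryGroup {d : ℕ} (θ : Fin d → ZMod 3) :
    phaseMat θ ∈ Matrix.unitaryGroup (Fin d) ℂ := by
  rw [Matrix.mem_unitaryGroup_iff, Matrix.star_eq_conjTranspose, phaseMat,
    Matrix.diagonal_conjTranspose, Matrix.diagonal_mul_diagonal, ← Matrix.diagonal_one]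
  congr 1
  ext j
  rw [Pi.star_apply, star_phase, ← AddChar.map_add_eq_mul, add_neg_cancel, AddChar.map_zero_eq_one]

/-- Orthogonality of characters: the sum vanishes unless the linear form in θ is zero. Modulo 3 the
coefficient 2, which occurs when x = w, is still nonzero; phases ±1 would also leave the terms with
x = w and y = z. -/
theorem sum_phase {d : ℕ} (x y z w : Fin d) :
    ∑ θ : Fin d → ZMod 3, phase (θ x - θ y - θ z + θ w) =
      if (x = y ∧ z = w) ∨ (x = z ∧ y = w) then (3 : ℂ) ^ d else 0 := by
  split_ifs with h
  · have h0 : ∀ θ : Fin d → ZMod 3, θ x - θ y - θ z + θ w = 0 := by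
      intro θ
      rcases h with ⟨rfl, rfl⟩ | ⟨rfl, rfl⟩ <;> ring
    simp [h0, AddChar.map_zero_eq_one]
  · let ℓ : (Fin d → ZMod 3) →+ ZMod 3 :=
      Pi.evalAddMonoidHom (fun _ : Fin d => ZMod 3) x - Pi.evalAddMonoidHom _ y -
        Pi.evalAddMonoidHom _ z + Pi.evalAddMonoidHom _ w
    have hℓ : ∀ θ, θ x - θ y - θ z + θ w = ℓ θ := fun θ => rfl
    simp only [hℓ]
    refine AddChar.sum_eq_zero_of_ne_one (ψ := phase.compAddMonoidHom ℓ) ?_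
    obtain ⟨k, hk⟩ : ∃ k : Fin d, ℓ (Pi.single k 1) ≠ 0 := by
      push Not at h
      simp only [← hℓ]
      by_cases hxy : x = y
      · refine ⟨z, ?_⟩
        have hzw : w ≠ z := fun e => h.1 hxy e.symm
        subst hxy
        simp [Pi.single_apply, hzw]
      · by_cases hxz : x = z
        · refine ⟨y, ?_⟩
          have hyw : w ≠ y := fun e => h.2 hxz e.symm
          subst hxz
          simp [Pi.single_apply, hyw]
        · refine ⟨x, ?_⟩
          rw [Pi.single_eq_same, Pi.single_eq_of_ne (Ne.symm hxy), Pi.single_eq_of_ne (Ne.symm hxz)]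
          rw [Pi.single_apply]
          split_ifs <;> decide
    intro h1
    refine hk (phase_injective ?_)
    rw [AddChar.map_zero_eq_one]
    exact DFunLike.congr_fun h1 (Pi.single k 1)

/-- The average of `(D ⊗ D̄) X (D ⊗ D̄)ᴴ` over diagonal unitaries `D`. -/
def phaseAvg {d : ℕ} (X : Op d d) : Op d d :=
  ∑ θ : Fin d → ZMod 3, ((3 : ℝ) ^ d)⁻¹ • (conjKron (phaseMat θ) * X * (conjKron (phaseMat θ))ᴴ)

theorem conjKron_phaseMat {d : ℕ} (θ : Fin d → ZMod 3) : conjKron (phaseMat θ) =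
    Matrix.diagonal fun p : Fin d × Fin d => phase (θ p.1) * phase (-θ p.2) := by
  have : (phaseMat θ).map star = Matrix.diagonal fun j => phase (-θ j) := by
    rw [phaseMat, Matrix.diagonal_map (star_zero _)]
    congr 1; ext j; exact star_phase _
  rw [conjKron, this, phaseMat, Matrix.diagonal_kronecker_diagonal]

theorem phaseAvg_apply {d : ℕ} (X : Op d d) (x y z w : Fin d) :
    phaseAvg X (x, y) (z, w) =
      if (x = y ∧ z = w) ∨ (x = z ∧ y = w) then X (x, y) (z, w) else 0 := by
  have h1 : ∀ θ : Fin d → ZMod 3,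
      (conjKron (phaseMat θ) * X * (conjKron (phaseMat θ))ᴴ) (x, y) (z, w) =
        X (x, y) (z, w) * phase (θ x - θ y - θ z + θ w) := by
    intro θ
    rw [conjKron_phaseMat, Matrix.diagonal_conjTranspose, Matrix.mul_diagonal,
      Matrix.diagonal_mul, Pi.star_apply, star_mul', star_phase, star_phase, neg_neg,
      sub_eq_add_neg, sub_eq_add_neg, AddChar.map_add_eq_mul, AddChar.map_add_eq_mul,
      AddChar.map_add_eq_mul]
    ring
  rw [phaseAvg, Matrix.sum_apply]
  simp only [Matrix.smul_apply, h1]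
  rw [← Finset.smul_sum, ← Finset.mul_sum, sum_phase]
  split_ifs
  · rw [← Complex.coe_smul, smul_eq_mul]
    push_cast
    field_simp
  · simp

theorem IsSepCone.phaseAvg {d : ℕ} {X : Op d d} (hX : IsSepCone X) : IsSepCone (phaseAvg X) := by
  refine IsSepCone.sum fun θ => ?_
  rw [← Complex.coe_smul]
  exact (hX.conj _ _).smul (by positivity)

/-! ### One-way strategies -/

/-- Tests realized by a measurement of Alice followed by a test of Bob depending on its outcome. -/
def IsOneWay (Ω : Op a b) : Prop :=
  ∃ (ι : Type) (_ : Fintype ι) (E : ι → Matrix (Fin a) (Fin a) ℂ)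
    (F : ι → Matrix (Fin b) (Fin b) ℂ), (∀ i, (E i).PosSemidef) ∧ ∑ i, E i = 1 ∧
    (∀ i, (F i).PosSemidef ∧ (1 - F i).PosSemidef) ∧ Ω = ∑ i, E i ⊗ₖ F i

theorem IsOneWay.isLocal {Ω : Op a b} (h : IsOneWay Ω) : IsLocal Ω := by
  obtain ⟨ι, _, E, F, hE, hE1, hF, rfl⟩ := h
  choose K hK using fun i => exists_eq_conjTranspose_mul_self (hE i)
  choose L hL using fun i => exists_eq_conjTranspose_mul_self (hF i).1
  choose L' hL' using fun i => exists_eq_conjTranspose_mul_self (hF i).2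
  let e := (Fintype.equivFin ι).symm
  refine ⟨a, b, .alice (Fintype.card ι) (fun _ => a) (fun i => K (e i))
    (by rw [← hE1, ← e.sum_comp]; exact Finset.sum_congr rfl fun i _ => (hK _).symm) fun i =>
      .bob 2 (fun _ => b) ![L (e i), L' (e i)] (by simp [Fin.sum_univ_two, ← hL, ← hL'])
        ![.done true, .done false], fun σ _ => ?_⟩
  have key : ∀ i, (((1 : Matrix (Fin a) (Fin a) ℂ) ⊗ₖ L i) *
      ((K i ⊗ₖ (1 : Matrix (Fin b) (Fin b) ℂ)) * σ *
        (K i ⊗ₖ (1 : Matrix (Fin b) (Fin b) ℂ))ᴴ) *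
      ((1 : Matrix (Fin a) (Fin a) ℂ) ⊗ₖ L i)ᴴ).trace = ((E i ⊗ₖ F i) * σ).trace := by
    intro i
    have h1 : E i ⊗ₖ F i = (((1 : Matrix (Fin a) (Fin a) ℂ) ⊗ₖ L i) *
        (K i ⊗ₖ (1 : Matrix (Fin b) (Fin b) ℂ)))ᴴ * (((1 : Matrix (Fin a) (Fin a) ℂ) ⊗ₖ L i) *
        (K i ⊗ₖ (1 : Matrix (Fin b) (Fin b) ℂ))) := by
      rw [← Matrix.mul_kronecker_mul, Matrix.one_mul, Matrix.mul_one,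
        Matrix.conjTranspose_kronecker, ← Matrix.mul_kronecker_mul, ← hK, ← hL]
    rw [h1, ← Matrix.trace_mul_cycle _ σ _, Matrix.conjTranspose_mul]
    simp only [Matrix.mul_assoc]
  have hR : ((∑ i, E i ⊗ₖ F i) * σ).trace = ∑ i, ((E (e i) ⊗ₖ F (e i)) * σ).trace := by
    rw [Matrix.sum_mul, Matrix.trace_sum, ← e.sum_comp]
  rw [hR]
  simp only [LOCC.instrument, Fin.sum_univ_two, Matrix.trace_sum]
  refine Finset.sum_congr rfl fun i _ => ?_
  simpa [LOCC.instrument] using key (e i)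

/-- Alice tosses the coin as a part of her measurement and announces it with the outcome. -/
theorem convex_isOneWay : Convex ℝ {Ω : Op a b | IsOneWay Ω} := by
  rintro _ ⟨ι, _, E, F, hE, hE1, hF, rfl⟩ _ ⟨κ, _, E', F', hE', hE1', hF', rfl⟩ r s hr hs hrs
  refine ⟨ι ⊕ κ, inferInstance, Sum.elim (fun i => r • E i) (fun i => s • E' i), Sum.elim F F',
    ?_, ?_, ?_, ?_⟩
  · rintro (i | i)
    exacts [(hE i).smul hr, (hE' i).smul hs]
  · simp only [Fintype.sum_sum_type, Sum.elim_inl, Sum.elim_inr]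
    rw [← Finset.smul_sum, ← Finset.smul_sum, hE1, hE1', ← add_smul, hrs, one_smul]
  · rintro (i | i)
    exacts [hF i, hF' i]
  · simp only [Fintype.sum_sum_type, Sum.elim_inl, Sum.elim_inr, Matrix.smul_kronecker,
      Finset.smul_sum]

theorem IsOneWay.conj {Ω : Op a b} (h : IsOneWay Ω) {U : Matrix (Fin a) (Fin a) ℂ}
    {V : Matrix (Fin b) (Fin b) ℂ} (hU : U ∈ Matrix.unitaryGroup (Fin a) ℂ)
    (hV : V ∈ Matrix.unitaryGroup (Fin b) ℂ) : IsOneWay ((U ⊗ₖ V) * Ω * (U ⊗ₖ V)ᴴ) := by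
  obtain ⟨ι, _, E, F, hE, hE1, hF, rfl⟩ := h
  rw [Matrix.mem_unitaryGroup_iff, Matrix.star_eq_conjTranspose] at hU hV
  refine ⟨ι, inferInstance, fun i => U * E i * Uᴴ, fun i => V * F i * Vᴴ, fun i =>
    (hE i).mul_mul_conjTranspose_same _, ?_, fun i => ⟨(hF i).1.mul_mul_conjTranspose_same _, ?_⟩,
      ?_⟩
  · rw [← Matrix.sum_mul, ← Matrix.mul_sum, hE1, Matrix.mul_one, hU]
  · have := (hF i).2.mul_mul_conjTranspose_same V
    rwa [Matrix.mul_sub, Matrix.sub_mul, Matrix.mul_one, hV] at this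
  · simp only [Matrix.mul_sum, Matrix.sum_mul, Matrix.conjTranspose_kronecker,
      Matrix.mul_kronecker_mul]

theorem posSemidef_sum_sq_smul_one_sub {n : Type*} [Fintype n] [DecidableEq n] (ψ : n → ℂ) :
    (((∑ i, ‖ψ i‖ ^ 2 : ℝ) : ℂ) • (1 : Matrix n n ℂ) -
      Matrix.vecMulVec ψ (star ψ)).PosSemidef := by
  refine .of_dotProduct_mulVec_nonneg ?_ fun x => ?_
  · refine Matrix.IsHermitian.sub ?_ (Matrix.posSemidef_vecMulVec_self_star ψ).1
    rw [Matrix.IsHermitian, Matrix.conjTranspose_smul, Matrix.conjTranspose_one, RCLike.star_def,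
      Complex.conj_ofReal]
  · have hcs := norm_inner_le_norm (𝕜 := ℂ) (WithLp.toLp 2 ψ : EuclideanSpace ℂ n) (WithLp.toLp 2 x)
    rw [EuclideanSpace.inner_eq_star_dotProduct] at hcs
    have h2 : ‖x ⬝ᵥ star ψ‖ ^ 2 ≤ (∑ i, ‖ψ i‖ ^ 2) * ∑ i, ‖x i‖ ^ 2 := by
      have := pow_le_pow_left₀ (norm_nonneg _) hcs 2
      rwa [mul_pow, EuclideanSpace.norm_sq_eq, EuclideanSpace.norm_sq_eq] at this
    have h3 : star x ⬝ᵥ x = ((∑ i, ‖x i‖ ^ 2 : ℝ) : ℂ) := by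
      simp [dotProduct, Complex.conj_mul']
    have h4 : star x ⬝ᵥ (Matrix.vecMulVec ψ (star ψ) *ᵥ x) = ((‖x ⬝ᵥ star ψ‖ ^ 2 : ℝ) : ℂ) := by
      rw [Matrix.vecMulVec_mulVec, dotProduct_comm (star ψ) x]
      have : star x ⬝ᵥ ψ = star (x ⬝ᵥ star ψ) := by
        rw [← Matrix.star_dotProduct_star, star_star, dotProduct_comm]
      rw [dotProduct_smul, this]
      simp [Complex.conj_mul']
    rw [Matrix.sub_mulVec, dotProduct_sub, Matrix.smul_mulVec, Matrix.one_mulVec, dotProduct_smul,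
      h3, h4, smul_eq_mul, sub_nonneg]
    exact_mod_cast h2

theorem exists_pos_posSemidef_one_sub {n : ℕ} {ι : Type} [Fintype ι] (ψ : ι → Fin n → ℂ) :
    ∃ ε : ℝ, 0 < ε ∧
      (1 - (ε : ℂ) • ∑ i, Matrix.vecMulVec (ψ i) (star (ψ i))).PosSemidef := by
  set N : ι → ℝ := fun i => ∑ j, ‖ψ i j‖ ^ 2
  have hN : ∀ i, 0 ≤ N i := fun i => Finset.sum_nonneg fun _ _ => sq_nonneg _
  have hN' : 0 ≤ ∑ i, N i := Finset.sum_nonneg fun i _ => hN i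
  -- Each |ψ_i⟩⟨ψ_i| is at most N_i times the identity; the added 1 makes the denominator positive
  -- even if all vectors vanish.
  set ε : ℝ := (1 + ∑ i, N i)⁻¹ with hε
  have hε0 : 0 < ε := by positivity
  refine ⟨ε, hε0, ?_⟩
  have h1 : (1 : Matrix (Fin n) (Fin n) ℂ) - (ε : ℂ) • ∑ i, Matrix.vecMulVec (ψ i) (star (ψ i)) =
      (ε : ℂ) • (1 : Matrix (Fin n) (Fin n) ℂ) + (ε : ℂ) • ∑ i, (((N i : ℝ) : ℂ) •
        (1 : Matrix (Fin n) (Fin n) ℂ) - Matrix.vecMulVec (ψ i) (star (ψ i))) := by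
    rw [Finset.sum_sub_distrib, smul_sub, ← add_sub_assoc, ← Finset.sum_smul, smul_smul,
      ← add_smul]
    congr 1
    have : (ε : ℂ) + (ε : ℂ) * ∑ i, ((N i : ℝ) : ℂ) = 1 := by
      rw [← Complex.ofReal_sum, ← Complex.ofReal_mul, ← Complex.ofReal_add, ← mul_one_add ε,
        hε, inv_mul_cancel₀ (by positivity), Complex.ofReal_one]
    rw [this, one_smul]
  rw [h1]
  have hε' : (0 : ℂ) ≤ ε := by exact_mod_cast hε0.le
  exact (Matrix.PosSemidef.one.smul hε').add
    ((Matrix.posSemidef_sum _ fun i _ => posSemidef_sum_sq_smul_one_sub (ψ i)).smul hε')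

theorem proj_prodVec (ψ : Fin a → ℂ) (φ : Fin b → ℂ) : proj (prodVec ψ φ) =
    Matrix.vecMulVec ψ (star ψ) ⊗ₖ Matrix.vecMulVec φ (star φ) := by
  ext ⟨i, j⟩ ⟨k, l⟩
  simp [proj, prodVec, Matrix.vecMulVec_apply, Matrix.kroneckerMap_apply]
  ring

/-- If `X` is separable, then `1 - ε X` can be realized by one-way LOCC for some `ε > 0`. -/
theorem IsSepCone.exists_isOneWay {X : Op a b} (hX : IsSepCone X) :
    ∃ ε : ℝ, 0 < ε ∧ IsOneWay (1 - (ε : ℂ) • X) := by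
  obtain ⟨ι, _, ψ, φ, rfl⟩ := hX
  obtain ⟨δ, hδ, hψ⟩ := exists_pos_posSemidef_one_sub ψ
  obtain ⟨δ', hδ', hφ⟩ := exists_pos_posSemidef_one_sub φ
  have hδc : (0 : ℂ) ≤ δ := by exact_mod_cast hδ.le
  have hδc' : (0 : ℂ) ≤ δ' := by exact_mod_cast hδ'.le
  -- Alice measures the effects δ|ψ_i⟩⟨ψ_i| and the remainder `none`. On outcome i Bob rejects with
  -- effect δ'|φ_i⟩⟨φ_i|, on the remainder he always accepts; the rejection effects add up to δδ'X.
  refine ⟨δ * δ', mul_pos hδ hδ', Option ι, inferInstance, fun o => o.elim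
    (1 - (δ : ℂ) • ∑ i, Matrix.vecMulVec (ψ i) (star (ψ i)))
    fun i => (δ : ℂ) • Matrix.vecMulVec (ψ i) (star (ψ i)),
    fun o => o.elim 1 fun i => 1 - (δ' : ℂ) • Matrix.vecMulVec (φ i) (star (φ i)), ?_, ?_, ?_, ?_⟩
  · rintro (_ | i)
    exacts [hψ, (Matrix.posSemidef_vecMulVec_self_star _).smul hδc]
  · simp [Fintype.sum_option, Finset.smul_sum]
  · rintro (_ | i)
    · exact ⟨Matrix.PosSemidef.one, by simpa using Matrix.PosSemidef.zero⟩
    · refine ⟨?_, by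
        simpa using (Matrix.posSemidef_vecMulVec_self_star (φ i)).smul hδc'⟩
      classical
      have h1 : (1 : Matrix (Fin b) (Fin b) ℂ) -
          (δ' : ℂ) • Matrix.vecMulVec (φ i) (star (φ i)) =
          (1 - (δ' : ℂ) • ∑ j, Matrix.vecMulVec (φ j) (star (φ j))) +
            (δ' : ℂ) • ∑ j ∈ Finset.univ.erase i, Matrix.vecMulVec (φ j) (star (φ j)) := by
        rw [← Finset.add_sum_erase _ _ (Finset.mem_univ i), smul_add]
        abel
      simp only [Option.elim]
      rw [h1]
      exact hφ.add ((Matrix.posSemidef_sum _ fun j _ =>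
        Matrix.posSemidef_vecMulVec_self_star _).smul hδc')
  · rw [Fintype.sum_option]
    simp only [Option.elim, proj_prodVec]
    ext ⟨i, j⟩ ⟨k, l⟩
    rw [← Matrix.one_kronecker_one]
    simp only [Matrix.sub_apply, Matrix.add_apply, Matrix.smul_apply, Matrix.sum_apply,
      Matrix.kroneckerMap_apply, smul_eq_mul, Finset.mul_sum, sub_mul, mul_sub,
      Finset.sum_sub_distrib, Finset.sum_mul]
    push_cast
    have : ∀ x, (δ : ℂ) * (δ' : ℂ) * (Matrix.vecMulVec (ψ x) (star (ψ x)) i k *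
        Matrix.vecMulVec (φ x) (star (φ x)) j l) = (δ : ℂ) * Matrix.vecMulVec (ψ x) (star (ψ x)) i k *
        ((δ' : ℂ) * Matrix.vecMulVec (φ x) (star (φ x)) j l) := fun x => by ring
    simp only [this]
    ring

/-! ### Homogeneous one-way strategies -/

theorem exists_mul_eq_and_norm_sq (z : ℂ) : ∃ c w : ℂ, c * w = z ∧ ‖c‖ ^ 2 = ‖z‖ ∧ ‖w‖ ^ 2 = ‖z‖ := by
  rcases eq_or_ne z 0 with rfl | hz
  · exact ⟨0, 0, by simp⟩
  have hz' : Real.sqrt ‖z‖ ≠ 0 := (Real.sqrt_pos.2 (norm_pos_iff.2 hz)).ne'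
  have hz'' : ((Real.sqrt ‖z‖ : ℝ) : ℂ) ≠ 0 := by exact_mod_cast hz'
  refine ⟨(Real.sqrt ‖z‖ : ℝ), z / (Real.sqrt ‖z‖ : ℝ), by field_simp, ?_, ?_⟩
  · rw [Complex.norm_real, Real.norm_eq_abs, sq_abs, Real.sq_sqrt (norm_nonneg _)]
  · rw [norm_div, Complex.norm_real, Real.norm_eq_abs, div_pow, sq_abs,
      Real.sq_sqrt (norm_nonneg _), sq, mul_div_assoc, div_self (norm_ne_zero_iff.2 hz), mul_one]

theorem isSepCone_diagonal {f : Fin a × Fin b → ℝ} (hf : ∀ p, 0 ≤ f p) :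
    IsSepCone (Matrix.diagonal fun p => (f p : ℂ)) := by
  have h : (Matrix.diagonal fun p => (f p : ℂ)) = ∑ p : Fin a × Fin b, (f p : ℂ) •
      proj (prodVec (Pi.single p.1 1) (Pi.single p.2 1) : Vec a b) := by
    ext p q
    have h1 : ∀ x : Fin a × Fin b, proj (prodVec (Pi.single x.1 1) (Pi.single x.2 1) : Vec a b) p q
        = if p = x ∧ q = x then 1 else 0 := by
      intro x
      have h2 : ∀ y : Fin a × Fin b,
          (prodVec (Pi.single x.1 1) (Pi.single x.2 1) : Vec a b) y = if y = x then 1 else 0 := by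
        intro y
        simp only [prodVec, Pi.single_apply, Prod.ext_iff]
        split_ifs <;> simp_all
      rw [proj, Matrix.vecMulVec_apply, Pi.star_apply, h2, h2]
      split_ifs <;> simp_all
    simp only [Matrix.sum_apply, Matrix.smul_apply, h1, smul_eq_mul]
    by_cases hpq : p = q
    · subst hpq
      simp
    · rw [Matrix.diagonal_apply_ne _ hpq, Finset.sum_eq_zero]
      intro x _
      rw [if_neg, mul_zero]
      rintro ⟨rfl, rfl⟩
      exact hpq rfl
  rw [h]
  exact IsSepCone.sum fun p => (isSepCone_proj _ _).smul (hf p)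

/-- On the span of the |jj⟩ the operator is the positive matrix G = 1 - |μ⟩⟨μ| = ∑ |g_k⟩⟨g_k|.
Splitting g_k entrywise as a product c_k w_k with |c_k|² = |w_k|² = |g_k|, the phase average of |c_k
⊗ w_k⟩ reproduces |g_k⟩⟨g_k| on that span and adds only diagonal terms |g_k(x)||g_k(y)| off it. -/
theorem isSepCone_one_sub_proj_diagVec {d : ℕ} {μ : Fin d → ℝ} (hμ : ∑ i, μ i ^ 2 = 1) :
    IsSepCone (1 - proj (diagVec d d μ)) := by
  let ψ : Fin d → ℂ := fun i => (μ i : ℂ)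
  have hψ : ((1 : Matrix (Fin d) (Fin d) ℂ) - Matrix.vecMulVec ψ (star ψ)).PosSemidef := by
    have := posSemidef_sum_sq_smul_one_sub ψ
    have h1 : ∑ i, ‖ψ i‖ ^ 2 = 1 := by
      simpa [ψ] using hμ
    rwa [h1, Complex.ofReal_one, one_smul] at this
  obtain ⟨m, g, hg⟩ := Matrix.posSemidef_iff_eq_sum_vecMulVec.1 hψ
  choose c w hcw hc hw using fun k i => exists_mul_eq_and_norm_sq (g k i)
  have hgii : ∀ i, ∑ k, ‖g k i‖ ^ 2 ≤ 1 := by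
    intro i
    have h1 := congrFun (congrFun hg i) i
    rw [Matrix.sum_apply] at h1
    simp only [Matrix.vecMulVec_apply, Pi.star_apply, RCLike.star_def, Complex.mul_conj',
      Matrix.sub_apply, Matrix.one_apply_eq, ψ, Complex.norm_real] at h1
    have h2 : 1 - ‖μ i‖ ^ 2 = ∑ k, ‖g k i‖ ^ 2 := by exact_mod_cast h1
    rw [← h2]
    have := sq_nonneg ‖μ i‖
    linarith
  have hgij : ∀ i j, ∑ k, ‖g k i‖ * ‖g k j‖ ≤ 1 := by
    intro i j
    have h1 : ∑ k, ‖g k i‖ * ‖g k j‖ ≤ ∑ k, (‖g k i‖ ^ 2 + ‖g k j‖ ^ 2) / 2 :=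
      Finset.sum_le_sum fun k _ => by nlinarith [sq_nonneg (‖g k i‖ - ‖g k j‖)]
    rw [← Finset.sum_div, Finset.sum_add_distrib] at h1
    linarith [hgii i, hgii j]
  -- The surplus diagonal terms sum to at most 1 by `hgij`, so what is missing is a nonnegative
  -- diagonal operator, which is separable.
  have key : 1 - proj (diagVec d d μ) = ∑ k, phaseAvg (proj (prodVec (c k) (w k))) +
      Matrix.diagonal fun p : Fin d × Fin d =>
        (((if p.1 = p.2 then 0 else 1 - ∑ k, ‖g k p.1‖ * ‖g k p.2‖ : ℝ)) : ℂ) := by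
    ext ⟨x, y⟩ ⟨z, t⟩
    have hG := congrFun (congrFun hg x) z
    rw [Matrix.sum_apply] at hG
    simp only [Matrix.sub_apply, Matrix.vecMulVec_apply, Pi.star_apply, ψ] at hG
    simp only [Matrix.sub_apply, Matrix.add_apply, Matrix.sum_apply, phaseAvg_apply]
    have hproj : ∀ k, proj (prodVec (c k) (w k)) (x, y) (z, t) =
        c k x * w k y * star (c k z * w k t) := fun k => rfl
    have hdiag : proj (diagVec d d μ) (x, y) (z, t) =
        if x = y ∧ z = t then (μ x : ℂ) * star (μ z : ℂ) else 0 := by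
      simp only [proj, Matrix.vecMulVec_apply, diagVec, Pi.star_apply, Fin.val_inj]
      split_ifs <;> simp_all
    simp only [hproj, hdiag]
    by_cases hxy : x = y
    · subst hxy
      by_cases hzt : z = t
      · subst hzt
        have : Matrix.diagonal (fun p : Fin d × Fin d =>
            (((if p.1 = p.2 then 0 else 1 - ∑ k, ‖g k p.1‖ * ‖g k p.2‖ : ℝ)) : ℂ)) (x, x) (z, z) =
            0 := by
          by_cases h : x = z
          · subst h; simp
          · rw [Matrix.diagonal_apply_ne _ (fun h' => h (Prod.ext_iff.1 h').1)]
        rw [this]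
        simp only [true_or, and_self, if_true, hcw, add_zero]
        rw [← hG]
        congr 1
        simp [Matrix.one_apply, Prod.ext_iff]
      · rw [Matrix.one_apply_ne (fun h => hzt (by
          have := Prod.ext_iff.1 h; exact this.1.symm.trans this.2)),
          Matrix.diagonal_apply_ne _ (fun h => hzt (by
          have := Prod.ext_iff.1 h; exact this.1.symm.trans this.2))]
        have h1 : ¬ (x = z ∧ x = t) := fun h => hzt (h.1.symm.trans h.2)
        simp [hzt, h1]
    · by_cases h2 : x = z ∧ y = t
      · obtain ⟨rfl, rfl⟩ := h2
        simp only [hxy, and_self, or_true, if_true, if_false, sub_zero,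
          Matrix.one_apply_eq, Matrix.diagonal_apply_eq]
        have h3 : ∀ k, c k x * w k y * star (c k x * w k y) = ((‖g k x‖ * ‖g k y‖ : ℝ) : ℂ) := by
          intro k
          rw [RCLike.star_def, Complex.mul_conj', norm_mul, ← hc, ← hw]
          push_cast
          ring
        simp only [h3]
        push_cast
        ring
      · have h3 : ((x, y) : Fin d × Fin d) ≠ (z, t) := fun h => h2 (Prod.ext_iff.1 h)
        rw [Matrix.one_apply_ne h3, Matrix.diagonal_apply_ne _ h3]
        simp [hxy, h2]
  rw [key]
  refine (IsSepCone.sum fun k => (isSepCone_proj _ _).phaseAvg).add (isSepCone_diagonal fun p => ?_)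
  split_ifs
  · exact le_rfl
  · exact sub_nonneg.2 (hgij _ _)

/-- Reduce to Schmidt form by local unitaries. Off the a × a block the operator is 1 ⊗ `coembed`,
which is separable. -/
theorem isSepCone_one_sub_proj (hab : a ≤ b) {Ψ : Vec a b} (hΨ : IsPure Ψ) :
    IsSepCone (1 - proj Ψ) := by
  obtain ⟨U, hU, V, hV, h⟩ := exists_schmidt_decomposition hab Ψ
  set μ : Fin a → ℝ := fun i => Real.sqrt (schmidtVector Ψ i)
  have hUV := kronecker_conjTranspose_mul_self hU hV
  have hμ : ∑ i, μ i ^ 2 = 1 := by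
    rw [Finset.sum_congr rfl fun i _ => Real.sq_sqrt (schmidtVector_nonneg Ψ i),
      sum_schmidtVector hab]
    exact hΨ
  have h1 : 1 - proj (diagVec a b μ) = embed₂ hab * (1 - proj (diagVec a a μ)) * (embed₂ hab)ᴴ +
      ((1 : Matrix (Fin a) (Fin a) ℂ) ⊗ₖ coembed hab) * 1 *
        ((1 : Matrix (Fin a) (Fin a) ℂ) ⊗ₖ coembed hab)ᴴ := by
    rw [← one_sub_embed₂, Matrix.mul_sub, Matrix.sub_mul, Matrix.mul_one, ← proj_mulVec,
      embed₂_mulVec_diagVec]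
    abel
  have h2 : IsSepCone (1 - proj (diagVec a b μ)) := by
    rw [h1]
    exact ((isSepCone_one_sub_proj_diagVec hμ).conj _ _).add (isSepCone_one.conj _ _)
  have h3 := h2.conj' U V
  rw [← h, proj_mulVec, Matrix.mul_sub, Matrix.sub_mul, Matrix.mul_one, hUV] at h3
  convert h3 using 2
  calc proj Ψ = ((U ⊗ₖ V)ᴴ * (U ⊗ₖ V)) * proj Ψ * ((U ⊗ₖ V)ᴴ * (U ⊗ₖ V)) := by
        rw [hUV, Matrix.one_mul, Matrix.mul_one]
    _ = _ := by simp only [Matrix.mul_assoc]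

/-- Every pure state has a homogeneous local verification operator. -/
theorem exists_isHomogeneous_isLocal (hab : a ≤ b) {Ψ : Vec a b} (hΨ : IsPure Ψ) :
    ∃ Ω, IsVerificationOperator Ψ Ω ∧ IsHomogeneous Ψ Ω ∧ IsLocal Ω := by
  obtain ⟨ε, hε, h⟩ := (isSepCone_one_sub_proj hab hΨ).exists_isOneWay
  have hone : IsOneWay (1 : Op a b) :=
    ⟨Unit, inferInstance, fun _ => 1, fun _ => 1, fun _ => .one, by simp,
      fun _ => ⟨.one, by simpa using Matrix.PosSemidef.zero⟩, by simp⟩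
  -- Mixing with the trivial test replaces ε by tε ≤ 1, so that β = 1 - tε lies in [0, 1).
  set t : ℝ := min 1 ε⁻¹ with ht
  have ht0 : 0 < t := lt_min one_pos (inv_pos.2 hε)
  have ht1 : t ≤ 1 := min_le_left _ _
  have htε : t * ε ≤ 1 := by
    calc t * ε ≤ ε⁻¹ * ε := mul_le_mul_of_nonneg_right (min_le_right _ _) hε.le
      _ = 1 := inv_mul_cancel₀ hε.ne'
  have h2 : IsOneWay (1 - ((t * ε : ℝ) : ℂ) • (1 - proj Ψ)) := by
    have := convex_isOneWay h hone ht0.le (sub_nonneg.2 ht1) (by ring)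
    have e1 : 1 - ((t * ε : ℝ) : ℂ) • (1 - proj Ψ) =
        t • (1 - (ε : ℂ) • (1 - proj Ψ)) + (1 - t) • (1 : Op a b) := by
      rw [← Complex.coe_smul t, ← Complex.coe_smul (1 - t)]
      ext p q
      simp only [Matrix.sub_apply, Matrix.add_apply, Matrix.smul_apply, smul_eq_mul]
      push_cast
      ring
    rw [e1]
    exact this
  have h3 := h2.isLocal.isSepCone
  have hΨ' : proj Ψ *ᵥ Ψ = Ψ := by
    rw [proj, Matrix.vecMulVec_mulVec, ← ofReal_normSq, show normSq Ψ = 1 from hΨ]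
    simp
  refine ⟨_, (isVerificationOperator_iff _ _).2 ⟨h3.1.posSemidef, h3.2.posSemidef, ?_⟩,
    ⟨1 - t * ε, sub_nonneg.2 htε, by linarith [mul_pos ht0 hε], ?_⟩, h2.isLocal⟩
  · rw [Matrix.sub_mulVec, Matrix.smul_mulVec, Matrix.sub_mulVec, hΨ', Matrix.one_mulVec, sub_self,
      smul_zero, sub_zero]
  · push_cast
    rw [sub_smul, one_smul]
    abel

/-! ### Averages over local unitaries `U ⊗ Ū` -/

/-- The Fourier matrix, whose entries all have squared modulus 1/d. -/
theorem exists_flat_unitary {d : ℕ} (hd : 0 < d) : ∃ F ∈ Matrix.unitaryGroup (Fin d) ℂ,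
    ∀ i j, F i j * star (F i j) = (d : ℂ)⁻¹ := by
  have : NeZero d := ⟨hd.ne'⟩
  let e := ZMod.finEquiv d
  let ψ : AddChar (ZMod d) ℂ := ZMod.stdAddChar
  have hstar : ∀ t, star (ψ t) = ψ (-t) := fun t => by rw [AddChar.map_neg_eq_conj]; rfl
  have hsq : (((Real.sqrt d)⁻¹ : ℝ) : ℂ) * (((Real.sqrt d)⁻¹ : ℝ) : ℂ) = (d : ℂ)⁻¹ := by
    rw [← Complex.ofReal_mul, ← mul_inv, Real.mul_self_sqrt (Nat.cast_nonneg d)]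
    push_cast; rfl
  have key : ∀ i k j, ((((Real.sqrt d)⁻¹ : ℝ) : ℂ) * ψ (e i * e j)) *
      star ((((Real.sqrt d)⁻¹ : ℝ) : ℂ) * ψ (e k * e j)) =
      (d : ℂ)⁻¹ * ψ (e j * (e i - e k)) := by
    intro i k j
    rw [star_mul', hstar, RCLike.star_def, Complex.conj_ofReal, mul_mul_mul_comm, hsq,
      ← AddChar.map_add_eq_mul]
    congr 2
    ring
  refine ⟨Matrix.of fun i j => (((Real.sqrt d)⁻¹ : ℝ) : ℂ) * ψ (e i * e j), ?_, fun i j => ?_⟩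
  · rw [Matrix.mem_unitaryGroup_iff]
    ext i k
    simp only [Matrix.mul_apply, Matrix.star_apply, Matrix.of_apply, key]
    have h1 : ∑ j, ψ (e j * (e i - e k)) = ∑ x, ψ (x * (e i - e k)) :=
      Fintype.sum_equiv e.toEquiv _ _ fun _ => rfl
    rw [← Finset.mul_sum, h1, AddChar.sum_mulShift _ (ZMod.isPrimitive_stdAddChar d), ZMod.card]
    by_cases h : i = k
    · subst h
      simp [hd.ne']
    · simp [h, sub_eq_zero]
  · simp only [Matrix.of_apply, key, sub_self, mul_zero, AddChar.map_zero_eq_one, mul_one]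

/-- `∑ j, |jj⟩⟨jj|`. -/
def diagProj (d : ℕ) : Op d d := Matrix.diagonal fun p => if p.1 = p.2 then 1 else 0

/-- `d |Φ⟩⟨Φ|`. -/
def entProj (d : ℕ) : Op d d := proj (diagVec d d fun _ => 1)

theorem entProj_apply {d : ℕ} (x y z w : Fin d) :
    entProj d (x, y) (z, w) = if x = y ∧ z = w then 1 else 0 := by
  simp only [entProj, proj, Matrix.vecMulVec_apply, diagVec, Pi.star_apply, Fin.val_inj]
  split_ifs <;> simp_all

theorem conjKron_mulVec_diagVec_one {d : ℕ} {U : Matrix (Fin d) (Fin d) ℂ}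
    (hU : U ∈ Matrix.unitaryGroup (Fin d) ℂ) :
    conjKron U *ᵥ (diagVec d d fun _ => 1) = diagVec d d fun _ => 1 := by
  apply mat_injective
  have h1 : mat (diagVec d d fun _ => 1) = 1 := by
    ext i j
    simp [mat, diagVec, Matrix.one_apply, Fin.val_inj]
  rw [conjKron, mat_kronecker_mulVec, h1, Matrix.mul_one]
  exact Matrix.mem_unitaryGroup_iff.1 hU

theorem conjKron_mul_entProj_mul {d : ℕ} {U : Matrix (Fin d) (Fin d) ℂ}
    (hU : U ∈ Matrix.unitaryGroup (Fin d) ℂ) :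
    conjKron U * entProj d * (conjKron U)ᴴ = entProj d := by
  rw [entProj, ← proj_mulVec, conjKron_mulVec_diagVec_one hU]

/-- Convex sets of operators which are invariant under all local unitaries `U ⊗ Ū`. -/
def TwirlClosed {d : ℕ} (C : Set (Op d d)) : Prop :=
  Convex ℝ C ∧ ∀ U ∈ Matrix.unitaryGroup (Fin d) ℂ, ∀ X ∈ C,
    conjKron U * X * (conjKron U)ᴴ ∈ C

theorem TwirlClosed.phaseAvg_mem {d : ℕ} {C : Set (Op d d)} (hC : TwirlClosed C) {X : Op d d}
    (hX : X ∈ C) : phaseAvg X ∈ C := by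
  refine hC.1.sum_mem (fun _ _ => by positivity) ?_
    fun θ _ => hC.2 _ (phaseMat_mem_unitaryGroup θ) X hX
  simp

theorem phaseAvg_flat {d : ℕ} {F : Matrix (Fin d) (Fin d) ℂ}
    (hF : ∀ i j, F i j * star (F i j) = (d : ℂ)⁻¹) :
    phaseAvg (conjKron F * diagProj d * (conjKron F)ᴴ) =
      (d : ℂ)⁻¹ • (1 + entProj d - diagProj d) := by
  ext ⟨x, y⟩ ⟨z, w⟩
  have h1 : (conjKron F * diagProj d * (conjKron F)ᴴ) (x, y) (z, w) =
      ∑ j, F x j * star (F y j) * star (F z j * star (F w j)) := by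
    rw [diagProj, Matrix.mul_apply]
    simp only [Matrix.mul_diagonal, Matrix.conjTranspose_apply, conjKron, Matrix.kroneckerMap_apply,
      Matrix.map_apply, Fintype.sum_prod_type, mul_ite, mul_one, mul_zero, ite_mul, zero_mul,
      Finset.sum_ite_eq, Finset.mem_univ, if_true]
  have hd' : (Finset.univ : Finset (Fin d)).card = d := by simp
  have hdx : (d : ℂ) ≠ 0 := by
    have := x.2
    exact_mod_cast (by omega : d ≠ 0)
  rw [phaseAvg_apply, h1]
  simp only [Matrix.smul_apply, Matrix.sub_apply, Matrix.add_apply, entProj_apply, diagProj,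
    smul_eq_mul]
  by_cases hxy : x = y
  · subst hxy
    by_cases hzw : z = w
    · subst hzw
      have h2 : (1 : Op d d) (x, x) (z, z) - Matrix.diagonal
          (fun p : Fin d × Fin d => if p.1 = p.2 then (1 : ℂ) else 0) (x, x) (z, z) = 0 := by
        by_cases h : x = z
        · subst h; simp
        · have h3 : ((x, x) : Fin d × Fin d) ≠ (z, z) := fun h' => h (Prod.ext_iff.1 h').1
          rw [Matrix.one_apply_ne h3, Matrix.diagonal_apply_ne _ h3, sub_zero]
      rw [add_sub_right_comm, h2]
      simp only [and_self, true_or, if_true, hF, star_inv₀, star_natCast, Finset.sum_const, hd',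
        nsmul_eq_mul, zero_add]
      field_simp
    · have h3 : ((x, x) : Fin d × Fin d) ≠ (z, w) := fun h' => hzw
        ((Prod.ext_iff.1 h').1.symm.trans (Prod.ext_iff.1 h').2)
      have h4 : ¬ (x = z ∧ x = w) := fun h => hzw (h.1.symm.trans h.2)
      rw [Matrix.one_apply_ne h3, Matrix.diagonal_apply_ne _ h3]
      simp [hzw, h4]
  · by_cases h2 : x = z ∧ y = w
    · obtain ⟨rfl, rfl⟩ := h2
      have h3 : ∀ j, F x j * star (F y j) * star (F x j * star (F y j)) =
          (d : ℂ)⁻¹ * (d : ℂ)⁻¹ := by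
        intro j
        calc _ = (F x j * star (F x j)) * (F y j * star (F y j)) := by
              rw [star_mul', star_star]; ring
          _ = _ := by rw [hF, hF]
      simp only [h3, hxy, Finset.sum_const, hd', nsmul_eq_mul, Matrix.one_apply_eq,
        Matrix.diagonal_apply_eq, and_self, or_true, if_true, if_false]
      field_simp
      ring
    · have h3 : ((x, y) : Fin d × Fin d) ≠ (z, w) := fun h => h2 (Prod.ext_iff.1 h)
      rw [Matrix.one_apply_ne h3, Matrix.diagonal_apply_ne _ h3]
      simp [hxy, h2]

/-- The Fourier rotation of `diagProj`, averaged over phases, is (1 + `entProj` - `diagProj`)/d.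
Mixing it with `diagProj` in the ratio d : 1 cancels the latter. -/
theorem TwirlClosed.isotropic_mem {d : ℕ} (hd : 0 < d) {C : Set (Op d d)} (hC : TwirlClosed C)
    (h : diagProj d ∈ C) : ((d : ℂ) + 1)⁻¹ • (1 + entProj d) ∈ C := by
  obtain ⟨F, hF, hF'⟩ := exists_flat_unitary hd
  have h1 := hC.phaseAvg_mem (hC.2 F hF _ h)
  rw [phaseAvg_flat hF'] at h1
  have hd0 : (d : ℂ) ≠ 0 := by exact_mod_cast hd.ne'
  have hd1 : (d : ℂ) + 1 ≠ 0 := by exact_mod_cast (Nat.succ_ne_zero d)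
  have h2 := hC.1 h h1 (show (0 : ℝ) ≤ ((d : ℝ) + 1)⁻¹ by positivity)
    (show (0 : ℝ) ≤ d * ((d : ℝ) + 1)⁻¹ by positivity) (by field_simp; ring)
  convert h2 using 1
  rw [← Complex.coe_smul, ← Complex.coe_smul]
  push_cast
  ext p q
  simp only [Matrix.smul_apply, Matrix.add_apply, Matrix.sub_apply, smul_eq_mul]
  field_simp
  ring

theorem exists_perm_apply_eq {d : ℕ} {x y x' y' : Fin d} (h : x ≠ y) (h' : x' ≠ y') :
    ∃ τ : Equiv.Perm (Fin d), τ x = x' ∧ τ y = y' :=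
  (MulAction.is_two_pretransitive_iff.1 (Equiv.Perm.isMultiplyPretransitive (Fin d) 2)) h h'

/-- The symmetric group is transitive on points and on ordered pairs of distinct points. -/
theorem exists_sum_perm_eq {d : ℕ} (f : Fin d → Fin d → ℂ) : ∃ c₁ c₂ : ℂ, ∀ x y,
    ∑ π : Equiv.Perm (Fin d), f (π x) (π y) = if x = y then c₁ else c₂ := by
  have h1 : ∀ x x', ∑ π : Equiv.Perm (Fin d), f (π x) (π x) =
      ∑ π : Equiv.Perm (Fin d), f (π x') (π x') := by
    intro x x'
    rw [← Equiv.sum_comp (Equiv.mulRight (Equiv.swap x x'))]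
    simp
  have h2 : ∀ x y x' y', x ≠ y → x' ≠ y' → ∑ π : Equiv.Perm (Fin d), f (π x) (π y) =
      ∑ π : Equiv.Perm (Fin d), f (π x') (π y') := by
    intro x y x' y' h h'
    obtain ⟨τ, rfl, rfl⟩ := exists_perm_apply_eq h h'
    rw [← Equiv.sum_comp (Equiv.mulRight τ)]
    simp
  have hc₁ : ∃ c₁, ∀ x, ∑ π : Equiv.Perm (Fin d), f (π x) (π x) = c₁ := by
    rcases isEmpty_or_nonempty (Fin d) with _ | ⟨⟨x₀⟩⟩
    · exact ⟨0, fun x => isEmptyElim x⟩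
    · exact ⟨_, fun x => h1 x x₀⟩
  have hc₂ : ∃ c₂, ∀ x y, x ≠ y → ∑ π : Equiv.Perm (Fin d), f (π x) (π y) = c₂ := by
    by_cases h : ∃ x y : Fin d, x ≠ y
    · obtain ⟨x₀, y₀, h₀⟩ := h
      exact ⟨_, fun x y hxy => h2 x y x₀ y₀ hxy h₀⟩
    · exact ⟨0, fun x y hxy => (h ⟨x, y, hxy⟩).elim⟩
  obtain ⟨c₁, hc₁⟩ := hc₁
  obtain ⟨c₂, hc₂⟩ := hc₂
  refine ⟨c₁, c₂, fun x y => ?_⟩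
  split_ifs with h
  · subst h; exact hc₁ x
  · exact hc₂ x y h

theorem conjKron_permMatrix_mul {d : ℕ} (π : Equiv.Perm (Fin d)) (X : Op d d) (x y z w : Fin d) :
    (conjKron (π.permMatrix ℂ) * X * (conjKron (π.permMatrix ℂ))ᴴ) (x, y) (z, w) =
      X (π x, π y) (π z, π w) := by
  have h : (π.permMatrix ℂ).map star = π.permMatrix ℂ := by
    ext i j
    simp [Equiv.Perm.permMatrix, PEquiv.toMatrix_apply, apply_ite]
  rw [conjKron, h]
  have h1 : ∀ Y : Op d d, ∀ p q, ((π.permMatrix ℂ ⊗ₖ π.permMatrix ℂ) * Y) p q =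
      Y (π p.1, π p.2) q := by
    intro Y p q
    exact congrFun (permMatrix_kronecker_mulVec π π fun p => Y p q) p
  have h2 : (π.permMatrix ℂ ⊗ₖ π.permMatrix ℂ) * X * (π.permMatrix ℂ ⊗ₖ π.permMatrix ℂ)ᴴ =
      ((π.permMatrix ℂ ⊗ₖ π.permMatrix ℂ) *
        ((π.permMatrix ℂ ⊗ₖ π.permMatrix ℂ) * X)ᴴ)ᴴ := by
    rw [Matrix.conjTranspose_mul, Matrix.conjTranspose_conjTranspose]
  rw [h2, Matrix.conjTranspose_apply, h1, Matrix.conjTranspose_apply, h1, star_star]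

/-- An average over finitely many unitaries `U ⊗ Ū` makes an operator almost isotropic. -/
theorem TwirlClosed.exists_mem {d : ℕ} {C : Set (Op d d)} (hC : TwirlClosed C)
    {X : Op d d} (hX : X ∈ C) :
    ∃ s t u : ℂ, s • 1 + t • entProj d + u • diagProj d ∈ C := by
  -- The phase average leaves only entries (xx, zz) and (xy, xy); averaging over permutations makes
  -- each of the two families depend only on equality of its indices.
  set Y := phaseAvg X with hY
  have hYC : Y ∈ C := hC.phaseAvg_mem hX
  set N : ℝ := (Fintype.card (Equiv.Perm (Fin d)) : ℝ) with hN
  have hN0 : N ≠ 0 := by simp [hN, Fintype.card_ne_zero]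
  have hZ : ∑ π : Equiv.Perm (Fin d), N⁻¹ •
      (conjKron (π.permMatrix ℂ) * Y * (conjKron (π.permMatrix ℂ))ᴴ) ∈ C := by
    refine hC.1.sum_mem (fun _ _ => by positivity) ?_
      fun π _ => hC.2 _ (permMatrix_mem_unitaryGroup π) Y hYC
    rw [Finset.sum_const, Finset.card_univ, nsmul_eq_mul, ← hN, mul_inv_cancel₀ hN0]
  obtain ⟨c₁, c₂, hc⟩ := exists_sum_perm_eq fun x z => Y (x, x) (z, z)
  obtain ⟨c₃, c₄, hc'⟩ := exists_sum_perm_eq fun x y => Y (x, y) (x, y)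
  have h13 : ∀ _ : Fin d, c₃ = c₁ := by
    intro x
    have h1 := hc x x
    have h3 := hc' x x
    rw [if_pos rfl] at h1 h3
    rw [← h1, ← h3]
  refine ⟨(N : ℂ)⁻¹ * c₄, (N : ℂ)⁻¹ * c₂, (N : ℂ)⁻¹ * (c₁ - c₂ - c₄), ?_⟩
  convert hZ using 1
  ext ⟨x, y⟩ ⟨z, w⟩
  rw [Matrix.sum_apply]
  simp only [Matrix.smul_apply, conjKron_permMatrix_mul]
  rw [← Finset.smul_sum, ← Complex.coe_smul, smul_eq_mul]
  simp only [Matrix.add_apply, Matrix.smul_apply, entProj_apply, diagProj, smul_eq_mul]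
  push_cast
  by_cases hxy : x = y
  · subst hxy
    by_cases hzw : z = w
    · subst hzw
      rw [hc x z]
      by_cases hxz : x = z
      · subst hxz
        simp only [Matrix.one_apply_eq, Matrix.diagonal_apply_eq, and_self, if_true]
        ring
      · have h3 : ((x, x) : Fin d × Fin d) ≠ (z, z) := fun h' => hxz (Prod.ext_iff.1 h').1
        rw [Matrix.one_apply_ne h3, Matrix.diagonal_apply_ne _ h3]
        simp [hxz]
    · have h3 : ((x, x) : Fin d × Fin d) ≠ (z, w) := fun h' => hzw
        ((Prod.ext_iff.1 h').1.symm.trans (Prod.ext_iff.1 h').2)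
      have h4 : ¬ (x = z ∧ x = w) := fun h => hzw (h.1.symm.trans h.2)
      rw [Matrix.one_apply_ne h3, Matrix.diagonal_apply_ne _ h3, Finset.sum_eq_zero]
      · simp [hzw]
      · intro π _
        rw [hY, phaseAvg_apply, if_neg]
        simpa [hzw] using h4
  · by_cases h2 : x = z ∧ y = w
    · obtain ⟨rfl, rfl⟩ := h2
      rw [hc' x y]
      simp [hxy]
    · have h3 : ((x, y) : Fin d × Fin d) ≠ (z, w) := fun h => h2 (Prod.ext_iff.1 h)
      rw [Matrix.one_apply_ne h3, Matrix.diagonal_apply_ne _ h3, Finset.sum_eq_zero]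
      · simp [hxy]
      · intro π _
        rw [hY, phaseAvg_apply, if_neg]
        simpa [hxy] using h2

/-- A convex set of operators which is invariant under all local unitaries `U ⊗ Ū` contains an
isotropic operator. -/
theorem TwirlClosed.exists_isotropic_mem {d : ℕ} (hd : 0 < d) {C : Set (Op d d)}
    (hC : TwirlClosed C) {X : Op d d} (hX : X ∈ C) :
    ∃ s t : ℂ, s • 1 + t • entProj d ∈ C := by
  obtain ⟨s, t, u, h⟩ := hC.exists_mem hX
  -- Both 1 and `entProj` are invariant under U ⊗ Ū, so the twirl can act on the `diagProj` part
  -- alone.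
  have hC' : TwirlClosed {Z : Op d d | s • 1 + t • entProj d + u • Z ∈ C} := by
    refine ⟨?_, fun U hU Z hZ => ?_⟩
    · intro Z hZ Z' hZ' r r' hr hr' hrr
      have := hC.1 hZ hZ' hr hr' hrr
      rw [Set.mem_ofPred_eq]
      convert this using 1
      have hrr' : (r : ℂ) + r' = 1 := by exact_mod_cast hrr
      simp only [← Complex.coe_smul]
      ext p q
      simp only [Matrix.add_apply, Matrix.smul_apply, smul_eq_mul]
      linear_combination (-(s * (1 : Op d d) p q) - t * entProj d p q) * hrr'
    · have := hC.2 U hU _ hZ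
      rw [Set.mem_ofPred_eq]
      convert this using 1
      have h1 : conjKron U * (conjKron U)ᴴ = 1 := mul_eq_one_comm.1 (conjKron_conjTranspose_mul hU)
      simp only [Matrix.mul_add, Matrix.add_mul, Matrix.mul_smul, Matrix.smul_mul,
        conjKron_mul_entProj_mul hU, Matrix.mul_one, h1]
  have h2 := hC'.isotropic_mem hd h
  refine ⟨s + u * ((d : ℂ) + 1)⁻¹, t + u * ((d : ℂ) + 1)⁻¹, ?_⟩
  rw [Set.mem_ofPred_eq] at h2
  convert h2 using 1
  ext p q
  simp only [Matrix.add_apply, Matrix.smul_apply, smul_eq_mul]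
  ring

/-! ### The maximally entangled state -/

/-- The extension of an operator on `ℂ^a` to `ℂ^b` by the identity. -/
def extend (hab : a ≤ b) (W : Matrix (Fin a) (Fin a) ℂ) : Matrix (Fin b) (Fin b) ℂ :=
  embed hab * W * (embed hab)ᴴ + coembed hab

theorem embed_mul_coembed (hab : a ≤ b) : (embed hab)ᴴ * coembed hab = 0 := by
  rw [← coembed_conjTranspose, ← Matrix.conjTranspose_mul, coembed_mul_embed,
    Matrix.conjTranspose_zero]

theorem extend_mul_embed (hab : a ≤ b) (W : Matrix (Fin a) (Fin a) ℂ) :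
    extend hab W * embed hab = embed hab * W := by
  rw [extend, Matrix.add_mul, coembed_mul_embed, add_zero, Matrix.mul_assoc,
    embed_conjTranspose_mul, Matrix.mul_one]

theorem extend_mem_unitaryGroup (hab : a ≤ b) {W : Matrix (Fin a) (Fin a) ℂ}
    (hW : W ∈ Matrix.unitaryGroup (Fin a) ℂ) :
    extend hab W ∈ Matrix.unitaryGroup (Fin b) ℂ := by
  rw [Matrix.mem_unitaryGroup_iff, Matrix.star_eq_conjTranspose] at hW ⊢
  have h1 : (extend hab W)ᴴ = embed hab * Wᴴ * (embed hab)ᴴ + coembed hab := by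
    rw [extend, Matrix.conjTranspose_add, coembed_conjTranspose]
    simp only [Matrix.conjTranspose_mul, Matrix.conjTranspose_conjTranspose, Matrix.mul_assoc]
  have h2 : extend hab W * coembed hab = coembed hab := by
    rw [extend, Matrix.add_mul, Matrix.mul_assoc, embed_mul_coembed, Matrix.mul_zero, zero_add,
      coembed_mul_self]
  rw [h1, Matrix.mul_add, h2, Matrix.mul_assoc (embed hab), ← Matrix.mul_assoc (extend hab W),
    extend_mul_embed, Matrix.mul_assoc (embed hab) W, ← Matrix.mul_assoc W, hW, Matrix.one_mul,
    coembed, add_sub_cancel]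

theorem kronecker_extend_mul_embed₂ (hab : a ≤ b) (U W : Matrix (Fin a) (Fin a) ℂ) :
    (U ⊗ₖ extend hab W) * embed₂ hab = embed₂ hab * (U ⊗ₖ W) := by
  rw [embed₂, ← Matrix.mul_kronecker_mul, ← Matrix.mul_kronecker_mul, extend_mul_embed,
    Matrix.mul_one, Matrix.one_mul]

theorem isOneWay_diagProj (hab : a ≤ b) :
    IsOneWay (embed₂ hab * diagProj a * (embed₂ hab)ᴴ) := by
  let D : Fin a → Matrix (Fin a) (Fin a) ℂ := fun j => Matrix.diagonal (Pi.single j 1)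
  have hD : ∀ j, (D j).PosSemidef := fun j => Matrix.PosSemidef.diagonal fun i => by
    rw [Pi.single_apply]; split_ifs <;> simp
  have hD' : ∀ j, (1 - D j).PosSemidef := fun j => by
    rw [← Matrix.diagonal_one, Matrix.diagonal_sub]
    exact Matrix.PosSemidef.diagonal fun i => by
      rw [Pi.single_apply]; split_ifs <;> simp
  refine ⟨Fin a, inferInstance, D, fun j => embed hab * D j * (embed hab)ᴴ, hD, ?_,
    fun j => ⟨(hD j).mul_mul_conjTranspose_same _, ?_⟩, ?_⟩
  · ext i k
    rw [Matrix.sum_apply]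
    by_cases h : i = k
    · subst h
      simp [D, Pi.single_apply]
    · simp [D, h]
  · have h1 : 1 - embed hab * D j * (embed hab)ᴴ =
        embed hab * (1 - D j) * (embed hab)ᴴ + coembed hab * (coembed hab)ᴴ := by
      rw [coembed_conjTranspose, coembed_mul_self, coembed, Matrix.mul_sub, Matrix.sub_mul,
        Matrix.mul_one]
      abel
    rw [h1]
    exact ((hD' j).mul_mul_conjTranspose_same _).add (Matrix.posSemidef_self_mul_conjTranspose _)
  · have h1 : diagProj a = ∑ j, D j ⊗ₖ D j := by
      simp only [D, Matrix.diagonal_kronecker_diagonal]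
      ext p q
      rw [Matrix.sum_apply, diagProj]
      by_cases h : p = q
      · subst h
        simp [Pi.single_apply]
      · simp [h]
    rw [h1, Matrix.mul_sum, Matrix.sum_mul]
    refine Finset.sum_congr rfl fun j _ => ?_
    rw [embed₂, Matrix.conjTranspose_kronecker, ← Matrix.mul_kronecker_mul,
      ← Matrix.mul_kronecker_mul, Matrix.conjTranspose_one, Matrix.mul_one, Matrix.one_mul]

/-- A rotation U ⊗ Ū of the block extends to the local unitary U ⊗ `extend` Ū of the whole space,
which preserves one-way tests. -/
theorem twirlClosed_isOneWay (hab : a ≤ b) :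
    TwirlClosed {Y : Op a a | IsOneWay (embed₂ hab * Y * (embed₂ hab)ᴴ)} := by
  refine ⟨?_, fun U hU X hX => ?_⟩
  · intro Y hY Z hZ r s hr hs hrs
    have := convex_isOneWay hY hZ hr hs hrs
    rw [Set.mem_ofPred_eq] at this ⊢
    simpa only [Matrix.mul_add, Matrix.add_mul, Matrix.mul_smul, Matrix.smul_mul] using this
  · have := IsOneWay.conj hX hU (extend_mem_unitaryGroup hab (map_star_mem_unitaryGroup hU))
    rw [Set.mem_ofPred_eq]
    convert this using 1
    have h1 := kronecker_extend_mul_embed₂ hab U (U.map star)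
    calc _ = (embed₂ hab * conjKron U) * X * (embed₂ hab * conjKron U)ᴴ := by
          rw [Matrix.conjTranspose_mul]; simp only [Matrix.mul_assoc]
      _ = _ := by
          rw [conjKron, ← h1, Matrix.conjTranspose_mul]; simp only [Matrix.mul_assoc]

/-- The optimal strategy for the maximally entangled state. -/
def optimalTest (hab : a ≤ b) : Op a b :=
  embed₂ hab * (((a : ℂ) + 1)⁻¹ • (1 + entProj a)) * (embed₂ hab)ᴴ

theorem isLocal_optimalTest (ha : 0 < a) (hab : a ≤ b) : IsLocal (optimalTest hab) :=
  IsOneWay.isLocal ((twirlClosed_isOneWay hab).isotropic_mem ha (isOneWay_diagProj hab))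

theorem maxEnt_eq (hab : a ≤ b) : maxEnt a b =
    (((Real.sqrt a)⁻¹ : ℝ) : ℂ) • (embed₂ hab *ᵥ diagVec a a fun _ => 1) := by
  rw [embed₂_mulVec_diagVec]
  ext p
  by_cases h : (p.1 : ℕ) = p.2 <;> simp [maxEnt, diagVec, h]

theorem normSq_diagVec_one (d : ℕ) : normSq (diagVec d d fun _ => 1) = d := by
  rw [normSq_diagVec le_rfl]; simp

theorem isPure_maxEnt (ha : 0 < a) (hab : a ≤ b) : IsPure (maxEnt a b) := by
  change normSq (diagVec a b fun _ => (Real.sqrt a)⁻¹) = 1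
  rw [normSq_diagVec hab]
  have : (a : ℝ) ≠ 0 := by exact_mod_cast ha.ne'
  simp [inv_pow, this]

theorem entProj_mulVec (d : ℕ) :
    entProj d *ᵥ (diagVec d d fun _ => 1) = (d : ℂ) • diagVec d d fun _ => 1 := by
  rw [entProj, proj, Matrix.vecMulVec_mulVec, op_smul_eq_smul, ← ofReal_normSq, normSq_diagVec_one,
    Complex.ofReal_natCast]

theorem mulVec_maxEnt_iff (ha : 0 < a) (hab : a ≤ b) (T : Op a b) :
    T *ᵥ maxEnt a b = maxEnt a b ↔ T *ᵥ (embed₂ hab *ᵥ diagVec a a fun _ => 1) =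
      embed₂ hab *ᵥ diagVec a a fun _ => 1 := by
  have h : (((Real.sqrt a)⁻¹ : ℝ) : ℂ) ≠ 0 := by
    have : Real.sqrt a ≠ 0 := (Real.sqrt_pos.2 (by exact_mod_cast ha)).ne'
    exact_mod_cast inv_ne_zero this
  rw [maxEnt_eq hab, Matrix.mulVec_smul]
  exact smul_right_injective _ h |>.eq_iff

theorem isVerificationOperator_optimalTest (ha : 0 < a) (hab : a ≤ b) :
    IsVerificationOperator (maxEnt a b) (optimalTest hab) := by
  have h := (isLocal_optimalTest ha hab).isSepCone
  rw [isVerificationOperator_iff]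
  refine ⟨h.1.posSemidef, h.2.posSemidef, ?_⟩
  rw [mulVec_maxEnt_iff ha hab, optimalTest, Matrix.mulVec_mulVec, Matrix.mul_assoc,
    embed₂_conjTranspose_mul, Matrix.mul_one, ← Matrix.mulVec_mulVec]
  congr 1
  rw [Matrix.smul_mulVec, Matrix.add_mulVec, Matrix.one_mulVec, entProj_mulVec]
  have h1 : (a : ℂ) + 1 ≠ 0 := by exact_mod_cast Nat.succ_ne_zero a
  ext p
  simp only [Pi.smul_apply, Pi.add_apply, smul_eq_mul]
  field_simp
  ring

/-- A separable operator has at most the trace as its expectation on `√d |Φ⟩`. -/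
theorem IsSepCone.re_trace_mul_entProj_le {d : ℕ} {X : Op d d} (hX : IsSepCone X) :
    (X * entProj d).trace.re ≤ X.trace.re := by
  obtain ⟨ι, _, ψ, φ, rfl⟩ := hX
  rw [Finset.sum_mul, Matrix.trace_sum, Matrix.trace_sum, Complex.re_sum, Complex.re_sum]
  refine Finset.sum_le_sum fun i _ => ?_
  have h1 : star (diagVec d d fun _ => 1) ⬝ᵥ prodVec (ψ i) (φ i) = ∑ j, ψ i j * φ i j := by
    simp [dotProduct, diagVec, prodVec, Fintype.sum_prod_type, Fin.val_inj, apply_ite]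
  have h2 : star (prodVec (ψ i) (φ i)) ⬝ᵥ (diagVec d d fun _ => 1) =
      star (∑ j, ψ i j * φ i j) := by
    rw [← h1, Matrix.star_dotProduct]
  rw [entProj, trace_mul_proj, trace_proj, Complex.ofReal_re, proj, Matrix.vecMulVec_mulVec, h2,
    op_smul_eq_smul, dotProduct_smul, h1, smul_eq_mul, RCLike.star_def, Complex.conj_mul',
    ← Complex.ofReal_pow, Complex.ofReal_re]
  calc ‖∑ j, ψ i j * φ i j‖ ^ 2 ≤ (∑ j, ‖ψ i j‖ * ‖φ i j‖) ^ 2 := by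
        gcongr
        exact (norm_sum_le _ _).trans_eq (by simp)
    _ ≤ (∑ j, ‖ψ i j‖ ^ 2) * ∑ j, ‖φ i j‖ ^ 2 := Finset.sum_mul_sq_le_sq_mul_sq _ _ _
    _ = _ := by
        simp [prodVec, mul_pow, Fintype.sum_prod_type, Finset.sum_mul_sum]

theorem re_trace_convex_mul {n : Type*} [Fintype n] (r s : ℝ) (Y Z M : Matrix n n ℂ) :
    ((r • Y + s • Z) * M).trace.re = r * (Y * M).trace.re + s * (Z * M).trace.re := by
  simp only [Matrix.add_mul, Matrix.smul_mul, Matrix.trace_add, Matrix.trace_smul, Complex.add_re,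
    Complex.smul_re, smul_eq_mul]

/-- The operators which fix the maximally entangled state, have at least the trace of a separable
such operator, and pass all the states `(U ⊗ Ū) σ (U ⊗ Ū)ᴴ` with probability at most `p`. -/
theorem twirlClosed_maxEnt {d : ℕ} (σ : Op d d) (p : ℝ) : TwirlClosed {Y : Op d d |
    Y *ᵥ (diagVec d d fun _ => 1) = (diagVec d d fun _ => 1) ∧ (d : ℝ) ≤ Y.trace.re ∧
    ∀ U ∈ Matrix.unitaryGroup (Fin d) ℂ,
      (Y * (conjKron U * σ * (conjKron U)ᴴ)).trace.re ≤ p} := by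
  refine ⟨?_, ?_⟩
  · rintro Y ⟨hY1, hY2, hY3⟩ Z ⟨hZ1, hZ2, hZ3⟩ r s hr hs hrs
    refine ⟨?_, ?_, fun U hU => ?_⟩
    · rw [Matrix.add_mulVec, Matrix.smul_mulVec, Matrix.smul_mulVec, hY1, hZ1, ← add_smul, hrs,
        one_smul]
    · have := re_trace_convex_mul r s Y Z 1
      simp only [Matrix.mul_one] at this
      rw [this]
      calc (d : ℝ) = r * d + s * d := by rw [← add_mul, hrs, one_mul]
        _ ≤ _ := by gcongr
    · rw [re_trace_convex_mul]
      calc _ ≤ r * p + s * p := by gcongr <;> [exact hY3 U hU; exact hZ3 U hU]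
        _ = p := by rw [← add_mul, hrs, one_mul]
  · rintro W hW Y ⟨hY1, hY2, hY3⟩
    have hW' := unitary_conjTranspose_mem hW
    have h0 := conjKron_mulVec_diagVec_one hW
    have h1 : (conjKron W)ᴴ *ᵥ (diagVec d d fun _ => 1) = diagVec d d fun _ => 1 := by
      conv_lhs => rw [← h0, Matrix.mulVec_mulVec, conjKron_conjTranspose_mul hW, Matrix.one_mulVec]
    have h2 : (conjKron W)ᴴ = conjKron Wᴴ := by
      rw [conjKron, Matrix.conjTranspose_kronecker, conjKron]
      congr 1
    refine ⟨?_, ?_, fun U hU => ?_⟩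
    · rw [← Matrix.mulVec_mulVec, h1, ← Matrix.mulVec_mulVec, hY1, h0]
    · rwa [Matrix.trace_mul_comm, ← Matrix.mul_assoc, conjKron_conjTranspose_mul hW,
        Matrix.one_mul]
    -- Rotating `Y` by W amounts to replacing U by WᴴU in the bound, which is why the bound is
    -- imposed for all U.
    · have := hY3 (Wᴴ * U) (mul_mem hW' hU)
      rw [conjKron_mul, ← h2, Matrix.conjTranspose_mul, Matrix.conjTranspose_conjTranspose] at this
      convert this using 2
      rw [Matrix.mul_assoc, Matrix.mul_assoc, Matrix.trace_mul_comm]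
      simp only [Matrix.mul_assoc]

theorem posSemidef_smul_one_sub_entProj (d : ℕ) : ((d : ℂ) • 1 - entProj d).PosSemidef := by
  have := posSemidef_sum_sq_smul_one_sub (diagVec d d fun _ => 1)
  have h : (∑ i, ‖diagVec d d (fun _ => 1) i‖ ^ 2) = (d : ℝ) := normSq_diagVec_one d
  rw [h] at this
  exact_mod_cast this

/-- The compression to the a × a block is not trace preserving; the second operator completes it to
a channel under which `S` is closed. -/
theorem isKraus_pinching (hab : a ≤ b) {U W : Matrix (Fin a) (Fin a) ℂ}
    (hU : U ∈ Matrix.unitaryGroup (Fin a) ℂ) (hW : W ∈ Matrix.unitaryGroup (Fin a) ℂ) :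
    IsKraus (fun _ : Fin 2 => U) ![embed hab * W * (embed hab)ᴴ, coembed hab] := by
  rw [Matrix.mem_unitaryGroup_iff', Matrix.star_eq_conjTranspose] at hU hW
  have h1 : (embed hab * W * (embed hab)ᴴ)ᴴ * (embed hab * W * (embed hab)ᴴ) =
      embed hab * (embed hab)ᴴ := by
    calc _ = embed hab * (Wᴴ * ((embed hab)ᴴ * embed hab) * W) * (embed hab)ᴴ := by
          simp only [Matrix.conjTranspose_mul, Matrix.conjTranspose_conjTranspose,
            Matrix.mul_assoc]
      _ = _ := by rw [embed_conjTranspose_mul, Matrix.mul_one, hW, Matrix.mul_one]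
  rw [IsKraus, Fin.sum_univ_two]
  simp only [Matrix.conjTranspose_kronecker, ← Matrix.mul_kronecker_mul, Matrix.cons_val_zero,
    Matrix.cons_val_one]
  rw [hU, h1, coembed_conjTranspose, coembed_mul_self, ← Matrix.kronecker_add, coembed,
    add_sub_cancel, Matrix.one_kronecker_one]

/-- For fixed σ, the conditions on the compressed test in `twirlClosed_maxEnt` survive twirling, so
an isotropic s + t `entProj` satisfies them too. It remains to compare two numbers. -/
theorem passProb_optimalTest_le (ha : 2 ≤ a) (hab : a ≤ b) {S : Set (Op a b)}
    (hS : S ⊆ states a b) (hK : KrausClosed S) {Ω : Op a b}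
    (hΩ : IsVerificationOperator (maxEnt a b) Ω) (hsep : IsSeparable Ω) :
    passProb (optimalTest hab) S ≤ passProb Ω S := by
  have ha0 : 0 < a := by omega
  rw [isVerificationOperator_iff] at hΩ
  have hcone := ((isSeparable_iff ha0 (by omega) Ω).1 hsep).1
  refine Real.sSup_le ?_ (passProb_nonneg hS hΩ.1)
  rintro _ ⟨σ, hσ, rfl⟩
  dsimp only
  set J := embed₂ hab with hJ
  set p := passProb Ω S
  set v : Vec a a := diagVec a a fun _ => 1
  set Ω₀ : Op a a := Jᴴ * Ω * J with hΩ₀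
  set σ₀ : Op a a := Jᴴ * σ * J with hσ₀
  have hσ₀' : σ₀.PosSemidef := (hS hσ).1.conjTranspose_mul_mul_same _
  have hcone₀ : IsSepCone Ω₀ := hcone.conj' _ _
  have hfix : Ω₀ *ᵥ v = v := by
    rw [hΩ₀, ← Matrix.mulVec_mulVec, ← Matrix.mulVec_mulVec,
      (mulVec_maxEnt_iff ha0 hab Ω).1 hΩ.2.2, Matrix.mulVec_mulVec, embed₂_conjTranspose_mul,
      Matrix.one_mulVec]
  have htr : (a : ℝ) ≤ Ω₀.trace.re := by
    have := hcone₀.re_trace_mul_entProj_le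
    rwa [entProj, trace_mul_proj, hfix, ← ofReal_normSq, normSq_diagVec_one,
      Complex.ofReal_re] at this
  -- The pinched and rotated σ is again in `S`; its part outside the block contributes a nonnegative
  -- amount and is dropped.
  have hpass : ∀ U ∈ Matrix.unitaryGroup (Fin a) ℂ,
      (Ω₀ * (conjKron U * σ₀ * (conjKron U)ᴴ)).trace.re ≤ p := by
    intro U hU
    have h1 := le_passProb hS hΩ.2.1
      (hK _ _ _ (isKraus_pinching hab hU (map_star_mem_unitaryGroup hU)) σ hσ)
    rw [krausMap, Fin.sum_univ_two, Matrix.mul_add, Matrix.trace_add, Complex.add_re] at h1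
    refine le_trans (le_trans (le_of_eq ?_) (le_add_of_nonneg_right
      (re_trace_mul_nonneg hΩ.1 ((hS hσ).1.mul_mul_conjTranspose_same _)))) h1
    have h2 : U ⊗ₖ (embed hab * U.map star * (embed hab)ᴴ) = J * conjKron U * Jᴴ := by
      rw [hJ, embed₂, conjKron, Matrix.conjTranspose_kronecker, ← Matrix.mul_kronecker_mul,
        ← Matrix.mul_kronecker_mul, Matrix.conjTranspose_one, Matrix.mul_one, Matrix.one_mul]
    simp only [Matrix.cons_val_zero, h2]
    rw [hΩ₀, hσ₀, Matrix.mul_assoc, Matrix.mul_assoc, Matrix.trace_mul_comm]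
    simp only [Matrix.conjTranspose_mul, Matrix.conjTranspose_conjTranspose, Matrix.mul_assoc]
  obtain ⟨s, t, hst1, hst2, hst3⟩ :=
    (twirlClosed_maxEnt σ₀ p).exists_isotropic_mem ha0 ⟨hfix, htr, hpass⟩
  have hsum : s + t * a = 1 := by
    have h1 := congrFun hst1 (⟨0, ha0⟩, ⟨0, ha0⟩)
    rw [Matrix.add_mulVec, Matrix.smul_mulVec, Matrix.smul_mulVec, Matrix.one_mulVec,
      entProj_mulVec] at h1
    simpa [diagVec] using h1
  have htrE : (entProj a).trace = (a : ℂ) := by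
    rw [entProj, trace_proj_eq_normSq, normSq_diagVec_one]; simp
  have htr' : (a : ℝ) ≤ s.re * (a * a) + t.re * a := by
    rw [Matrix.trace_add, Matrix.trace_smul, Matrix.trace_smul, htrE, Matrix.trace_one] at hst2
    simpa using hst2
  have hp := hst3 1 (one_mem _)
  have hone : conjKron (1 : Matrix (Fin a) (Fin a) ℂ) = 1 := by
    rw [conjKron, Matrix.map_one _ (star_zero _) (star_one _), Matrix.one_kronecker_one]
  have hτim : σ₀.trace.im = 0 := (Complex.le_def.1 hσ₀'.trace_nonneg).2.symm
  have hFim : (entProj a * σ₀).trace.im = 0 := by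
    rw [Matrix.trace_mul_comm, entProj, trace_mul_proj]
    exact (Complex.le_def.1 (hσ₀'.dotProduct_mulVec_nonneg v)).2.symm
  have hFle := re_trace_mul_nonneg (posSemidef_smul_one_sub_entProj a) hσ₀'
  have hopt : (optimalTest hab * σ).trace =
      ((a : ℂ) + 1)⁻¹ * (σ₀.trace + (entProj a * σ₀).trace) := by
    have h1 : (optimalTest hab * σ).trace = ((((a : ℂ) + 1)⁻¹ • (1 + entProj a)) * σ₀).trace := by
      rw [optimalTest, hσ₀, Matrix.mul_assoc, Matrix.mul_assoc, Matrix.trace_mul_comm]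
      simp only [Matrix.mul_assoc, hJ]
    rw [h1, Matrix.smul_mul, Matrix.trace_smul, Matrix.add_mul, Matrix.one_mul, Matrix.trace_add,
      smul_eq_mul]
  rw [hone, Matrix.conjTranspose_one, Matrix.mul_one, Matrix.one_mul, Matrix.add_mul,
    Matrix.smul_mul, Matrix.smul_mul, Matrix.one_mul, Matrix.trace_add, Matrix.trace_smul,
    Matrix.trace_smul, smul_eq_mul, smul_eq_mul, Complex.add_re, Complex.mul_re, Complex.mul_re,
    hτim, hFim, mul_zero, mul_zero, sub_zero, sub_zero] at hp
  rw [Matrix.sub_mul, Matrix.smul_mul, Matrix.one_mul, Matrix.trace_sub, Matrix.trace_smul,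
    smul_eq_mul, Complex.sub_re, ← Complex.ofReal_natCast, Complex.re_ofReal_mul] at hFle
  have hc : ((a : ℂ) + 1)⁻¹ = (((a : ℝ) + 1)⁻¹ : ℝ) := by push_cast; rfl
  rw [hopt, hc, Complex.re_ofReal_mul, Complex.add_re]
  have hsum' : s.re + t.re * a = 1 := by
    have := congrArg Complex.re hsum
    simpa using this
  have haR : (2 : ℝ) ≤ a := by exact_mod_cast ha
  generalize s.re = s at *
  generalize t.re = t at *
  generalize σ₀.trace.re = τ at *
  generalize (entProj a * σ₀).trace.re = F at *
  -- Inserting ta = 1 - s into the trace bound gives (a - 1)(s(a + 1) - 1) ≥ 0, and a ≥ 2 allows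
  -- division by a - 1.
  have hs : 1 ≤ s * (a + 1) := by
    have : (0 : ℝ) ≤ (a - 1) * (s * (a + 1) - 1) := by nlinarith
    have := nonneg_of_mul_nonneg_right this (by linarith)
    linarith
  rw [inv_mul_le_iff₀ (by positivity)]
  -- Up to a positive factor this is the excess of the isotropic pass probability over the optimal
  -- one; F ≤ aτ because `entProj` is at most a times the identity.
  have h5 : 0 ≤ (s * (a + 1) - 1) * (a * τ - F) := mul_nonneg (by linarith) (by linarith)
  have h6 : (0 : ℝ) ≤ a * (((a : ℝ) + 1) * (s * τ + t * F) - (τ + F)) := by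
    have : (a : ℝ) * (((a : ℝ) + 1) * (s * τ + t * F) - (τ + F)) =
        (s * (a + 1) - 1) * (a * τ - F) + (a + 1) * F * (s + t * a - 1) := by ring
    rw [this, hsum', sub_self, mul_zero, add_zero]
    exact h5
  have h7 := nonneg_of_mul_nonneg_right h6 (by linarith)
  nlinarith

/-! ### Comparison of the separation probabilities -/

theorem partialTraceB_proj_maxEnt (hab : a ≤ b) :
    partialTraceB (proj (maxEnt a b)) = (((a : ℝ)⁻¹ : ℝ) : ℂ) • 1 := by
  ext i k
  have h0 : (((Real.sqrt a)⁻¹ : ℝ) : ℂ) * (((Real.sqrt a)⁻¹ : ℝ) : ℂ) = (((a : ℝ)⁻¹ : ℝ) : ℂ) := by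
    rw [← Complex.ofReal_mul, ← mul_inv, Real.mul_self_sqrt (Nat.cast_nonneg a)]
  simp only [partialTraceB, Matrix.of_apply, proj, Matrix.vecMulVec_apply, Pi.star_apply, maxEnt,
    Matrix.smul_apply, smul_eq_mul]
  rw [Finset.sum_eq_single (Fin.castLE hab i)]
  · by_cases h : i = k
    · subst h
      simp only [Fin.val_castLE, if_true, RCLike.star_def, Complex.conj_ofReal, h0,
        Matrix.one_apply_eq, mul_one]
    · have h' : ¬ ((k : ℕ) = i) := fun e => h (Fin.ext e.symm)
      simp [h, h']
  · intro j _ hj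
    rw [if_neg, zero_mul]
    exact fun e => hj (Fin.ext e.symm)
  · simp

theorem schmidtVector_maxEnt (hab : a ≤ b) (j : Fin a) :
    schmidtVector (maxEnt a b) j = (a : ℝ)⁻¹ := by
  have key : ∀ i, (isHermitian_partialTraceB_proj (maxEnt a b)).eigenvalues i = (a : ℝ)⁻¹ := by
    intro i
    have h := (isHermitian_partialTraceB_proj (maxEnt a b)).eigenvalues_mem_spectrum_real i
    have : Nonempty (Fin a) := ⟨i⟩
    generalize (isHermitian_partialTraceB_proj (maxEnt a b)).eigenvalues i = x at h ⊢
    rwa [partialTraceB_proj_maxEnt hab, Complex.coe_smul, ← Algebra.algebraMap_eq_smul_one,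
      spectrum.scalar_eq] at h
  exact key _

/-- The leading entries of a nonincreasing vector have at least the overall average; `y k` separates
the two groups. Hence the flat vector is majorized by every probability vector. -/
theorem card_mul_sum_Iic_le {d : ℕ} {y : Fin d → ℝ} (hy : Antitone y) (k : Fin d) :
    ((Finset.Iic k).card : ℝ) * ∑ j, y j ≤ d * ∑ j ∈ Finset.Iic k, y j := by
  classical
  have h1 : ((Finset.Iic k).card : ℝ) * y k ≤ ∑ j ∈ Finset.Iic k, y j := by
    rw [← nsmul_eq_mul]
    exact Finset.card_nsmul_le_sum _ _ _ fun j hj => hy (Finset.mem_Iic.1 hj)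
  have h2 : ∑ j ∈ (Finset.Iic k)ᶜ, y j ≤ ((Finset.Iic k)ᶜ.card : ℝ) * y k := by
    rw [← nsmul_eq_mul]
    refine Finset.sum_le_card_nsmul _ _ _ fun j hj => hy ?_
    rw [Finset.mem_compl, Finset.mem_Iic, not_le] at hj
    exact hj.le
  have h3 := Finset.sum_add_sum_compl (Finset.Iic k) y
  have h4 : ((Finset.Iic k).card : ℝ) + (Finset.Iic k)ᶜ.card = d := by
    have := Finset.card_add_card_compl (Finset.Iic k)
    rw [Fintype.card_fin] at this
    exact_mod_cast this
  rw [← h3, ← h4]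
  have h5 : ((Finset.Iic k).card : ℝ) * ∑ j ∈ (Finset.Iic k)ᶜ, y j ≤
      (Finset.Iic k)ᶜ.card * ∑ j ∈ Finset.Iic k, y j := by
    calc _ ≤ ((Finset.Iic k).card : ℝ) * (((Finset.Iic k)ᶜ.card : ℝ) * y k) := by gcongr
      _ = (Finset.Iic k)ᶜ.card * ((Finset.Iic k).card * y k) := by ring
      _ ≤ _ := by gcongr
  linarith

theorem majorized_maxEnt (ha : 0 < a) (hab : a ≤ b) {Ψ : Vec a b} (hΨ : IsPure Ψ) :
    Majorized (schmidtVector (maxEnt a b)) (schmidtVector Ψ) := by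
  have h1 : ∑ j, schmidtVector Ψ j = 1 := (sum_schmidtVector hab Ψ).trans hΨ
  have ha' : (0 : ℝ) < a := by exact_mod_cast ha
  rw [Majorized, sortDesc_eq_self (antitone_schmidtVector _),
    sortDesc_eq_self (antitone_schmidtVector _), h1]
  simp only [schmidtVector_maxEnt hab]
  constructor
  · intro k
    have := card_mul_sum_Iic_le (antitone_schmidtVector Ψ) k
    rw [h1, mul_one] at this
    rwa [Finset.sum_const, nsmul_eq_mul, ← div_eq_mul_inv, div_le_iff₀' ha']
  · simp [ha'.ne']

theorem Psep_maxEnt_le (ha : 0 < a) (hab : a ≤ b) {S : Set (Op a b)} (hS : S ⊆ states a b)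
    (hK : KrausClosed S) {Ψ : Vec a b} (hΨ : IsPure Ψ) : Psep (maxEnt a b) S ≤ Psep Ψ S :=
  Psep_le_of_LOCCTransforms ha (ha.trans_le hab) hS hK
    (.of_majorized hab (isPure_maxEnt ha hab) hΨ (majorized_maxEnt ha hab hΨ))

theorem PLC_maxEnt_eq (ha : 2 ≤ a) (hab : a ≤ b) {S : Set (Op a b)} (hS : S ⊆ states a b)
    (hK : KrausClosed S) : PLC (maxEnt a b) S = Psep (maxEnt a b) S := by
  have ha0 : 0 < a := by omega
  refine le_antisymm ?_ (Psep_le_PLC ha0 (by omega) hS _)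
  refine le_csInf ⟨_, optimalTest hab, isVerificationOperator_optimalTest ha0 hab,
    (isSeparable_iff ha0 (by omega) _).2 (isLocal_optimalTest ha0 hab).isSepCone, rfl⟩ ?_
  rintro _ ⟨Ω, hΩ, hsep, rfl⟩
  exact (csInf_le (bddBelow_of_passProb hS) ⟨_, isVerificationOperator_optimalTest ha0 hab,
    isLocal_optimalTest ha0 hab, rfl⟩).trans (passProb_optimalTest_le ha hab hS hK hΩ hsep)

/-- An infimum over the empty set would be 0 in ℝ, so inclusion of the strategy classes is not
enough; a homogeneous local strategy must exist. -/
theorem PsepH_le_PLCH (ha : 0 < a) (hab : a ≤ b) {S : Set (Op a b)} (hS : S ⊆ states a b)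
    {Ψ : Vec a b} (hΨ : IsPure Ψ) : PsepH Ψ S ≤ PLCH Ψ S := by
  obtain ⟨Ω₀, h1, h2, h3⟩ := exists_isHomogeneous_isLocal hab hΨ
  refine le_csInf ⟨_, Ω₀, h1, h2, h3, rfl⟩ ?_
  rintro _ ⟨Ω, hΩ, hh, hl, rfl⟩
  refine csInf_le ⟨0, ?_⟩
    ⟨Ω, hΩ, hh, (isSeparable_iff ha (ha.trans_le hab) _).2 hl.isSepCone, rfl⟩
  rintro _ ⟨T, hT, -, -, rfl⟩
  exact passProb_nonneg hS ((isVerificationOperator_iff _ _).1 hT).1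

theorem Psep_le_PsepH (ha : 0 < a) (hab : a ≤ b) {S : Set (Op a b)} (hS : S ⊆ states a b)
    {Ψ : Vec a b} (hΨ : IsPure Ψ) : Psep Ψ S ≤ PsepH Ψ S := by
  obtain ⟨Ω₀, h1, h2, h3⟩ := exists_isHomogeneous_isLocal hab hΨ
  refine le_csInf ⟨_, Ω₀, h1, h2, (isSeparable_iff ha (ha.trans_le hab) _).2 h3.isSepCone, rfl⟩ ?_
  rintro _ ⟨Ω, hΩ, -, hs, rfl⟩
  exact csInf_le (bddBelow_of_passProb hS) ⟨Ω, hΩ, hs, rfl⟩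

/-- Local unitaries are LOCC transformations in both directions, which gives invariance;
majorization gives a transformation in one direction. -/
theorem schurConvex_of_LOCCNondecreasing (hab : a ≤ b) {f : Vec a b → ℝ}
    (hf : LOCCNondecreasing f) : SchurConvex f := by
  refine ⟨fun U hU V hV Ψ hΨ => ?_, fun Ψ Υ hΨ hΥ h => hf Ψ Υ hΨ hΥ (.of_majorized hab hΨ hΥ h)⟩
  have hUV : IsPure ((U ⊗ₖ V) *ᵥ Ψ) :=
    (normSq_mulVec_of_unitary (kronecker_conjTranspose_mul_self hU hV) Ψ).trans hΨ
  refine le_antisymm (hf _ _ hUV hΨ ?_) (hf _ _ hΨ hUV ?_)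
  · refine .of_unitary hUV hΨ (unitary_conjTranspose_mem hU) (unitary_conjTranspose_mem hV) ?_
    rw [← Matrix.conjTranspose_kronecker, Matrix.mulVec_mulVec,
      kronecker_conjTranspose_mul_self hU hV, Matrix.one_mulVec]
  · exact .of_unitary hΨ hUV hU hV rfl

theorem separation_probabilities (ha : 2 ≤ a) (hab : a ≤ b) {S : Set (Op a b)}
    (hS : S ⊆ states a b) (hK : KrausClosed S) :
    SchurConvex (fun Ψ : Vec a b => PLC Ψ S) ∧ SchurConvex (fun Ψ : Vec a b => Psep Ψ S) ∧
    LOCCNondecreasing (fun Ψ : Vec a b => PLC Ψ S) ∧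
    LOCCNondecreasing (fun Ψ : Vec a b => Psep Ψ S) ∧
    PLC (maxEnt a b) S = Psep (maxEnt a b) S ∧
    ∀ Ψ : Vec a b, IsPure Ψ →
      (Psep (maxEnt a b) S ≤ Psep Ψ S ∧ Psep Ψ S ≤ PLC Ψ S) ∧
      (Psep (maxEnt a b) S ≤ PsepH Ψ S ∧ PsepH Ψ S ≤ PLCH Ψ S) := by
  have ha0 : 0 < a := by omega
  have h1 : LOCCNondecreasing (fun Ψ : Vec a b => PLC Ψ S) :=
    fun Ψ Υ _ _ h => PLC_le_of_LOCCTransforms hS hK h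
  have h2 : LOCCNondecreasing (fun Ψ : Vec a b => Psep Ψ S) :=
    fun Ψ Υ _ _ h => Psep_le_of_LOCCTransforms ha0 (ha0.trans_le hab) hS hK h
  refine ⟨schurConvex_of_LOCCNondecreasing hab h1, schurConvex_of_LOCCNondecreasing hab h2, h1, h2,
    PLC_maxEnt_eq ha hab hS hK, fun Ψ hΨ => ?_⟩
  have h3 := Psep_maxEnt_le ha0 hab hS hK hΨ
  exact ⟨⟨h3, Psep_le_PLC ha0 (ha0.trans_le hab) hS Ψ⟩, h3.trans (Psep_le_PsepH ha0 hab hS hΨ),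
    PsepH_le_PLCH ha0 hab hS hΨ⟩

end EntCert

end

theorem mainTheorem2 (dA dB : ℕ) (hd : dA ≤ dB) (r : ℕ) (hr1 : 1 ≤ r) (hr : r ≤ dA - 1)
    (E : ℝ) (hE0 : 0 ≤ E) (hE : E < ((dA : ℝ) - r) / dA)
    (S : Set (EntCert.Op dA dB))
    (hS : S = EntCert.schmidtSet dA dB r ∨ S = EntCert.entSet dA dB r E) :
    EntCert.SchurConvex (fun Ψ : EntCert.Vec dA dB => EntCert.PLC Ψ S) ∧
    EntCert.SchurConvex (fun Ψ : EntCert.Vec dA dB => EntCert.Psep Ψ S) ∧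
    EntCert.LOCCNondecreasing (fun Ψ : EntCert.Vec dA dB => EntCert.PLC Ψ S) ∧
    EntCert.LOCCNondecreasing (fun Ψ : EntCert.Vec dA dB => EntCert.Psep Ψ S) ∧
    EntCert.PLC (EntCert.maxEnt dA dB) S = EntCert.Psep (EntCert.maxEnt dA dB) S ∧
    ∀ Ψ : EntCert.Vec dA dB, EntCert.IsPure Ψ →
      (EntCert.Psep (EntCert.maxEnt dA dB) S ≤ EntCert.Psep Ψ S ∧
        EntCert.Psep Ψ S ≤ EntCert.PLC Ψ S) ∧
      (EntCert.Psep (EntCert.maxEnt dA dB) S ≤ EntCert.PsepH Ψ S ∧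
        EntCert.PsepH Ψ S ≤ EntCert.PLCH Ψ S) := by
  have ha : 2 ≤ dA := by omega
  rcases hS with rfl | rfl
  · exact EntCert.separation_probabilities ha hd (EntCert.schmidtSet_subset_states dA dB r)
      (EntCert.krausClosed_schmidtSet dA dB r)
  · exact EntCert.separation_probabilities ha hd (fun _ h => h.1)
      (EntCert.krausClosed_entSet hd r E)
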